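/- Throughout, everything is $C^\infty$. Let $M$ be an $m$-dimensional manifold and let $p:\mathfrak{T}M\to M$ be its *big tangent manifold*, the total space of $TM\oplus T^*M$, with points $(x,y,z)$, $y\in T_xM$, $z\in T_x^*M$. Its vertical bundle is $\mathcal{V}=\ker p_*=\mathcal{V}_1\oplus\mathcal{V}_2$, where $\mathcal{V}_1\approx p^{-1}(TM)$, $\mathcal{V}_2\approx p^{-1}(T^*M)\approx\mathcal{V}_1^*$, and it carries the metric $g((Y,\alpha),(Y',\alpha'))=\frac12(\alpha(Y')+\alpha'(Y))$. A *double field* on $M$ is a triple $\Phi=(\mathcal{H},\sigma,\psi)$, where $\mathcal{H}$ is a horizontal bundle, $T\mathfrak{T}M=\mathcal{H}\oplus\mathcal{V}$, $\sigma$ is a non-degenerate symmetric metric (of any signature) on $\mathcal{V}_1$ and $\psi$ is a $2$-form on $\mathcal{V}_1$. Projections refer to the decomposition $T\mathfrak{T}M=\mathcal{H}\oplus\mathcal{V}_1\oplus\mathcal{V}_2$; $\flat_\sigma Y=\sigma(Y,\cdot)$, $\sharp_\sigma=\flat_\sigma^{-1}$, $\flat_\psi Y=\psi(Y,\cdot)$.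 Put $l=-\sharp_\sigma\flat_\psi$, $$\phi(Y,\alpha)=\bigl(lY+\sharp_\sigma\alpha,\ \flat_\sigma(\mathrm{Id}-(\sharp_\sigma\flat_\psi)^2)Y+\alpha\circ l\bigr),\qquad g_{\mathcal V}(Z,Z')=2g(\phi Z,Z').$$ Then $\phi^2=\mathrm{Id}$ and $g_{\mathcal V}$ is a metric on $\mathcal{V}$. Let $\mathcal{U}_\pm$ be the $(\pm1)$-eigenbundles of $\phi$, $pr_{\mathcal{U}_\pm}=\frac12(\mathrm{Id}\pm\phi)$, and let $\iota_\pm:\mathcal{V}_1\to\mathcal{U}_\pm$, $\iota_\pm Y=(Y,(\flat_\psi\pm\flat_\sigma)Y)$, be the inverses of $pr_{\mathcal{V}_1}|_{\mathcal{U}_\pm}$. A *double metric connection* is a connection on the bundle $\mathcal{V}\to\mathfrak{T}M$ that preserves $g$ and $g_{\mathcal V}$. A connection $D$ on $\mathcal V$ *corresponds to the pair* $(D^+,D^-)$ of connections on $\mathcal{V}_1$ if $D_Z(\iota_\pm Y)=\iota_\pm(D^\pm_ZY)$ for $Z\in\chi(\mathfrak{T}M)$, $Y\in\Gamma\mathcal{V}_1$.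 *Construction.* Below, $Z$ is a vector field on $\mathfrak{T}M$ and $Y$ a section of $\mathcal{V}_1$. 1. Let $g_\sigma$ be the metric of $\mathfrak{T}M$ for which $\mathcal{H},\mathcal{V}_1,\mathcal{V}_2$ are orthogonal and which is given on $\mathcal{H}\approx p^{-1}(TM)\approx\mathcal{V}_1$, on $\mathcal{V}_1$ and on $\mathcal{V}_2\approx\mathcal{V}_1^*$ by $\sigma$ (on $\mathcal{V}_1^*$: by the dual metric $\sigma^{-1}$), and let $D^\sigma$ be its Levi-Civita connection. Let $D'^0$ be the connection on $\mathcal{V}_1$ with $D'^0_ZY=pr_{\mathcal{V}_1}D^\sigma_ZY$ for $Z\in\mathcal{V}_1$, and $D'^0_ZY=pr_{\mathcal{V}_1}[Z,Y]$ for $Z\in\Gamma\mathcal{V}_2$ and for $Z\in\Gamma\mathcal{H}$. The *metrization* of a connection $D'$ on $\mathcal{V}_1$ is $D'_ZY+\frac12\sharp_\sigma\bigl((D'_Z\sigma)(Y,\cdot)\bigr)$. Let $D^0$ be the metrization of $D'^0$ and $\mathcal{D}^0$ the connection on $\mathcal{V}$ corresponding to $(D^0,D^0)$. 2. Let $D'^\pm_ZY=D^0_ZY\pm\frac12\sharp_\sigma\bigl((d_{\mathcal{V}_1}\psi)(pr_{\mathcal{V}_1}Z,Y,\cdot)\bigr)$,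 where $d_{\mathcal{V}_1}$ is the exterior differential along the leaves of $\mathcal{V}_1$, and let $D^\pm$ be the metrization of $D'^\pm$. 3. For a connection $\nabla$ on $\mathcal V$ and $s,s'\in\Gamma\mathcal{V}$ define $s\wedge_\nabla s'\in\Gamma\mathcal V$ by $g_{\mathcal V}(w,s\wedge_\nabla s')=\frac12\bigl[g_{\mathcal V}(s,\nabla_ws')-g_{\mathcal V}(s',\nabla_ws)\bigr]$ for all $w\in\mathcal V$, the *metric bracket* $[s,s']_{g_{\mathcal V}}=\mathcal{D}^0_ss'-\mathcal{D}^0_{s'}s-s\wedge_{\mathcal{D}^0}s'$, and the *Gualtieri torsion* $$\tau_\nabla(s,s',s'')=g_{\mathcal V}\bigl(\nabla_ss'-\nabla_{s'}s-[s,s']_{g_{\mathcal V}}-s\wedge_\nabla s',\,s''\bigr).$$ 4. Let $\tilde D^\pm$ be the connections on $\mathcal{V}_1$ with $\tilde D^\pm_X=D^\pm_X$ for $X\in\mathcal{H}$ and $$\tilde D^\pm_sY=D^\pm_{pr_{\mathcal{U}_\pm}s}Y+pr_{\mathcal{V}_1}pr_{\mathcal{U}_\pm}[pr_{\mathcal{U}_\mp}s,\iota_\pm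 Y]_{g_{\mathcal V}}\qquad(s\in\Gamma\mathcal{V}),$$ and $\tilde{\mathcal D}$ the connection on $\mathcal{V}$ corresponding to $(\tilde D^+,\tilde D^-)$. 5. The *field-adapted connection* $\bar{\mathcal D}$ of $\Phi$ is the connection on $\mathcal V$ with $\bar{\mathcal D}_X=\tilde{\mathcal D}_X$ for $X\in\mathcal{H}$ and $$g_{\mathcal V}\bigl(\bar{\mathcal D}_ss'-\tilde{\mathcal D}_ss',\,s''\bigr)=-\tfrac13\,\tau_{\tilde{\mathcal D}}(s,s',s'')\qquad(s,s',s''\in\Gamma\mathcal V).$$ **Proposition 5.7.** For every double field $\Phi$ the construction can be carried out: all the connections above exist. The connection $\tilde{\mathcal D}$ is a smooth double metric connection and $\tau_{\tilde{\mathcal D}}$ is a totally skew-symmetric vertical tensor field. The field-adapted connection $\bar{\mathcal D}$ is a smooth double metric connection with vanishing Gualtieri torsion, $\tau_{\bar{\mathcal D}}=0$. The construction is invariant: $\bar{\mathcal D}$ is uniquely determined by $\Phi$, and if $f:M\to N$ is a local diffeomorphism, $F:\mathfrak{T}M\to\mathfrak{T}N$, $F(x,y,z)=(f(x),df_x\,y,z\circ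 df_x^{-1})$, is its lift, and $\Phi$ is the pull-back by $F$ of a double field $\Phi'$ on $N$, then $F$ carries $\bar{\mathcal D}$ to the field-adapted connection $\bar{\mathcal D}'$ of $\Phi'$, i.e. $\bar{\mathcal D}'_{F_*Z}s=F_*\bigl(\bar{\mathcal D}_Z(F^*s)\bigr)$ for every tangent vector $Z$ of $\mathfrak{T}M$ and every section $s$ of the vertical bundle of $\mathfrak{T}N$. -/

import Mathlib

set_option maxSynthPendingDepth 3

open Bundle
open scoped Manifold ContDiff

noncomputable section

namespace BigTangent

section Pullback

/-! Instances on the fibres of pullback bundles. -/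

variable {B B' : Type*} (f : B' → B) (F : B → Type*)

instance [∀ x : B, AddCommGroup (F x)] (x : B') : AddCommGroup ((f *ᵖ F) x) :=
  inferInstanceAs <| AddCommGroup (F (f x))

instance [∀ x : B, AddCommGroup (F x)] [∀ x, TopologicalSpace (F x)]
    [∀ x, IsTopologicalAddGroup (F x)] (x : B') : IsTopologicalAddGroup ((f *ᵖ F) x) :=
  inferInstanceAs <| IsTopologicalAddGroup (F (f x))

instance [∀ x : B, AddCommGroup (F x)] [∀ x, TopologicalSpace (F x)]
    [∀ x, Module ℝ (F x)] [∀ x, ContinuousSMul ℝ (F x)] (x : B') :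
    ContinuousSMul ℝ ((f *ᵖ F) x) :=
  inferInstanceAs <| ContinuousSMul ℝ (F (f x))

end Pullback

/-! ### The big tangent manifold and its vertical bundle

`M` is a smooth manifold without boundary, modelled on the finite dimensional space `E`. -/

section Spaces

variable (E : Type*) [NormedAddCommGroup E] [NormedSpace ℝ E]
  (M : Type*) [TopologicalSpace M] [ChartedSpace E M] [IsManifold 𝓘(ℝ, E) ∞ M]

/-- The fibre `T_x M ⊕ T_x^* M` of the big tangent bundle. -/
abbrev Fibre (x : M) : Type _ :=
  TangentSpace 𝓘(ℝ, E) x × (TangentSpace 𝓘(ℝ, E) x →L[ℝ] Trivial M ℝ x)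

/-- The big tangent manifold: the total space of `TM ⊕ T^*M`; its points are triples `(x, y, z)`
with `y ∈ T_x M` and `z ∈ T_x^* M`. -/
abbrev Total : Type _ := TotalSpace (E × (E →L[ℝ] ℝ)) (Fibre E M)

/-- The model of the big tangent manifold. -/
abbrev model := (𝓘(ℝ, E)).prod 𝓘(ℝ, E × (E →L[ℝ] ℝ))

/-- The projection `p` of the big tangent manifold on `M`. -/
def p : C^∞⟮model E, Total E M; 𝓘(ℝ, E), M⟯ :=
  ⟨TotalSpace.proj, contMDiff_proj (Fibre E M)⟩

instance : TopologicalSpace (Total E M) := inferInstance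

instance : ChartedSpace (ModelProd E (E × (E →L[ℝ] ℝ))) (Total E M) := inferInstance

instance : IsManifold (model E) ∞ (Total E M) := inferInstance

instance : IsManifold (model E) 1 (Total E M) := inferInstance

instance : IsManifold (model E) 2 (Total E M) := inferInstance

/-- The bundle `V₁ ≈ p⁻¹(TM)` over the big tangent manifold. -/
def V1 : Total E M → Type _ := (p E M) *ᵖ (TangentSpace 𝓘(ℝ, E) : M → Type _)

/-- The vertical bundle `V ≈ p⁻¹(TM ⊕ T^*M)`; `vlift` below is its embedding in the tangent
bundle of the big tangent manifold. -/
def V : Total E M → Type _ := (p E M) *ᵖ (Fibre E M)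

/-! `V₁` and `V` carry the smooth vector bundle structures of pullback bundles. -/

instance (u : Total E M) : AddCommGroup (V1 E M u) :=
  inferInstanceAs (AddCommGroup (((p E M) *ᵖ (TangentSpace 𝓘(ℝ, E) : M → Type _)) u))

instance (u : Total E M) : Module ℝ (V1 E M u) :=
  inferInstanceAs (Module ℝ (((p E M) *ᵖ (TangentSpace 𝓘(ℝ, E) : M → Type _)) u))

instance (u : Total E M) : TopologicalSpace (V1 E M u) :=
  inferInstanceAs (TopologicalSpace (((p E M) *ᵖ (TangentSpace 𝓘(ℝ, E) : M → Type _)) u))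

instance (u : Total E M) : IsTopologicalAddGroup (V1 E M u) :=
  inferInstanceAs (IsTopologicalAddGroup (((p E M) *ᵖ (TangentSpace 𝓘(ℝ, E) : M → Type _)) u))

instance (u : Total E M) : ContinuousSMul ℝ (V1 E M u) :=
  inferInstanceAs (ContinuousSMul ℝ (((p E M) *ᵖ (TangentSpace 𝓘(ℝ, E) : M → Type _)) u))

instance [FiniteDimensional ℝ E] (u : Total E M) : FiniteDimensional ℝ (V1 E M u) :=
  inferInstanceAs (FiniteDimensional ℝ E)

instance : TopologicalSpace (TotalSpace E (V1 E M)) :=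
  inferInstanceAs (TopologicalSpace
    (TotalSpace E ((p E M) *ᵖ (TangentSpace 𝓘(ℝ, E) : M → Type _))))

instance : FiberBundle E (V1 E M) :=
  inferInstanceAs (FiberBundle E ((p E M) *ᵖ (TangentSpace 𝓘(ℝ, E) : M → Type _)))

instance : VectorBundle ℝ E (V1 E M) :=
  inferInstanceAs (VectorBundle ℝ E ((p E M) *ᵖ (TangentSpace 𝓘(ℝ, E) : M → Type _)))

instance : ContMDiffVectorBundle ∞ E (V1 E M) (model E) :=
  inferInstanceAs
    (ContMDiffVectorBundle ∞ E ((p E M) *ᵖ (TangentSpace 𝓘(ℝ, E) : M → Type _)) (model E))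

instance (u : Total E M) : AddCommGroup (V E M u) :=
  inferInstanceAs (AddCommGroup (((p E M) *ᵖ (Fibre E M)) u))

instance (u : Total E M) : Module ℝ (V E M u) :=
  inferInstanceAs (Module ℝ (((p E M) *ᵖ (Fibre E M)) u))

instance (u : Total E M) : TopologicalSpace (V E M u) :=
  inferInstanceAs (TopologicalSpace (((p E M) *ᵖ (Fibre E M)) u))

instance (u : Total E M) : IsTopologicalAddGroup (V E M u) :=
  inferInstanceAs (IsTopologicalAddGroup (((p E M) *ᵖ (Fibre E M)) u))

instance (u : Total E M) : ContinuousSMul ℝ (V E M u) :=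
  inferInstanceAs (ContinuousSMul ℝ (((p E M) *ᵖ (Fibre E M)) u))

instance [FiniteDimensional ℝ E] (u : Total E M) : FiniteDimensional ℝ (V E M u) :=
  inferInstanceAs (FiniteDimensional ℝ (E × (E →L[ℝ] ℝ)))

instance : TopologicalSpace (TotalSpace (E × (E →L[ℝ] ℝ)) (V E M)) :=
  inferInstanceAs (TopologicalSpace (TotalSpace (E × (E →L[ℝ] ℝ)) ((p E M) *ᵖ (Fibre E M))))

instance : FiberBundle (E × (E →L[ℝ] ℝ)) (V E M) :=
  inferInstanceAs (FiberBundle (E × (E →L[ℝ] ℝ)) ((p E M) *ᵖ (Fibre E M)))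

instance : VectorBundle ℝ (E × (E →L[ℝ] ℝ)) (V E M) :=
  inferInstanceAs (VectorBundle ℝ (E × (E →L[ℝ] ℝ)) ((p E M) *ᵖ (Fibre E M)))

instance : ContMDiffVectorBundle ∞ (E × (E →L[ℝ] ℝ)) (V E M) (model E) :=
  inferInstanceAs
    (ContMDiffVectorBundle ∞ (E × (E →L[ℝ] ℝ)) ((p E M) *ᵖ (Fibre E M)) (model E))

/-- Connections on `V₁`. -/
abbrev Conn1 := CovariantDerivative (model E) E (V1 E M)

/-- Connections on the vertical bundle `V`. -/
abbrev ConnV := CovariantDerivative (model E) (E × (E →L[ℝ] ℝ)) (V E M)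

/-- Linear connections on the big tangent manifold. -/
abbrev ConnT := CovariantDerivative (model E) (E × (E × (E →L[ℝ] ℝ)))
  (TangentSpace (model E) : Total E M → Type _)

end Spaces

section Vertical

variable {E : Type*} [NormedAddCommGroup E] [NormedSpace ℝ E]
  {M : Type*} [TopologicalSpace M] [ChartedSpace E M] [IsManifold 𝓘(ℝ, E) ∞ M]

/-- The inclusion `V₁ → V`. -/
def inclV1 (u : Total E M) : V1 E M u →L[ℝ] V E M u :=
  ContinuousLinearMap.inl ℝ (TangentSpace 𝓘(ℝ, E) u.proj) (TangentSpace 𝓘(ℝ, E) u.proj →L[ℝ] ℝ)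

/-- The inclusion `V₂ = V₁^* → V`. -/
def inclV2 (u : Total E M) : (V1 E M u →L[ℝ] ℝ) →L[ℝ] V E M u :=
  ContinuousLinearMap.inr ℝ (TangentSpace 𝓘(ℝ, E) u.proj) (TangentSpace 𝓘(ℝ, E) u.proj →L[ℝ] ℝ)

/-- The projection `V → V₁`. -/
def prV1 (u : Total E M) : V E M u →L[ℝ] V1 E M u :=
  ContinuousLinearMap.fst ℝ (TangentSpace 𝓘(ℝ, E) u.proj) (TangentSpace 𝓘(ℝ, E) u.proj →L[ℝ] ℝ)

/-- The projection `V → V₂ = V₁^*`. -/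
def prV2 (u : Total E M) : V E M u →L[ℝ] (V1 E M u →L[ℝ] ℝ) :=
  ContinuousLinearMap.snd ℝ (TangentSpace 𝓘(ℝ, E) u.proj) (TangentSpace 𝓘(ℝ, E) u.proj →L[ℝ] ℝ)

section Components

variable (u : Total E M) (Y : V1 E M u) (a : V1 E M u →L[ℝ] ℝ) (w : V E M u)

theorem prV1_inclV1 : prV1 u (inclV1 u Y) = Y := rfl

theorem prV2_inclV1 : prV2 u (inclV1 u Y) = 0 := rfl

theorem prV1_inclV2 : prV1 u (inclV2 u a) = 0 := rfl

theorem prV2_inclV2 : prV2 u (inclV2 u a) = a := rfl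

theorem V_ext {u : Total E M} {w w' : V E M u} (h1 : prV1 u w = prV1 u w')
    (h2 : prV2 u w = prV2 u w') : w = w' :=
  Prod.ext h1 h2

end Components

/-- The vertical lift of `T_x M ⊕ T_x^* M` into the tangent space at `u = (x, y, z)`: the
differential at `(y, z)` of the inclusion `w ↦ (x, w)` of the fibre over `x`. -/
def vlift (u : Total E M) : V E M u →L[ℝ] TangentSpace (model E) u :=
  mfderiv 𝓘(ℝ, E × (E →L[ℝ] ℝ)) (model E)
    (fun w : E × (E →L[ℝ] ℝ) => (⟨u.proj, w⟩ : Total E M)) u.2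

/-- The para-Hermitian metric `g((Y, α), (Y', α')) = (α(Y') + α'(Y)) / 2` of `V`. -/
def g (u : Total E M) : LinearMap.BilinForm ℝ (V E M u) :=
  LinearMap.mk₂ ℝ (fun w w' => (prV2 u w (prV1 u w') + prV2 u w' (prV1 u w)) / 2)
    (fun a b c => by simp; ring) (fun a b c => by simp; ring)
    (fun a b c => by simp; ring) (fun a b c => by simp; ring)

theorem g_apply (u : Total E M) (w w' : V E M u) :
    g u w w' = (prV2 u w (prV1 u w') + prV2 u w' (prV1 u w)) / 2 := rfl

/-- Differentiability of sections of `V₁` at a point. -/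
def Diff1 (Y : Π u, V1 E M u) (u : Total E M) : Prop :=
  MDifferentiableAt (model E) ((model E).prod 𝓘(ℝ, E)) (fun v => TotalSpace.mk' E v (Y v)) u

/-- Differentiability of sections of `V` at a point. -/
def DiffV (s : Π u, V E M u) (u : Total E M) : Prop :=
  MDifferentiableAt (model E) ((model E).prod 𝓘(ℝ, E × (E →L[ℝ] ℝ)))
    (fun v => TotalSpace.mk' (E × (E →L[ℝ] ℝ)) v (s v)) u

/-- Differentiability of vector fields on the big tangent manifold at a point. -/
def DiffT (X : Π u : Total E M, TangentSpace (model E) u) (u : Total E M) : Prop :=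
  MDifferentiableAt (model E) ((model E).prod 𝓘(ℝ, E × (E × (E →L[ℝ] ℝ))))
    (fun v => TotalSpace.mk' (E × (E × (E →L[ℝ] ℝ))) v (X v)) u

/-- The derivative of a function on the big tangent manifold in the direction `Z`. -/
def dirDeriv (f : Total E M → ℝ) (u : Total E M) (Z : TangentSpace (model E) u) : ℝ :=
  mvfderiv (model E) f u Z

/-- A section of `V₁` seen as a vector field on the big tangent manifold. -/
def field1 (Y : Π u, V1 E M u) (u : Total E M) : TangentSpace (model E) u :=
  vlift u (inclV1 u (Y u))

end Vertical

/-! ### Smooth connections and metric connections -/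

section Connections

variable {E : Type*} [NormedAddCommGroup E] [NormedSpace ℝ E]
  {M : Type*} [TopologicalSpace M] [ChartedSpace E M] [IsManifold 𝓘(ℝ, E) ∞ M]

/-- A connection on `V` is smooth if it sends smooth sections over any open set to smooth
sections. -/
def IsSmooth (D : ConnV E M) : Prop :=
  ∀ U : Set (Total E M), IsOpen U →
    ContMDiffCovariantDerivativeOn (E × (E →L[ℝ] ℝ)) ∞ D.toFun U

/-- The connection `D` on `V` preserves the bilinear form `b` of `V`. -/
def PreservesV (D : ConnV E M) (b : Π u, V E M u → V E M u → ℝ) : Prop :=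
  ∀ (u : Total E M) (s s' : Π u, V E M u), DiffV s u → DiffV s' u →
    ∀ Z : TangentSpace (model E) u,
      dirDeriv (fun v => b v (s v) (s' v)) u Z = b u (D s u Z) (s' u) + b u (s u) (D s' u Z)

/-- The linear connection `D` on the big tangent manifold preserves the bilinear form `b`. -/
def PreservesT (D : ConnT E M)
    (b : Π u : Total E M, TangentSpace (model E) u → TangentSpace (model E) u → ℝ) : Prop :=
  ∀ (u : Total E M) (X X' : Π u : Total E M, TangentSpace (model E) u), DiffT X u → DiffT X' u →
    ∀ Z : TangentSpace (model E) u,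
      dirDeriv (fun v => b v (X v) (X' v)) u Z = b u (D X u Z) (X' u) + b u (X u) (D X' u Z)

end Connections

/-! ### Double fields -/

section Fields

variable (E : Type*) [NormedAddCommGroup E] [NormedSpace ℝ E]
  (M : Type*) [TopologicalSpace M] [ChartedSpace E M] [IsManifold 𝓘(ℝ, E) ∞ M]

/-- A horizontal bundle, i.e. a smooth complement of the vertical bundle in the tangent bundle of
the big tangent manifold, given by the smooth projection `vert` of the tangent bundle on the
vertical bundle along it. -/
structure HorizontalBundle where
  /-- the projection `pr_V` -/
  vert : Π u : Total E M, TangentSpace (model E) u →L[ℝ] V E M u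
  vert_vlift : ∀ (u : Total E M) (w : V E M u), vert u (vlift u w) = w
  smooth : ContMDiff (model E)
    ((model E).prod 𝓘(ℝ, (E × (E × (E →L[ℝ] ℝ))) →L[ℝ] (E × (E →L[ℝ] ℝ)))) ∞
    (fun u => TotalSpace.mk' ((E × (E × (E →L[ℝ] ℝ))) →L[ℝ] (E × (E →L[ℝ] ℝ)))
      (E := fun u : Total E M => TangentSpace (model E) u →L[ℝ] V E M u) u (vert u))

variable {E M} in
/-- The horizontal space at `u`. -/
def HorizontalBundle.space (H : HorizontalBundle E M) (u : Total E M) :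
    Submodule ℝ (TangentSpace (model E) u) :=
  LinearMap.ker (H.vert u).toLinearMap

/-- A double field over `M`: a horizontal bundle with the components `σ` (a non degenerate,
symmetric metric of any signature) and `ψ` (a `2`-form) on `V₁ ≈ p⁻¹(TM)`. -/
structure DoubleField where
  /-- the horizontal bundle -/
  H : HorizontalBundle E M
  /-- the metric component -/
  σ : Π u : Total E M, V1 E M u →L[ℝ] V1 E M u →L[ℝ] ℝ
  σ_symm : ∀ u Y Y', σ u Y Y' = σ u Y' Y
  σ_nondegenerate : ∀ u Y, (∀ Y', σ u Y Y' = 0) → Y = 0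
  σ_smooth : ContMDiff (model E) ((model E).prod 𝓘(ℝ, E →L[ℝ] E →L[ℝ] ℝ)) ∞
    (fun u => TotalSpace.mk' (E →L[ℝ] E →L[ℝ] ℝ)
      (E := fun u : Total E M => V1 E M u →L[ℝ] V1 E M u →L[ℝ] ℝ) u (σ u))
  /-- the `2`-form component -/
  ψ : Π u : Total E M, V1 E M u →L[ℝ] V1 E M u →L[ℝ] ℝ
  ψ_alt : ∀ u Y, ψ u Y Y = 0
  ψ_smooth : ContMDiff (model E) ((model E).prod 𝓘(ℝ, E →L[ℝ] E →L[ℝ] ℝ)) ∞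
    (fun u => TotalSpace.mk' (E →L[ℝ] E →L[ℝ] ℝ)
      (E := fun u : Total E M => V1 E M u →L[ℝ] V1 E M u →L[ℝ] ℝ) u (ψ u))

end Fields

namespace DoubleField

variable {E : Type*} [NormedAddCommGroup E] [NormedSpace ℝ E]
  {M : Type*} [TopologicalSpace M] [ChartedSpace E M] [IsManifold 𝓘(ℝ, E) ∞ M]
  (Φ : DoubleField E M)

/-- The musical isomorphism `♯_σ : V₁^* → V₁`, the inverse of `♭_σ Y = σ(Y, ·)`. -/
def sharp (u : Total E M) : (V1 E M u →L[ℝ] ℝ) →L[ℝ] V1 E M u :=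
  (Φ.σ u).inverse

/-- The `V₁ → V₁` block `l = - ♯_σ ♭_ψ` of `φ`. -/
def l (u : Total E M) : V1 E M u →L[ℝ] V1 E M u :=
  -(Φ.sharp u ∘L Φ.ψ u)

/-- The `V₁ → V₁^*` block `♭_h = ♭_σ ∘ (Id - (♯_σ ♭_ψ)²)` of `φ`. -/
def flatH (u : Total E M) : V1 E M u →L[ℝ] (V1 E M u →L[ℝ] ℝ) :=
  Φ.σ u ∘L (ContinuousLinearMap.id ℝ _ - (Φ.sharp u ∘L Φ.ψ u) ∘L (Φ.sharp u ∘L Φ.ψ u))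

/-- The endomorphism `φ(Y, α) = (l Y + ♯_σ α, ♭_h Y + ᵗl α)` of `V`. -/
def phi (u : Total E M) : V E M u →ₗ[ℝ] V E M u where
  toFun w := inclV1 u (Φ.l u (prV1 u w) + Φ.sharp u (prV2 u w)) +
    inclV2 u (Φ.flatH u (prV1 u w) + (prV2 u w) ∘L (Φ.l u))
  map_add' w w' := by
    simp only [map_add, ContinuousLinearMap.add_comp]
    abel
  map_smul' c w := by
    simp only [map_smul, ContinuousLinearMap.smul_comp, ← smul_add, RingHom.id_apply]

/-- The double field metric `g_V(Z, Z') = 2 g(φ Z, Z')` of the vertical bundle. -/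
def gV (u : Total E M) : LinearMap.BilinForm ℝ (V E M u) :=
  (2 : ℝ) • (g u).comp (Φ.phi u) LinearMap.id

/-- The inverse isomorphisms `ι_ε : V₁ → U_ε`, `ι_ε Y = (Y, (♭_ψ + ε ♭_σ) Y)`, of the
projections of the eigenbundles `U_±` of `φ` on `V₁` (`ε = 1` for `U_+`, `ε = -1` for `U_-`). -/
def iota (ε : ℝ) (u : Total E M) (Y : V1 E M u) : V E M u :=
  inclV1 u Y + inclV2 u (Φ.ψ u Y + ε • Φ.σ u Y)

/-- The projection `(Id + ε φ) / 2` of `V` on the eigenbundle `U_ε` of `φ` (`ε = 1` or `-1`). -/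
def prU (ε : ℝ) (u : Total E M) (w : V E M u) : V E M u :=
  (1 / 2 : ℝ) • (w + ε • Φ.phi u w)

/-! Basic facts about this pointwise algebra. -/

section Algebra

theorem psi_neg (u : Total E M) (Y Y' : V1 E M u) : Φ.ψ u Y Y' = -Φ.ψ u Y' Y := by
  have h := Φ.ψ_alt u (Y + Y')
  simp only [map_add, add_apply, Φ.ψ_alt, zero_add, add_zero] at h
  linarith

theorem prV1_phi (u : Total E M) (w : V E M u) :
    prV1 u (Φ.phi u w) = Φ.sharp u (prV2 u w - Φ.ψ u (prV1 u w)) := by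
  have h : prV1 u (Φ.phi u w) = Φ.l u (prV1 u w) + Φ.sharp u (prV2 u w) := by
    change prV1 u (inclV1 u (Φ.l u (prV1 u w) + Φ.sharp u (prV2 u w)) +
      inclV2 u (Φ.flatH u (prV1 u w) + (prV2 u w) ∘L (Φ.l u))) = _
    rw [map_add, prV1_inclV1, prV1_inclV2, add_zero]
  have hl : Φ.l u (prV1 u w) = -Φ.sharp u (Φ.ψ u (prV1 u w)) := rfl
  rw [h, hl, map_sub]
  abel

variable [FiniteDimensional ℝ E]

theorem sigma_isInvertible (u : Total E M) : (Φ.σ u).IsInvertible := by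
  let f : E →L[ℝ] (E →L[ℝ] ℝ) := Φ.σ u
  have hinj : Function.Injective f.toLinearMap :=
    (injective_iff_map_eq_zero f.toLinearMap).2 fun Y hY =>
      Φ.σ_nondegenerate u Y fun Y' => by
        have := congrArg (fun h : E →L[ℝ] ℝ => h Y') hY
        exact this
  have hdim : Module.finrank ℝ E = Module.finrank ℝ (E →L[ℝ] ℝ) := by
    rw [← (LinearMap.toContinuousLinearMap : (E →ₗ[ℝ] ℝ) ≃ₗ[ℝ] (E →L[ℝ] ℝ)).finrank_eq]
    exact (Subspace.dual_finrank_eq (K := ℝ) (V := E)).symm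
  let e : E ≃L[ℝ] (E →L[ℝ] ℝ) :=
    (LinearEquiv.ofInjectiveOfFinrankEq f.toLinearMap hinj hdim).toContinuousLinearEquiv
  have he : (e : E →L[ℝ] (E →L[ℝ] ℝ)) = f := by
    ext x y
    rfl
  have : f.IsInvertible := ⟨e, he⟩
  exact this

theorem sigma_sharp (u : Total E M) (a : V1 E M u →L[ℝ] ℝ) : Φ.σ u (Φ.sharp u a) = a :=
  (Φ.sigma_isInvertible u).self_apply_inverse a

theorem sharp_sigma (u : Total E M) (Y : V1 E M u) : Φ.sharp u (Φ.σ u Y) = Y :=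
  (Φ.sigma_isInvertible u).inverse_apply_self Y

theorem sharp_symm (u : Total E M) (a b : V1 E M u →L[ℝ] ℝ) :
    a (Φ.sharp u b) = b (Φ.sharp u a) := by
  conv_lhs => rw [← Φ.sigma_sharp u a]
  conv_rhs => rw [← Φ.sigma_sharp u b]
  exact Φ.σ_symm u _ _

theorem prV2_phi (u : Total E M) (w : V E M u) :
    prV2 u (Φ.phi u w) = Φ.σ u (prV1 u w) + Φ.ψ u (prV1 u (Φ.phi u w)) := by
  have h : prV2 u (Φ.phi u w) = Φ.flatH u (prV1 u w) + (prV2 u w) ∘L (Φ.l u) := by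
    change prV2 u (inclV1 u (Φ.l u (prV1 u w) + Φ.sharp u (prV2 u w)) +
      inclV2 u (Φ.flatH u (prV1 u w) + (prV2 u w) ∘L (Φ.l u))) = _
    rw [map_add, prV2_inclV1, prV2_inclV2, zero_add]
  rw [h, prV1_phi]
  generalize prV1 u w = Y
  generalize prV2 u w = a
  ext W
  have h1 : Φ.flatH u Y W =
      Φ.σ u (Y - Φ.sharp u (Φ.ψ u (Φ.sharp u (Φ.ψ u Y)))) W := rfl
  have h2 : (a ∘L Φ.l u) W = a (-Φ.sharp u (Φ.ψ u W)) := rfl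
  rw [add_apply, add_apply, h1, h2, map_neg, map_sub, map_sub, map_sub, sub_apply, sub_apply,
    Φ.sigma_sharp, Φ.sharp_symm u a, Φ.psi_neg u W]
  ring

/-- `g_V((Y, α), (Y', α')) = σ(Y, Y') + σ⁻¹(α - ♭_ψ Y, α' - ♭_ψ Y')`. -/
theorem gV_apply (u : Total E M) (w w' : V E M u) :
    Φ.gV u w w' = Φ.σ u (prV1 u w) (prV1 u w') +
      (prV2 u w' - Φ.ψ u (prV1 u w')) (Φ.sharp u (prV2 u w - Φ.ψ u (prV1 u w))) := by
  have h : Φ.gV u w w' = 2 * ((prV2 u (Φ.phi u w) (prV1 u w') +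
    prV2 u w' (prV1 u (Φ.phi u w))) / 2) := rfl
  rw [h, prV2_phi, prV1_phi, add_apply, sub_apply, Φ.psi_neg u (prV1 u w')]
  ring

theorem gV_symm (u : Total E M) (w w' : V E M u) : Φ.gV u w w' = Φ.gV u w' w := by
  rw [gV_apply, gV_apply, Φ.σ_symm, Φ.sharp_symm]

/-- The metric `g_V` is compatible with `g`: `φ² = Id`. -/
theorem phi_phi (u : Total E M) (w : V E M u) : Φ.phi u (Φ.phi u w) = w := by
  have h : prV1 u (Φ.phi u (Φ.phi u w)) = prV1 u w := by
    rw [prV1_phi, prV2_phi, add_sub_cancel_right, sharp_sigma]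
  refine V_ext h ?_
  rw [prV2_phi, h, prV1_phi, sigma_sharp]
  abel

theorem gV_nondegenerate (u : Total E M) : (Φ.gV u).Nondegenerate := by
  have key : ∀ w, (∀ w', Φ.gV u w w' = 0) → w = 0 := by
    intro w hw
    have h2 : prV1 u w = 0 := by
      refine Φ.σ_nondegenerate u _ fun Y => ?_
      have h := hw (inclV1 u Y + inclV2 u (Φ.ψ u Y))
      have e1 : prV1 u (inclV1 u Y + inclV2 u (Φ.ψ u Y)) = Y := by
        rw [map_add, prV1_inclV1, prV1_inclV2, add_zero]
      have e2 : prV2 u (inclV1 u Y + inclV2 u (Φ.ψ u Y)) = Φ.ψ u Y := by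
        rw [map_add, prV2_inclV1, prV2_inclV2, zero_add]
      rw [gV_apply, e1, e2, sub_self, zero_apply, add_zero] at h
      exact h
    have h1 : prV2 u w = 0 := by
      have h3 : Φ.sharp u (prV2 u w) = 0 := by
        refine Φ.σ_nondegenerate u _ fun Y => ?_
        rw [Φ.σ_symm]
        have h := hw (inclV2 u (Φ.σ u Y))
        rw [gV_apply, h2, prV1_inclV2, prV2_inclV2, map_zero, map_zero,
          zero_add, sub_zero, sub_zero] at h
        exact h
      rw [← Φ.sigma_sharp u (prV2 u w), h3, map_zero]
    exact V_ext (by rw [h2, map_zero]) (by rw [h1, map_zero])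
  exact ⟨key, fun w hw => key w fun w' => by rw [gV_symm]; exact hw w'⟩

/-- `ι_+` and `ι_-` take values in the eigenbundles of `φ`. -/
theorem phi_iota (ε : ℝ) (hε : ε = 1 ∨ ε = -1) (u : Total E M) (Y : V1 E M u) :
    Φ.phi u (Φ.iota ε u Y) = ε • Φ.iota ε u Y := by
  have h1 : prV1 u (Φ.iota ε u Y) = Y := by
    rw [iota, map_add, prV1_inclV1, prV1_inclV2, add_zero]
  have h2 : prV2 u (Φ.iota ε u Y) = Φ.ψ u Y + ε • Φ.σ u Y := by
    rw [iota, map_add, prV2_inclV1, prV2_inclV2, zero_add]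
  have h3 : prV1 u (Φ.phi u (Φ.iota ε u Y)) = ε • Y := by
    rw [prV1_phi, h1, h2, add_sub_cancel_left, map_smul, sharp_sigma]
  have hε2 : ε * ε = 1 := by rcases hε with rfl | rfl <;> norm_num
  refine V_ext ?_ ?_
  · rw [h3, map_smul, h1]
  · rw [prV2_phi, h3, map_smul, h1, map_smul, h2, smul_add, smul_smul, hε2, one_smul]
    abel

end Algebra

/-! ### Metric bracket and Gualtieri torsion -/

section Brackets

variable [FiniteDimensional ℝ E]

/-- The operation `s ∧_D s'`, defined by
`g_V(w, s ∧_D s') = (g_V(s, D_w s') - g_V(s', D_w s)) / 2` for all `w` in `V`. -/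
def wedge (D : ConnV E M) (s s' : Π u, V E M u) (u : Total E M) : V E M u :=
  ((Φ.gV u).toDual (Φ.gV_nondegenerate u)).symm
    ((1 / 2 : ℝ) • ((Φ.gV u (s u)) ∘ₗ (D s' u ∘L vlift u).toLinearMap -
      (Φ.gV u (s' u)) ∘ₗ (D s u ∘L vlift u).toLinearMap))

theorem gV_wedge (D : ConnV E M) (s s' : Π u, V E M u) (u : Total E M) (w : V E M u) :
    Φ.gV u w (Φ.wedge D s s' u) =
      (Φ.gV u (s u) (D s' u (vlift u w)) - Φ.gV u (s' u) (D s u (vlift u w))) / 2 := by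
  rw [gV_symm, wedge, LinearMap.BilinForm.apply_toDual_symm_apply]
  simp
  ring

/-- The metric bracket `[s, s']_{g_V} = D⁰_s s' - D⁰_{s'} s - s ∧_{D⁰} s'`, where `D⁰` is the
connection that enters the definition of the bracket. -/
def metricBracket (D0 : ConnV E M) (s s' : Π u, V E M u) (u : Total E M) : V E M u :=
  D0 s' u (vlift u (s u)) - D0 s u (vlift u (s' u)) - Φ.wedge D0 s s' u

/-- The deformed Lie bracket `[s, s']_{g_V} + s ∧_D s'` of the connection `D`. -/
def deformedBracket (D0 D : ConnV E M) (s s' : Π u, V E M u) (u : Total E M) : V E M u :=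
  Φ.metricBracket D0 s s' u + Φ.wedge D s s' u

/-- The deformed torsion of the connection `D`. -/
def deformedTorsion (D0 D : ConnV E M) (s s' : Π u, V E M u) (u : Total E M) : V E M u :=
  D s' u (vlift u (s u)) - D s u (vlift u (s' u)) - Φ.deformedBracket D0 D s s' u

/-- The Gualtieri torsion of the connection `D`. -/
def gualtieriTorsion (D0 D : ConnV E M) (s s' s'' : Π u, V E M u) (u : Total E M) : ℝ :=
  Φ.gV u (Φ.deformedTorsion D0 D s s' u) (s'' u)

end Brackets

/-! ### The construction of the field-adapted connection -/

/-- The metric `g_σ` of the big tangent manifold: the orthogonal sum of the metrics to which `σ`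
transfers on the horizontal bundle, on `V₁` and on `V₂ = V₁^*`. -/
def gSigma (u : Total E M) (Z Z' : TangentSpace (model E) u) : ℝ :=
  let q : TangentSpace (model E) u →L[ℝ] V1 E M u := mfderiv (model E) 𝓘(ℝ, E) (p E M) u
  Φ.σ u (q Z) (q Z') + Φ.σ u (prV1 u (Φ.H.vert u Z)) (prV1 u (Φ.H.vert u Z')) +
    prV2 u (Φ.H.vert u Z') (Φ.sharp u (prV2 u (Φ.H.vert u Z)))

/-- The Lie bracket of two sections of `V₁`, as a section of `V₁`. -/
def leafBracket (Y Y' : Π u, V1 E M u) (u : Total E M) : V1 E M u :=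
  prV1 u (Φ.H.vert u (VectorField.mlieBracket (model E) (field1 Y) (field1 Y') u))

/-- The exterior differential of `ψ` along the leaves of `V₁`, evaluated on sections of `V₁`. -/
def leafDPsi (Y Y' Y'' : Π u, V1 E M u) (u : Total E M) : ℝ :=
  dirDeriv (fun v => Φ.ψ v (Y' v) (Y'' v)) u (field1 Y u) +
  dirDeriv (fun v => Φ.ψ v (Y'' v) (Y v)) u (field1 Y' u) +
  dirDeriv (fun v => Φ.ψ v (Y v) (Y' v)) u (field1 Y'' u) -
  Φ.ψ u (Φ.leafBracket Y Y' u) (Y'' u) - Φ.ψ u (Φ.leafBracket Y' Y'' u) (Y u) -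
  Φ.ψ u (Φ.leafBracket Y'' Y u) (Y' u)

/-- `D` is obtained from the connection `D'` on `V₁` by the transformation
`D_Z Y = D'_Z Y + (1/2) ♯_σ ♭_{D'_Z σ} Y`. -/
def IsMetrization (D' D : Conn1 E M) : Prop :=
  ∀ (u : Total E M) (Y W : Π u, V1 E M u), Diff1 Y u → Diff1 W u →
    ∀ Z : TangentSpace (model E) u,
      Φ.σ u (D Y u Z - D' Y u Z) (W u) =
        (dirDeriv (fun v => Φ.σ v (Y v) (W v)) u Z - Φ.σ u (D' Y u Z) (W u) -
          Φ.σ u (Y u) (D' W u Z)) / 2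

/-- `D` is obtained from the connection `D⁰` on `V₁` by
`D_Z Y = D⁰_Z Y + (ε/2) ♯_σ (i(Y) i(pr_{V₁} Z) d_{V₁} ψ)`. -/
def IsPsiDeformation (ε : ℝ) (D0 D : Conn1 E M) : Prop :=
  ∀ (u : Total E M) (Z₁ Y W : Π u, V1 E M u), Diff1 Z₁ u → Diff1 Y u → Diff1 W u →
    ∀ Z : TangentSpace (model E) u, prV1 u (Φ.H.vert u Z) = Z₁ u →
      Φ.σ u (D Y u Z - D0 Y u Z) (W u) = ε / 2 * Φ.leafDPsi Z₁ Y W u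

/-- The connection `D` on `V` corresponds to the pair `(D^+, D^-)` of connections on `V₁`:
`D_Z (ι_± Y) = ι_± (D^±_Z Y)`. -/
def IsPair (Dp Dm : Conn1 E M) (D : ConnV E M) : Prop :=
  ∀ (u : Total E M) (Y : Π u, V1 E M u), Diff1 Y u → ∀ Z : TangentSpace (model E) u,
    D (fun v => Φ.iota 1 v (Y v)) u Z = Φ.iota 1 u (Dp Y u Z) ∧
    D (fun v => Φ.iota (-1) v (Y v)) u Z = Φ.iota (-1) u (Dm Y u Z)

/-- `D'` is obtained from `D = D^ε` by means of the metric bracket: `D'_X = D_X` for `X`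
horizontal and, for `s` and `Y` sections of `V` and `V₁`,
`D'_s Y = D_{pr_{U_ε} s} Y + pr_{V₁} pr_{U_ε} [pr_{U_{-ε}} s, ι_ε Y]_{g_V}`. -/
def IsBracketModification [FiniteDimensional ℝ E] (ε : ℝ) (D0 : ConnV E M) (D D' : Conn1 E M) :
    Prop :=
  (∀ (u : Total E M) (Y : Π u, V1 E M u), Diff1 Y u → ∀ X ∈ Φ.H.space u, D' Y u X = D Y u X) ∧
  ∀ (u : Total E M) (Y : Π u, V1 E M u) (s : Π u, V E M u), Diff1 Y u → DiffV s u →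
    D' Y u (vlift u (s u)) = D Y u (vlift u (Φ.prU ε u (s u))) +
      prV1 u (Φ.prU ε u (Φ.metricBracket D0 (fun v => Φ.prU (-ε) v (s v))
        (fun v => Φ.iota ε v (Y v)) u))

/-- A vertical double metric connection: a connection on `V` that preserves `g` and `g_V`. -/
def IsDoubleMetric (D : ConnV E M) : Prop :=
  PreservesV D (fun u w w' => g u w w') ∧ PreservesV D (fun u w w' => Φ.gV u w w')

/-- The successive connections in the construction of the field-adapted connection `Dbar`
of the double field `Φ`. -/
structure FieldAdapted [FiniteDimensional ℝ E] where
  /-- the Levi-Civita connection of `g_σ` -/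
  Dσ : ConnT E M
  Dσ_torsion : ∀ (u : Total E M) (X X' : Π u : Total E M, TangentSpace (model E) u),
    DiffT X u → DiffT X' u →
    Dσ X' u (X u) - Dσ X u (X' u) = VectorField.mlieBracket (model E) X X' u
  Dσ_metric : PreservesT Dσ Φ.gSigma
  /-- the connection `D'⁰` on `V₁` -/
  Dprime0 : Conn1 E M
  /-- along `V₁`, `D'⁰` is the `V₁`-component of the Levi-Civita connection -/
  Dprime0_V1 : ∀ (u : Total E M) (Y : Π u, V1 E M u), Diff1 Y u → ∀ Z₁ : V1 E M u,
    Dprime0 Y u (vlift u (inclV1 u Z₁)) =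
      prV1 u (Φ.H.vert u (Dσ (field1 Y) u (vlift u (inclV1 u Z₁))))
  /-- along `V₂`, `D'⁰_Z Y` is the `V₁`-component of `[Z, Y]` -/
  Dprime0_V2 : ∀ (u : Total E M) (Y : Π u, V1 E M u) (s : Π u, V E M u), Diff1 Y u → DiffV s u →
    (∀ v, prV1 v (s v) = 0) →
    Dprime0 Y u (vlift u (s u)) =
      prV1 u (Φ.H.vert u
        (VectorField.mlieBracket (model E) (fun v => vlift v (s v)) (field1 Y) u))
  /-- along the horizontal bundle, `D'⁰_X Y` is the `V₁`-component of `[X, Y]` -/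
  Dprime0_H : ∀ (u : Total E M) (Y : Π u, V1 E M u) (X : Π u : Total E M, TangentSpace (model E) u),
    Diff1 Y u → DiffT X u → (∀ v, X v ∈ Φ.H.space v) →
    Dprime0 Y u (X u) =
      prV1 u (Φ.H.vert u (VectorField.mlieBracket (model E) X (field1 Y) u))
  /-- the `σ`-metric connection `D⁰` -/
  D0 : Conn1 E M
  D0_metrization : Φ.IsMetrization Dprime0 D0
  /-- the double metric connection `𝒟⁰` of the pair `(D⁰, D⁰)`, which defines the metric bracket -/
  DD0 : ConnV E M
  DD0_pair : Φ.IsPair D0 D0 DD0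
  /-- the connections `D'^±` -/
  DprimePlus : Conn1 E M
  DprimeMinus : Conn1 E M
  DprimePlus_psi : Φ.IsPsiDeformation 1 D0 DprimePlus
  DprimeMinus_psi : Φ.IsPsiDeformation (-1) D0 DprimeMinus
  /-- the `σ`-metric connections `D^±` -/
  DPlus : Conn1 E M
  DMinus : Conn1 E M
  DPlus_metrization : Φ.IsMetrization DprimePlus DPlus
  DMinus_metrization : Φ.IsMetrization DprimeMinus DMinus
  /-- the modifications of `D^±` by means of the metric bracket -/
  DtildePlus : Conn1 E M
  DtildeMinus : Conn1 E M
  DtildePlus_modification : Φ.IsBracketModification 1 DD0 DPlus DtildePlus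
  DtildeMinus_modification : Φ.IsBracketModification (-1) DD0 DMinus DtildeMinus
  /-- the connection on `V` of the pair of modified connections -/
  Dtilde : ConnV E M
  Dtilde_pair : Φ.IsPair DtildePlus DtildeMinus Dtilde
  /-- the field-adapted connection -/
  Dbar : ConnV E M
  Dbar_horizontal : ∀ (u : Total E M) (s : Π u, V E M u), DiffV s u → ∀ X ∈ Φ.H.space u,
    Dbar s u X = Dtilde s u X
  Dbar_vertical : ∀ (u : Total E M) (s s' s'' : Π u, V E M u), DiffV s u → DiffV s' u →
    DiffV s'' u →
    Φ.gV u (Dbar s' u (vlift u (s u)) - Dtilde s' u (vlift u (s u))) (s'' u) =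
      -(1 / 3) * Φ.gualtieriTorsion DD0 Dtilde s s' s'' u

end DoubleField

/-! ### Lifts of local diffeomorphisms -/

section Naturality

variable {E : Type*} [NormedAddCommGroup E] [NormedSpace ℝ E]
  {M : Type*} [TopologicalSpace M] [ChartedSpace E M] [IsManifold 𝓘(ℝ, E) ∞ M]
  {E' : Type*} [NormedAddCommGroup E'] [NormedSpace ℝ E']
  {N : Type*} [TopologicalSpace N] [ChartedSpace E' N] [IsManifold 𝓘(ℝ, E') ∞ N]
  (f : M → N)

/-- The differential of `f` at the base point of `u`. -/
def dBase (u : Total E M) :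
    TangentSpace 𝓘(ℝ, E) u.proj →L[ℝ] TangentSpace 𝓘(ℝ, E') (f u.proj) :=
  mfderiv 𝓘(ℝ, E) 𝓘(ℝ, E') f u.proj

/-- The lift `(x, y, z) ↦ (f(x), df_x y, z ∘ (df_x)⁻¹)` of a local diffeomorphism `f : M → N` to
the big tangent manifolds. -/
def liftMap (u : Total E M) : Total E' N :=
  ⟨f u.proj, (dBase (E' := E') f u u.2.1, u.2.2 ∘L (dBase (E' := E') f u).inverse)⟩

/-- The isomorphism `V₁ → V₁` over `liftMap f`. -/
def lift1 (u : Total E M) (Y : V1 E M u) : V1 E' N (liftMap f u) :=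
  dBase (E' := E') f u Y

/-- The isomorphism `V → V` over `liftMap f`. -/
def liftV (u : Total E M) (w : V E M u) : V E' N (liftMap f u) :=
  inclV1 (liftMap f u) (lift1 f u (prV1 u w)) +
    inclV2 (liftMap f u) (prV2 u w ∘L (dBase (E' := E') f u).inverse)

/-- The pull-back of a section of `V` by `liftMap f`. -/
def pullV (s : Π u, V E' N u) (u : Total E M) : V E M u :=
  inclV1 u ((dBase (E' := E') f u).inverse (prV1 (liftMap f u) (s (liftMap f u)))) +
    inclV2 u (prV2 (liftMap f u) (s (liftMap f u)) ∘L dBase (E' := E') f u)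

/-- The double field `Φ` is the pull-back of the double field `Φ'` by the local diffeomorphism
`f`. -/
structure IsPullback (Φ : DoubleField E M) (Φ' : DoubleField E' N) : Prop where
  H : ∀ (u : Total E M) (Z : TangentSpace (model E) u),
    Φ'.H.vert (liftMap f u) (mfderiv (model E) (model E') (liftMap f) u Z) = liftV f u (Φ.H.vert u Z)
  σ : ∀ (u : Total E M) (Y Y' : V1 E M u),
    Φ'.σ (liftMap f u) (lift1 f u Y) (lift1 f u Y') = Φ.σ u Y Y'
  ψ : ∀ (u : Total E M) (Y Y' : V1 E M u),
    Φ'.ψ (liftMap f u) (lift1 f u Y) (lift1 f u Y') = Φ.ψ u Y Y'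

end Naturality

end BigTangent

end

/-! Except for the connections of pairs and the bracket modifications, which have closed formulas,
every connection of the construction is described by a pairing K(X, Y, W) = b(D_X Y, W), where b is
a smooth non-degenerate form: σ on V₁, g_V on V, or g_σ on the tangent bundle. Such a connection
exists when K is tensorial in X and W and is additive and satisfies the Leibniz rule in Y
(`exists_connection_of_form`). It is smooth when K is smooth on smooth arguments
(`smoothConnection_of_form`), and its values on differentiable sections are determined by K. For the
Levi-Civita connection K is the Koszul expression. For the other connections K combines derivatives
of functions, brackets, d_{V₁}ψ and connections already built. Existence, smoothness and naturality
are therefore checked on explicit expressions.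

The algebra rests on the splitting V = U₊ ⊕ U₋. Write c_±(w) for the V₁-component of pr_{U_±} w
(`coordU`). Then g_V is 2(σ ⊕ σ) and g is σ ⊕ (-σ) (`gV_eq`, `g_eq`), so a pair of σ-metric
connections on V₁ gives a double metric connection on V (`IsPair.isDoubleMetric`). A metrization is
the average of a connection and its σ-adjoint, hence σ-metric.

The metric bracket needs little computation. The connection of the pair (D⁰, D⁰) preserves the
g_V-orthogonal bundles U₊ and U₋, so for s in U_{-ε} the U_ε-part of [s, ι_ε Y] is ι_ε(D⁰_s Y)
(`metricBracket_iota`). The modification thus replaces D^ε by D⁰ along U_{-ε} and leaves it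
unchanged along H and U_ε. It remains σ-metric.

For the torsion put A(a, b, c) = g_V(∇_a b - 𝒟⁰_a b, c). The bracket is itself built from 𝒟⁰, so the
torsion of ∇ depends only on the tensor A (`gualtieriTorsion_eq`). If ∇ preserves g_V, as 𝒟⁰ does, A
is skew in its last two arguments and the torsion is the cyclic sum of A. It is then totally skew.
Subtracting a third of it from the connection subtracts three times that third from the torsion,
which leaves 0, and g_V is still preserved by skewness.

Preservation of g needs more: the torsion must vanish on one argument in U₊ and one in U₋
(`torsionForm_iota_iota_neg`). This is the role of the bracket modification. The mixed terms vanish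
either because both connections preserve U_±, or because the modified connection agrees with 𝒟⁰ on
U_ε along U_{-ε}.

For invariance, each ingredient is natural under the lift of a local diffeomorphism and each step of
the construction preserves naturality (`carries_Dbar`). Uniqueness of the field-adapted connection
is the case of the identity map (`DoubleField.FieldAdapted.Dbar_unique`). -/

set_option linter.unusedSectionVars false

noncomputable section

/-! ### Sections of vector bundles and of their homomorphism bundles -/

namespace BundleAux

open Filter Topology FiberBundle

variable {EB : Type*} [NormedAddCommGroup EB] [NormedSpace ℝ EB]
  {HB : Type*} [TopologicalSpace HB] {I : ModelWithCorners ℝ EB HB}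
  {B : Type*} [TopologicalSpace B] [ChartedSpace HB B]
  {F₁ : Type*} [NormedAddCommGroup F₁] [NormedSpace ℝ F₁]
  {V₁ : B → Type*} [TopologicalSpace (TotalSpace F₁ V₁)]
  [∀ x, AddCommGroup (V₁ x)] [∀ x, Module ℝ (V₁ x)] [∀ x, TopologicalSpace (V₁ x)]
  [∀ x, IsTopologicalAddGroup (V₁ x)] [∀ x, ContinuousSMul ℝ (V₁ x)]
  [FiberBundle F₁ V₁] [VectorBundle ℝ F₁ V₁]
  {F₂ : Type*} [NormedAddCommGroup F₂] [NormedSpace ℝ F₂]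
  {V₂ : B → Type*} [TopologicalSpace (TotalSpace F₂ V₂)]
  [∀ x, AddCommGroup (V₂ x)] [∀ x, Module ℝ (V₂ x)] [∀ x, TopologicalSpace (V₂ x)]
  [∀ x, IsTopologicalAddGroup (V₂ x)] [∀ x, ContinuousSMul ℝ (V₂ x)]
  [FiberBundle F₂ V₂] [VectorBundle ℝ F₂ V₂]

/-- A family of linear maps between finite dimensional spaces is of class `C^n` if all its values
at fixed vectors are. -/
theorem contMDiffAt_clm_of_apply [FiniteDimensional ℝ F₁] {n : WithTop ℕ∞}
    {f : B → F₁ →L[ℝ] F₂} {x : B}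
    (h : ∀ v, ContMDiffAt I 𝓘(ℝ, F₂) n (fun y => f y v) x) :
    ContMDiffAt I 𝓘(ℝ, F₁ →L[ℝ] F₂) n f x := by
  let b := Module.finBasis ℝ F₁
  -- The family is a finite sum of its values on a basis, each inserted by a fixed continuous linear
  -- map.
  have hf : f = fun y => ∑ i, ContinuousLinearMap.smulRightL ℝ F₁ F₂
      (LinearMap.toContinuousLinearMap (b.coord i)) (f y (b i)) := by
    funext y
    ext v
    have h := congrArg (f y) (b.sum_repr v)
    rw [map_sum] at h
    simp [← h]
  rw [hf]
  refine ContMDiffAt.sum fun i _ => ?_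
  exact (ContinuousLinearMap.contMDiff _).contMDiffAt.comp x (h (b i))

/-- A section of the bundle of homomorphisms is of class `C^n` if it sends sections of class `C^n`
to sections of class `C^n`. -/
theorem contMDiffAt_hom_of_apply [FiniteDimensional ℝ F₁] {n : WithTop ℕ∞}
    [ContMDiffVectorBundle n F₁ V₁ I]
    {A : Π x, V₁ x →L[ℝ] V₂ x} {x : B}
    (h : ∀ s : Π y, V₁ y,
      ContMDiffAt I (I.prod 𝓘(ℝ, F₁)) n (fun y => TotalSpace.mk' F₁ y (s y)) x →
      ContMDiffAt I (I.prod 𝓘(ℝ, F₂)) n (fun y => TotalSpace.mk' F₂ y (A y (s y))) x) :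
    ContMDiffAt I (I.prod 𝓘(ℝ, F₁ →L[ℝ] F₂)) n
      (fun y => TotalSpace.mk' (F₁ →L[ℝ] F₂) (E := fun y => V₁ y →L[ℝ] V₂ y) y (A y)) x := by
  rw [contMDiffAt_hom_bundle]
  refine ⟨contMDiffAt_id, contMDiffAt_clm_of_apply fun v => ?_⟩
  -- The test section is constant, equal to `v`, in the trivialization at `x`. Its image read in
  -- coordinates is the coordinate expression of `A` applied to `v`.
  have hs := h _ (contMDiffAt_extend (k := n) I F₁
    ((trivializationAt F₁ V₁ x).symm x v))
  rw [contMDiffAt_section] at hs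
  refine hs.congr_of_eventuallyEq ?_
  filter_upwards [(trivializationAt F₁ V₁ x).open_baseSet.mem_nhds
      (FiberBundle.mem_baseSet_trivializationAt' x),
    (trivializationAt F₂ V₂ x).open_baseSet.mem_nhds
      (FiberBundle.mem_baseSet_trivializationAt' x)] with y hy hy'
  have hx := FiberBundle.mem_baseSet_trivializationAt' (F := F₁) (E := V₁) x
  simp [ContinuousLinearMap.inCoordinates, FiberBundle.extend, hx, hy, hy',
    Trivialization.symmL_apply, Trivialization.coe_linearMapAt_of_mem]

variable (I F₁ F₂) in
/-- Smoothness of a section of the bundle of homomorphisms. -/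
def SmoothHom (A : Π x, V₁ x →L[ℝ] V₂ x) : Prop :=
  ∀ x, ContMDiffAt I (I.prod 𝓘(ℝ, F₁ →L[ℝ] F₂)) ∞
    (fun y => TotalSpace.mk' (F₁ →L[ℝ] F₂) (E := fun y => V₁ y →L[ℝ] V₂ y) y (A y)) x

theorem SmoothHom.contMDiffAt {A : Π x, V₁ x →L[ℝ] V₂ x} (hA : SmoothHom I F₁ F₂ A)
    {s : Π y, V₁ y} {x : B}
    (hs : ContMDiffAt I (I.prod 𝓘(ℝ, F₁)) ∞ (fun y => TotalSpace.mk' F₁ y (s y)) x) :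
    ContMDiffAt I (I.prod 𝓘(ℝ, F₂)) ∞ (fun y => TotalSpace.mk' F₂ y (A y (s y))) x :=
  (hA x).clm_bundle_apply hs

theorem SmoothHom.mdifferentiableAt {A : Π x, V₁ x →L[ℝ] V₂ x} (hA : SmoothHom I F₁ F₂ A)
    {s : Π y, V₁ y} {x : B}
    (hs : MDifferentiableAt I (I.prod 𝓘(ℝ, F₁)) (fun y => TotalSpace.mk' F₁ y (s y)) x) :
    MDifferentiableAt I (I.prod 𝓘(ℝ, F₂)) (fun y => TotalSpace.mk' F₂ y (A y (s y))) x :=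
  ((hA x).mdifferentiableAt (by simp)).clm_bundle_apply hs

/-- The inverse of a section of isomorphisms of class `C^n` is of class `C^n`. -/
theorem contMDiffAt_hom_inverse [CompleteSpace F₁] {n : WithTop ℕ∞}
    {A : Π x, V₁ x →L[ℝ] V₂ x} (hA : ∀ x, (A x).IsInvertible) {x : B}
    (h : ContMDiffAt I (I.prod 𝓘(ℝ, F₁ →L[ℝ] F₂)) n
      (fun y => TotalSpace.mk' (F₁ →L[ℝ] F₂) (E := fun y => V₁ y →L[ℝ] V₂ y) y (A y)) x) :
    ContMDiffAt I (I.prod 𝓘(ℝ, F₂ →L[ℝ] F₁)) n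
      (fun y => TotalSpace.mk' (F₂ →L[ℝ] F₁) (E := fun y => V₂ y →L[ℝ] V₁ y) y
        (A y).inverse) x := by
  rw [contMDiffAt_hom_bundle] at h ⊢
  refine ⟨contMDiffAt_id, ?_⟩
  have hx := FiberBundle.mem_baseSet_trivializationAt' (F := F₁) (E := V₁) x
  have hx' := FiberBundle.mem_baseSet_trivializationAt' (F := F₂) (E := V₂) x
  -- Over the common base set, taking coordinates commutes with inversion, so smoothness reduces to
  -- that of the inversion of operators near an invertible one.
  have hinv : ∀ y ∈ (trivializationAt F₁ V₁ x).baseSet ∩ (trivializationAt F₂ V₂ x).baseSet,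
      ContinuousLinearMap.inCoordinates F₂ V₂ F₁ V₁ x y x y (A y).inverse =
        (ContinuousLinearMap.inCoordinates F₁ V₁ F₂ V₂ x y x y (A y)).inverse ∧
      (ContinuousLinearMap.inCoordinates F₁ V₁ F₂ V₂ x y x y (A y)).IsInvertible := by
    rintro y ⟨hy, hy'⟩
    obtain ⟨e, he⟩ := hA y
    rw [ContinuousLinearMap.inCoordinates_eq hy' hy, ContinuousLinearMap.inCoordinates_eq hy hy',
      ← he, ContinuousLinearMap.inverse_equiv]
    let e' : F₁ ≃L[ℝ] F₂ := ((trivializationAt F₁ V₁ x).continuousLinearEquivAt ℝ y hy).symm.trans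
      (e.trans ((trivializationAt F₂ V₂ x).continuousLinearEquivAt ℝ y hy'))
    refine ⟨?_, e', rfl⟩
    exact (ContinuousLinearMap.inverse_equiv e').symm
  have h2 := (ContinuousLinearMap.IsInvertible.contDiffAt_map_inverse (n := n)
    (hinv x ⟨hx, hx'⟩).2).contMDiffAt.comp x h.2
  refine h2.congr_of_eventuallyEq ?_
  filter_upwards [(trivializationAt F₁ V₁ x).open_baseSet.mem_nhds hx,
    (trivializationAt F₂ V₂ x).open_baseSet.mem_nhds hx'] with y hy hy'
  exact (hinv y ⟨hy, hy'⟩).1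

/-- A smooth bilinear form on sections gives smooth functions. -/
theorem contMDiffAt_form {n : WithTop ℕ∞} {b : Π x, V₁ x →L[ℝ] V₂ x →L[ℝ] ℝ} {x : B}
    {s : Π y, V₁ y} {t : Π y, V₂ y}
    (hb : ContMDiffAt I (I.prod 𝓘(ℝ, F₁ →L[ℝ] F₂ →L[ℝ] ℝ)) n
      (fun y => TotalSpace.mk' (F₁ →L[ℝ] F₂ →L[ℝ] ℝ)
        (E := fun y => V₁ y →L[ℝ] V₂ y →L[ℝ] ℝ) y (b y)) x)
    (hs : ContMDiffAt I (I.prod 𝓘(ℝ, F₁)) n (fun y => TotalSpace.mk' F₁ y (s y)) x)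
    (ht : ContMDiffAt I (I.prod 𝓘(ℝ, F₂)) n (fun y => TotalSpace.mk' F₂ y (t y)) x) :
    ContMDiffAt I 𝓘(ℝ, ℝ) n (fun y => b y (s y) (t y)) x := by
  have : ContMDiffAt I (I.prod 𝓘(ℝ)) n
      (fun y ↦ TotalSpace.mk' ℝ (E := Bundle.Trivial B ℝ) y (b y (s y) (t y))) x :=
    ContMDiffAt.clm_bundle_apply₂ (F₁ := F₁) (F₂ := F₂) hb hs ht
  rw [contMDiffAt_totalSpace] at this
  exact this.2

theorem mdifferentiableAt_form {b : Π x, V₁ x →L[ℝ] V₂ x →L[ℝ] ℝ} {x : B}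
    {s : Π y, V₁ y} {t : Π y, V₂ y}
    (hb : ContMDiffAt I (I.prod 𝓘(ℝ, F₁ →L[ℝ] F₂ →L[ℝ] ℝ)) ∞
      (fun y => TotalSpace.mk' (F₁ →L[ℝ] F₂ →L[ℝ] ℝ)
        (E := fun y => V₁ y →L[ℝ] V₂ y →L[ℝ] ℝ) y (b y)) x)
    (hs : MDifferentiableAt I (I.prod 𝓘(ℝ, F₁)) (fun y => TotalSpace.mk' F₁ y (s y)) x)
    (ht : MDifferentiableAt I (I.prod 𝓘(ℝ, F₂)) (fun y => TotalSpace.mk' F₂ y (t y)) x) :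
    MDifferentiableAt I 𝓘(ℝ, ℝ) (fun y => b y (s y) (t y)) x := by
  have : MDifferentiableAt I (I.prod 𝓘(ℝ))
      (fun y ↦ TotalSpace.mk' ℝ (E := Bundle.Trivial B ℝ) y (b y (s y) (t y))) x :=
    MDifferentiableAt.clm_bundle_apply₂ (F₁ := F₁) (F₂ := F₂)
      (hb.mdifferentiableAt (by simp)) hs ht
  rw [mdifferentiableAt_totalSpace] at this
  exact this.2

/-- A section whose pairings, by a smooth non degenerate form, with smooth sections are smooth is
smooth. -/
theorem contMDiffAt_of_form [FiniteDimensional ℝ F₁] [FiniteDimensional ℝ F₂] {n : WithTop ℕ∞}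
    [ContMDiffVectorBundle n F₁ V₁ I] [ContMDiffVectorBundle n F₂ V₂ I]
    {b : Π x, V₁ x →L[ℝ] V₂ x →L[ℝ] ℝ} (hinv : ∀ x, (b x).IsInvertible) {x : B}
    {s : Π y, V₁ y}
    (hb : ContMDiffAt I (I.prod 𝓘(ℝ, F₁ →L[ℝ] F₂ →L[ℝ] ℝ)) n
      (fun y => TotalSpace.mk' (F₁ →L[ℝ] F₂ →L[ℝ] ℝ)
        (E := fun y => V₁ y →L[ℝ] V₂ y →L[ℝ] ℝ) y (b y)) x)
    (h : ∀ t : Π y, V₂ y,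
      ContMDiffAt I (I.prod 𝓘(ℝ, F₂)) n (fun y => TotalSpace.mk' F₂ y (t y)) x →
      ContMDiffAt I 𝓘(ℝ, ℝ) n (fun y => b y (s y) (t y)) x) :
    ContMDiffAt I (I.prod 𝓘(ℝ, F₁)) n (fun y => TotalSpace.mk' F₁ y (s y)) x := by
  -- The functional b(s, ·) is smooth because its values on smooth sections are; then s is recovered
  -- from it by the smooth inverse of b.
  have h1 : ContMDiffAt I (I.prod 𝓘(ℝ, F₂ →L[ℝ] ℝ)) n
      (fun y => TotalSpace.mk' (F₂ →L[ℝ] ℝ)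
        (E := fun y => V₂ y →L[ℝ] Bundle.Trivial B ℝ y) y (b y (s y))) x := by
    refine contMDiffAt_hom_of_apply fun t ht => ?_
    rw [contMDiffAt_section]
    exact h t ht
  have h2 := contMDiffAt_hom_inverse (V₂ := fun y => V₂ y →L[ℝ] Bundle.Trivial B ℝ y)
    (A := b) hinv hb
  have h3 := h2.clm_bundle_apply h1
  refine h3.congr_of_eventuallyEq (Eventually.of_forall fun y => ?_)
  change TotalSpace.mk' F₁ y (s y) = TotalSpace.mk' F₁ y ((b y).inverse (b y (s y)))
  rw [(hinv y).inverse_apply_self]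

/-! ### Connections prescribed by their pairing with a non-degenerate form -/

section Connections

variable {F : Type*} [NormedAddCommGroup F] [NormedSpace ℝ F]
  {V : B → Type*} [TopologicalSpace (TotalSpace F V)]
  [∀ x, AddCommGroup (V x)] [∀ x, Module ℝ (V x)] [∀ x, TopologicalSpace (V x)]
  [∀ x, IsTopologicalAddGroup (V x)] [∀ x, ContinuousSMul ℝ (V x)]
  [FiberBundle F V] [VectorBundle ℝ F V]
  [FiniteDimensional ℝ EB] [FiniteDimensional ℝ F]

/-- A connection is smooth if it sends sections that are smooth at a point to sections that are
smooth at this point. -/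
def SmoothConnection [IsManifold I 1 B] (D : CovariantDerivative I F V) : Prop :=
  ∀ (x : B) (s : Π y, V y),
    ContMDiffAt I (I.prod 𝓘(ℝ, F)) ∞ (fun y => TotalSpace.mk' F y (s y)) x →
    ContMDiffAt I (I.prod 𝓘(ℝ, EB →L[ℝ] F)) ∞
      (fun y => TotalSpace.mk' (EB →L[ℝ] F) (E := fun y => TangentSpace I y →L[ℝ] V y) y
        (D s y)) x

variable [IsManifold I ∞ B]

theorem smoothConnection_of_apply [IsManifold I 1 B] {D : CovariantDerivative I F V}
    (h : ∀ (x : B) (X : Π y, TangentSpace I y) (s : Π y, V y),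
      ContMDiffAt I (I.prod 𝓘(ℝ, EB)) ∞ (fun y => TotalSpace.mk' EB y (X y)) x →
      ContMDiffAt I (I.prod 𝓘(ℝ, F)) ∞ (fun y => TotalSpace.mk' F y (s y)) x →
      ContMDiffAt I (I.prod 𝓘(ℝ, F)) ∞ (fun y => TotalSpace.mk' F y (D s y (X y))) x) :
    SmoothConnection D :=
  fun x s hs => contMDiffAt_hom_of_apply fun X hX => h x X s hX hs

theorem SmoothConnection.apply [IsManifold I 1 B] {D : CovariantDerivative I F V}
    (h : SmoothConnection D) {x : B} {X : Π y, TangentSpace I y} {s : Π y, V y}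
    (hX : ContMDiffAt I (I.prod 𝓘(ℝ, EB)) ∞ (fun y => TotalSpace.mk' EB y (X y)) x)
    (hs : ContMDiffAt I (I.prod 𝓘(ℝ, F)) ∞ (fun y => TotalSpace.mk' F y (s y)) x) :
    ContMDiffAt I (I.prod 𝓘(ℝ, F)) ∞ (fun y => TotalSpace.mk' F y (D s y (X y))) x :=
  (h x s hs).clm_bundle_apply hX

/-- Smoothness at a point gives class C¹ on a neighbourhood. This turns formulas valid at each point
of differentiability into identities of germs, to which smoothness can be transferred. -/
theorem eventually_mdifferentiableAt {E' H' : Type*} [NormedAddCommGroup E'] [NormedSpace ℝ E']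
    [TopologicalSpace H'] {I' : ModelWithCorners ℝ E' H'} {N : Type*} [TopologicalSpace N]
    [ChartedSpace H' N] [IsManifold I 1 B] [IsManifold I' 1 N] {f : B → N} {x : B}
    (hf : ContMDiffAt I I' ∞ f x) : ∀ᶠ y in 𝓝 x, MDifferentiableAt I I' f y := by
  have h1 : ContMDiffAt I I' 1 f x := hf.of_le (by simp)
  filter_upwards [(contMDiffAt_iff_contMDiffAt_nhds (by simp)).1 h1] with y hy
  exact hy.mdifferentiableAt (by simp)

variable {b : Π x, V x →L[ℝ] V x →L[ℝ] ℝ}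
  {K : (Π x : B, TangentSpace I x) → (Π x, V x) → (Π x, V x) → B → ℝ}

/-- A connection is smooth if its expression by a smooth non degenerate form is smooth. -/
theorem smoothConnection_of_form [IsManifold I 1 B] [ContMDiffVectorBundle ∞ F V I]
    (hinv : ∀ x, (b x).IsInvertible)
    (hb : ∀ x, ContMDiffAt I (I.prod 𝓘(ℝ, F →L[ℝ] F →L[ℝ] ℝ)) ∞
      (fun y => TotalSpace.mk' (F →L[ℝ] F →L[ℝ] ℝ)
        (E := fun y => V y →L[ℝ] V y →L[ℝ] ℝ) y (b y)) x)
    {D : CovariantDerivative I F V}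
    (hD : ∀ (x : B) (X : Π x, TangentSpace I x) (Y W : Π x, V x),
      MDifferentiableAt I (I.prod 𝓘(ℝ, EB)) (fun y => TotalSpace.mk' EB y (X y)) x →
      MDifferentiableAt I (I.prod 𝓘(ℝ, F)) (fun y => TotalSpace.mk' F y (Y y)) x →
      MDifferentiableAt I (I.prod 𝓘(ℝ, F)) (fun y => TotalSpace.mk' F y (W y)) x →
      b x (D Y x (X x)) (W x) = K X Y W x)
    (hK : ∀ (x : B) (X : Π x, TangentSpace I x) (Y W : Π x, V x),
      ContMDiffAt I (I.prod 𝓘(ℝ, EB)) ∞ (fun y => TotalSpace.mk' EB y (X y)) x →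
      ContMDiffAt I (I.prod 𝓘(ℝ, F)) ∞ (fun y => TotalSpace.mk' F y (Y y)) x →
      ContMDiffAt I (I.prod 𝓘(ℝ, F)) ∞ (fun y => TotalSpace.mk' F y (W y)) x →
      ContMDiffAt I 𝓘(ℝ, ℝ) ∞ (K X Y W) x) :
    SmoothConnection D := by
  refine smoothConnection_of_apply fun x X Y hX hY => ?_
  refine contMDiffAt_of_form hinv (hb x) fun W hW => ?_
  refine (hK x X Y W hX hY hW).congr_of_eventuallyEq ?_
  have e1 := eventually_mdifferentiableAt (I := I) hX
  have e2 := eventually_mdifferentiableAt (I := I) hY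
  have e3 := eventually_mdifferentiableAt (I := I) hW
  filter_upwards [e1, e2, e3] with y h1 h2 h3
  exact hD y X Y W h1 h2 h3

open Classical in
/-- Existence of a connection with a given expression by a non degenerate form. -/
theorem exists_connection_of_form [ContMDiffVectorBundle 1 F V I]
    (hinv : ∀ x, (b x).IsInvertible)
    (hX : ∀ (x : B) (Y W : Π x, V x),
      MDifferentiableAt I (I.prod 𝓘(ℝ, F)) (fun y => TotalSpace.mk' F y (Y y)) x →
      MDifferentiableAt I (I.prod 𝓘(ℝ, F)) (fun y => TotalSpace.mk' F y (W y)) x →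
      TensorialAt I EB (fun X => K X Y W x) x)
    (hW : ∀ (x : B) (X : Π x, TangentSpace I x) (Y : Π x, V x),
      MDifferentiableAt I (I.prod 𝓘(ℝ, EB)) (fun y => TotalSpace.mk' EB y (X y)) x →
      MDifferentiableAt I (I.prod 𝓘(ℝ, F)) (fun y => TotalSpace.mk' F y (Y y)) x →
      TensorialAt I F (fun W => K X Y W x) x)
    (hadd : ∀ (x : B) (X : Π x, TangentSpace I x) (Y Y' W : Π x, V x),
      MDifferentiableAt I (I.prod 𝓘(ℝ, EB)) (fun y => TotalSpace.mk' EB y (X y)) x →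
      MDifferentiableAt I (I.prod 𝓘(ℝ, F)) (fun y => TotalSpace.mk' F y (Y y)) x →
      MDifferentiableAt I (I.prod 𝓘(ℝ, F)) (fun y => TotalSpace.mk' F y (Y' y)) x →
      MDifferentiableAt I (I.prod 𝓘(ℝ, F)) (fun y => TotalSpace.mk' F y (W y)) x →
      K X (Y + Y') W x = K X Y W x + K X Y' W x)
    (hsmul : ∀ (x : B) (f : B → ℝ) (X : Π x, TangentSpace I x) (Y W : Π x, V x),
      MDifferentiableAt I 𝓘(ℝ, ℝ) f x →
      MDifferentiableAt I (I.prod 𝓘(ℝ, EB)) (fun y => TotalSpace.mk' EB y (X y)) x →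
      MDifferentiableAt I (I.prod 𝓘(ℝ, F)) (fun y => TotalSpace.mk' F y (Y y)) x →
      MDifferentiableAt I (I.prod 𝓘(ℝ, F)) (fun y => TotalSpace.mk' F y (W y)) x →
      K X (f • Y) W x = f x * K X Y W x + mvfderiv I f x (X x) * b x (Y x) (W x)) :
    ∃ D : CovariantDerivative I F V, ∀ (x : B) (X : Π x, TangentSpace I x) (Y W : Π x, V x),
      MDifferentiableAt I (I.prod 𝓘(ℝ, EB)) (fun y => TotalSpace.mk' EB y (X y)) x →
      MDifferentiableAt I (I.prod 𝓘(ℝ, F)) (fun y => TotalSpace.mk' F y (Y y)) x →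
      MDifferentiableAt I (I.prod 𝓘(ℝ, F)) (fun y => TotalSpace.mk' F y (W y)) x →
      b x (D Y x (X x)) (W x) = K X Y W x := by
  -- The value 0 at points of non-differentiability is harmless: the axioms of a connection and the
  -- required formula concern only differentiable sections.
  let D : (Π x, V x) → Π x, TangentSpace I x →L[ℝ] V x := fun Y x =>
    if hY : MDifferentiableAt I (I.prod 𝓘(ℝ, F)) (fun y => TotalSpace.mk' F y (Y y)) x then
      (b x).inverse ∘L TensorialAt.mkHom₂ (fun X W => K X Y W x) x
        (fun W h => hX x Y W hY h) (fun X h => hW x X Y h hY)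
    else 0
  have hD : ∀ (x : B) (X : Π x, TangentSpace I x) (Y W : Π x, V x),
      MDifferentiableAt I (I.prod 𝓘(ℝ, EB)) (fun y => TotalSpace.mk' EB y (X y)) x →
      MDifferentiableAt I (I.prod 𝓘(ℝ, F)) (fun y => TotalSpace.mk' F y (Y y)) x →
      MDifferentiableAt I (I.prod 𝓘(ℝ, F)) (fun y => TotalSpace.mk' F y (W y)) x →
      b x (D Y x (X x)) (W x) = K X Y W x := by
    intro x X Y W h1 h2 h3
    simp only [D, dif_pos h2, ContinuousLinearMap.comp_apply]
    rw [(hinv x).self_apply_inverse]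
    exact TensorialAt.mkHom₂_apply _ _ h1 h3
  -- Vectors at `x` extend to differentiable sections, so pairings with such sections determine a
  -- homomorphism at `x`.
  have hext : ∀ (x : B) (v v' : TangentSpace I x →L[ℝ] V x),
      (∀ (X : Π x, TangentSpace I x) (W : Π x, V x),
      MDifferentiableAt I (I.prod 𝓘(ℝ, EB)) (fun y => TotalSpace.mk' EB y (X y)) x →
      MDifferentiableAt I (I.prod 𝓘(ℝ, F)) (fun y => TotalSpace.mk' F y (W y)) x →
      b x (v (X x)) (W x) = b x (v' (X x)) (W x)) → v = v' := by
    intro x v v' h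
    ext Z
    have hinj : Function.Injective (b x) := (hinv x).injective
    refine hinj ?_
    ext w
    have := h (FiberBundle.extend EB Z) (FiberBundle.extend F w)
      (mdifferentiableAt_extend I EB Z) (mdifferentiableAt_extend I F w)
    simpa using this
  refine ⟨⟨D, ⟨?_, ?_⟩⟩, hD⟩
  · intro Y Y' x hY hY' _
    refine hext x _ _ fun X W h1 h3 => ?_
    rw [hD x X (Y + Y') W h1 (mdifferentiableAt_add_section hY hY') h3,
      hadd x X Y Y' W h1 hY hY' h3, add_apply, map_add, add_apply, hD x X Y W h1 hY h3,
      hD x X Y' W h1 hY' h3]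
  · intro Y f x hY hf _
    refine hext x _ _ fun X W h1 h3 => ?_
    rw [hD x X (f • Y) W h1 (hf.smul_section hY) h3, hsmul x f X Y W hf h1 hY h3, add_apply,
      map_add, add_apply, smul_apply, map_smul, smul_apply, hD x X Y W h1 hY h3]
    simp

end Connections

end BundleAux

/-! ### Smoothness of sections of `V₁`, `V₁^*` and `V` in components -/

namespace BigTangent
open BundleAux
section Structure

variable {E : Type*} [NormedAddCommGroup E] [NormedSpace ℝ E]
  {M : Type*} [TopologicalSpace M] [ChartedSpace E M] [IsManifold 𝓘(ℝ, E) ∞ M]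

/-- Smoothness of sections of `V₁` at a point. -/
def Smooth1 (Y : Π u, V1 E M u) (u : Total E M) : Prop :=
  ContMDiffAt (model E) ((model E).prod 𝓘(ℝ, E)) ∞ (fun v => TotalSpace.mk' E v (Y v)) u

/-- Smoothness of sections of `V₁^*` at a point. -/
def Smooth2 (a : Π u : Total E M, V1 E M u →L[ℝ] ℝ) (u : Total E M) : Prop :=
  ContMDiffAt (model E) ((model E).prod 𝓘(ℝ, E →L[ℝ] ℝ)) ∞
    (fun v => TotalSpace.mk' (E →L[ℝ] ℝ) (E := fun v => V1 E M v →L[ℝ] Trivial (Total E M) ℝ v)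
      v (a v)) u

/-- Smoothness of sections of `V` at a point. -/
def SmoothV (s : Π u, V E M u) (u : Total E M) : Prop :=
  ContMDiffAt (model E) ((model E).prod 𝓘(ℝ, E × (E →L[ℝ] ℝ))) ∞
    (fun v => TotalSpace.mk' (E × (E →L[ℝ] ℝ)) v (s v)) u

/-- Smoothness of vector fields on the big tangent manifold at a point. -/
def SmoothT (X : Π u : Total E M, TangentSpace (model E) u) (u : Total E M) : Prop :=
  ContMDiffAt (model E) ((model E).prod 𝓘(ℝ, E × (E × (E →L[ℝ] ℝ)))) ∞
    (fun v => TotalSpace.mk' (E × (E × (E →L[ℝ] ℝ))) v (X v)) u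

theorem trivializationAt_V1 (u v : Total E M) (Y : V1 E M v) :
    (trivializationAt E (V1 E M) u ⟨v, Y⟩).2 =
      (trivializationAt E (TangentSpace 𝓘(ℝ, E)) u.proj
        (⟨v.proj, Y⟩ : TotalSpace E (TangentSpace 𝓘(ℝ, E) : M → Type _))).2 := rfl

theorem symmL_V1 (u v : Total E M) (y : E) :
    (trivializationAt E (V1 E M) u).symmL ℝ v y =
      (trivializationAt E (TangentSpace 𝓘(ℝ, E) : M → Type _) u.proj).symmL ℝ v.proj y := by
  by_cases hv : v.proj ∈ (trivializationAt E (TangentSpace 𝓘(ℝ, E) : M → Type _) u.proj).baseSet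
  · have hv' : v ∈ (trivializationAt E (V1 E M) u).baseSet := hv
    set Y : V1 E M v :=
      (trivializationAt E (TangentSpace 𝓘(ℝ, E) : M → Type _) u.proj).symmL ℝ v.proj y with hY
    have h : (trivializationAt E (V1 E M) u ⟨v, Y⟩).2 = y := by
      rw [trivializationAt_V1, hY, Trivialization.symmL_apply _ hv]
      exact congrArg Prod.snd (Trivialization.apply_mk_symm _ hv y)
    rw [Trivialization.symmL_apply _ hv', ← h]
    exact Trivialization.symm_proj_apply _ (⟨v, Y⟩ : TotalSpace E (V1 E M)) hv'
  -- Outside the base set both inverse trivializations take the default value 0.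
  · have hv' : v ∉ (trivializationAt E (V1 E M) u).baseSet := hv
    have e1 : (trivializationAt E (V1 E M) u).symmL ℝ v y = 0 := by
      simp [Trivialization.symmL, hv']
    have e2 : (trivializationAt E (TangentSpace 𝓘(ℝ, E) : M → Type _) u.proj).symmL ℝ
        v.proj y = 0 := by
      exact Trivialization.symmₗ_apply_of_notMem _ hv y
    rw [e1, e2]
    rfl

/-- The covector part of V is pulled back from the cotangent bundle of M, while sections of V₁^* are
treated as sections of Hom(V₁, ℝ) over the big tangent manifold. The two bundle structures have the
same coordinates, so smoothness in V can be tested on the two components. -/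
theorem trivializationAt_V_snd (u v : Total E M) (w : V E M v) :
    (trivializationAt (E × (E →L[ℝ] ℝ)) (V E M) u ⟨v, w⟩).2.2 =
      (trivializationAt (E →L[ℝ] ℝ) (fun v => V1 E M v →L[ℝ] Trivial (Total E M) ℝ v) u
        ⟨v, prV2 v w⟩).2 := by
  rw [hom_trivializationAt_apply]
  change (trivializationAt (E →L[ℝ] ℝ)
    (fun x : M => TangentSpace 𝓘(ℝ, E) x →L[ℝ] Trivial M ℝ x) u.proj ⟨v.proj, prV2 v w⟩).2 = _
  rw [hom_trivializationAt_apply]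
  ext y
  simp only [ContinuousLinearMap.inCoordinates, ContinuousLinearMap.comp_apply, symmL_V1]
  rfl

theorem smoothV_iff {s : Π u, V E M u} {u : Total E M} :
    SmoothV s u ↔ Smooth1 (fun v => prV1 v (s v)) u ∧ Smooth2 (fun v => prV2 v (s v)) u := by
  rw [SmoothV, Smooth1, Smooth2, contMDiffAt_section, contMDiffAt_section, contMDiffAt_section]
  have h : (fun v => (trivializationAt (E →L[ℝ] ℝ)
      (fun v => V1 E M v →L[ℝ] Trivial (Total E M) ℝ v) u ⟨v, prV2 v (s v)⟩).2) =
      fun v => (trivializationAt (E × (E →L[ℝ] ℝ)) (V E M) u ⟨v, s v⟩).2.2 :=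
    funext fun v => (trivializationAt_V_snd u v (s v)).symm
  rw [h]
  exact contMDiffAt_prod_module_iff (I := model E) (F₁ := E) (F₂ := E →L[ℝ] ℝ)
    (fun v => (trivializationAt (E × (E →L[ℝ] ℝ)) (V E M) u ⟨v, s v⟩).2)

theorem Smooth1.diff1 {Y : Π u, V1 E M u} {u : Total E M} (h : Smooth1 Y u) : Diff1 Y u :=
  ContMDiffAt.mdifferentiableAt h (by simp)

theorem SmoothV.diffV {s : Π u, V E M u} {u : Total E M} (h : SmoothV s u) : DiffV s u :=
  ContMDiffAt.mdifferentiableAt h (by simp)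

theorem SmoothT.diffT {X : Π u : Total E M, TangentSpace (model E) u} {u : Total E M}
    (h : SmoothT X u) : DiffT X u :=
  ContMDiffAt.mdifferentiableAt h (by simp)

theorem Smooth1.add {Y Y' : Π u, V1 E M u} {u : Total E M} (h : Smooth1 Y u) (h' : Smooth1 Y' u) :
    Smooth1 (fun v => Y v + Y' v) u :=
  ContMDiffAt.add_section h h'

theorem SmoothV.add {Y Y' : Π u, V E M u} {u : Total E M} (h : SmoothV Y u) (h' : SmoothV Y' u) :
    SmoothV (fun v => Y v + Y' v) u :=
  ContMDiffAt.add_section h h'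

theorem Smooth2.add {Y Y' : Π u : Total E M, V1 E M u →L[ℝ] ℝ} {u : Total E M}
    (h : Smooth2 Y u) (h' : Smooth2 Y' u) : Smooth2 (fun v => Y v + Y' v) u :=
  ContMDiffAt.add_section (V := fun v => V1 E M v →L[ℝ] Trivial (Total E M) ℝ v) h h'

theorem Smooth2.const_smul {Y : Π u : Total E M, V1 E M u →L[ℝ] ℝ} {u : Total E M} (c : ℝ)
    (h : Smooth2 Y u) : Smooth2 (fun v => c • Y v) u :=
  ContMDiffAt.const_smul_section (V := fun v => V1 E M v →L[ℝ] Trivial (Total E M) ℝ v)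
    (a := c) h

theorem SmoothT.add {Y Y' : Π u : Total E M, TangentSpace (model E) u} {u : Total E M}
    (h : SmoothT Y u) (h' : SmoothT Y' u) : SmoothT (fun v => Y v + Y' v) u :=
  ContMDiffAt.add_section h h'

theorem SmoothT.sub {Y Y' : Π u : Total E M, TangentSpace (model E) u} {u : Total E M}
    (h : SmoothT Y u) (h' : SmoothT Y' u) : SmoothT (fun v => Y v - Y' v) u :=
  ContMDiffAt.sub_section h h'

theorem smooth1_zero (u : Total E M) : Smooth1 (fun v => (0 : V1 E M v)) u :=
  (contMDiff_zeroSection ℝ (V1 E M)).contMDiffAt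

theorem smooth2_zero (u : Total E M) : Smooth2 (fun v => (0 : V1 E M v →L[ℝ] ℝ)) u :=
  (contMDiff_zeroSection ℝ (fun v => V1 E M v →L[ℝ] Trivial (Total E M) ℝ v)).contMDiffAt

variable [FiniteDimensional ℝ E]

theorem smoothHom_inclV1 :
    SmoothHom (model E) E (E × (E →L[ℝ] ℝ)) (inclV1 : ∀ _ : Total E M, _) :=
  fun _ => contMDiffAt_hom_of_apply fun _ hY =>
    smoothV_iff.2 ⟨hY, smooth2_zero _⟩

theorem smoothHom_prV1 :
    SmoothHom (model E) (E × (E →L[ℝ] ℝ)) E (prV1 : ∀ _ : Total E M, _) :=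
  fun _ => contMDiffAt_hom_of_apply fun _ hs => (smoothV_iff.1 hs).1

theorem smoothHom_inclV2 :
    SmoothHom (V₁ := fun v => V1 E M v →L[ℝ] Trivial (Total E M) ℝ v) (model E) (E →L[ℝ] ℝ)
      (E × (E →L[ℝ] ℝ)) (inclV2 : ∀ _ : Total E M, _) :=
  fun _ => contMDiffAt_hom_of_apply fun _ hY =>
    smoothV_iff.2 ⟨smooth1_zero _, hY⟩

theorem smoothHom_prV2 :
    SmoothHom (V₂ := fun v => V1 E M v →L[ℝ] Trivial (Total E M) ℝ v) (model E)
      (E × (E →L[ℝ] ℝ)) (E →L[ℝ] ℝ) (prV2 : ∀ _ : Total E M, _) :=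
  fun _ => contMDiffAt_hom_of_apply fun _ hs => (smoothV_iff.1 hs).2

end Structure
end BigTangent

/-! ### Smoothness of the vertical lift and the differential of the projection -/

namespace BigTangent
open BundleAux
section VerticalLift

variable {E : Type*} [NormedAddCommGroup E] [NormedSpace ℝ E]
  {M : Type*} [TopologicalSpace M] [ChartedSpace E M] [IsManifold 𝓘(ℝ, E) ∞ M]

open Filter Topology

/-- The inclusion of the fibre over `x` in the big tangent manifold is smooth. -/
theorem contMDiff_fibreIncl (x : M) :
    ContMDiff 𝓘(ℝ, E × (E →L[ℝ] ℝ)) (model E) ∞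
      (fun w : E × (E →L[ℝ] ℝ) => (⟨x, w⟩ : Total E M)) := by
  intro w
  rw [contMDiffAt_totalSpace]
  refine ⟨contMDiffAt_const, ?_⟩
  let e := trivializationAt (E × (E →L[ℝ] ℝ)) (Fibre E M) x
  have hx : x ∈ e.baseSet := FiberBundle.mem_baseSet_trivializationAt' x
  let L : (E × (E →L[ℝ] ℝ)) →L[ℝ] (E × (E →L[ℝ] ℝ)) :=
    (e.continuousLinearEquivAt ℝ x hx : Fibre E M x →L[ℝ] (E × (E →L[ℝ] ℝ)))
  exact L.contMDiff.contMDiffAt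

/-- The translation of `u` in its fibre by `t w`. -/
def translate (u : Total E M) (w : Fibre E M u.proj) (t : ℝ) : Total E M :=
  ⟨u.proj, u.2 + t • w⟩

/-- The translations of the fibres by multiples of a smooth section of the vertical bundle. -/
theorem contMDiffAt_translation {s : Π u, V E M u} {u : Total E M} (hs : SmoothV s u) :
    ContMDiffAt ((model E).prod 𝓘(ℝ, ℝ)) (model E) ∞
      (Function.uncurry fun (v : Total E M) (t : ℝ) => translate v (s v) t) (u, 0) := by
  let e := trivializationAt (E × (E →L[ℝ] ℝ)) (Fibre E M) u.proj
  have hproj : ContMDiffAt ((model E).prod 𝓘(ℝ, ℝ)) 𝓘(ℝ, E) ∞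
      (fun q : Total E M × ℝ => q.1.proj) (u, 0) :=
    (p E M).contMDiff.contMDiffAt.comp (u, (0 : ℝ)) contMDiffAt_fst
  rw [contMDiffAt_totalSpace]
  refine ⟨hproj, ?_⟩
  have h1 : ContMDiffAt ((model E).prod 𝓘(ℝ, ℝ)) 𝓘(ℝ, E × (E →L[ℝ] ℝ)) ∞
      (fun q : Total E M × ℝ => (e q.1).2) (u, 0) := by
    have := (contMDiffAt_totalSpace.1 (contMDiffAt_id (I := model E) (n := ∞) (x := u))).2
    exact ContMDiffAt.comp (u, (0 : ℝ)) (g := fun v : Total E M => (e v).2) this contMDiffAt_fst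
  have h2 : ContMDiffAt ((model E).prod 𝓘(ℝ, ℝ)) 𝓘(ℝ, E × (E →L[ℝ] ℝ)) ∞
      (fun q : Total E M × ℝ => (e ⟨q.1.proj, s q.1⟩).2) (u, 0) := by
    have := (contMDiffAt_section u).1 hs
    exact ContMDiffAt.comp (u, (0 : ℝ)) (g := fun v : Total E M => (e ⟨v.proj, s v⟩).2) this
      contMDiffAt_fst
  have h3 := h1.add (ContMDiffAt.smul (contMDiffAt_snd (J := 𝓘(ℝ, ℝ)) (n := ∞)
    (p := (u, (0 : ℝ))) (I := model E)) h2)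
  refine h3.congr_of_eventuallyEq ?_
  have hb : ∀ᶠ q : Total E M × ℝ in 𝓝 (u, 0), q.1.proj ∈ e.baseSet :=
    hproj.continuousAt (e.open_baseSet.mem_nhds (FiberBundle.mem_baseSet_trivializationAt' u.proj))
  filter_upwards [hb] with q hq
  have := (e.linear ℝ hq)
  exact (this.map_add _ _).trans (congrArg _ (this.map_smul _ _))

/-- As the velocity of t ↦ u + t w, the vertical lift is a derivative in a parameter, and its
smoothness in u follows from joint smoothness of the translations. The definition uses a fibre
inclusion that changes with u and does not show this. -/
theorem vlift_eq_mfderiv (u : Total E M) (w : V E M u) :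
    vlift u w = mfderiv 𝓘(ℝ, ℝ) (model E)
      (translate u w) 0 (1 : ℝ) := by
  let w' : E × (E →L[ℝ] ℝ) := w
  let u' : E × (E →L[ℝ] ℝ) := u.2
  have h1 : HasFDerivAt (fun t : ℝ => u' + t • w') ((1 : ℝ →L[ℝ] ℝ).smulRight w') 0 := by
    exact (HasFDerivAt.smul_const (hasFDerivAt_id (0 : ℝ)) w').const_add u'
  have hc : MDifferentiableAt 𝓘(ℝ, E × (E →L[ℝ] ℝ)) (model E)
      (fun w : E × (E →L[ℝ] ℝ) => (⟨u.proj, w⟩ : Total E M)) (u' + (0 : ℝ) • w') :=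
    (contMDiff_fibreIncl (E := E) u.proj).contMDiffAt.mdifferentiableAt (by simp)
  have h2 := hc.hasMFDerivAt.comp (0 : ℝ) h1.hasMFDerivAt
  have h3 := h2.mfderiv
  have h4 : u' + (0 : ℝ) • w' = u' := by simp
  have h5 : mfderiv 𝓘(ℝ, ℝ) (model E)
      (translate u w) 0 (1 : ℝ) =
    mfderiv 𝓘(ℝ, E × (E →L[ℝ] ℝ)) (model E)
      (fun w : E × (E →L[ℝ] ℝ) => (⟨u.proj, w⟩ : Total E M)) (u' + (0 : ℝ) • w')
        (((1 : ℝ →L[ℝ] ℝ).smulRight w') 1) := congrArg (fun L => L (1 : ℝ)) h3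
  rw [h5]
  have h6 : (((1 : ℝ →L[ℝ] ℝ).smulRight w') 1) = w' := by simp
  rw [h6]
  change mfderiv 𝓘(ℝ, E × (E →L[ℝ] ℝ)) (model E)
      (fun w : E × (E →L[ℝ] ℝ) => (⟨u.proj, w⟩ : Total E M)) u' w' = _
  congr 2
  exact h4.symm

theorem SmoothV.smoothT_vlift {s : Π u, V E M u} {u : Total E M} (hs : SmoothV s u) :
    SmoothT (fun v => vlift v (s v)) u := by
  have h := ContMDiffAt.mfderiv (m := ∞) (I := 𝓘(ℝ, ℝ)) (I' := model E)
    (fun (v : Total E M) (t : ℝ) => translate v (s v) t) (fun _ => (0 : ℝ))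
    (contMDiffAt_translation hs) contMDiffAt_const (by simp)
  -- At time 0 the translation is the identity, so the derivative is indeed taken with values over
  -- v.
  have hg : (fun v : Total E M => translate v (s v) 0) = id := by
    funext v
    exact congrArg (fun w => (⟨v.proj, w⟩ : Total E M))
      ((congrArg (fun w => v.2 + w) (zero_smul ℝ _)).trans (add_zero v.2))
  have h' : ContMDiffAt (model E) 𝓘(ℝ, ℝ →L[ℝ] E × (E × (E →L[ℝ] ℝ))) ∞
      (inTangentCoordinates 𝓘(ℝ, ℝ) (model E) (fun _ : Total E M => (0 : ℝ)) id
        (fun v => mfderiv 𝓘(ℝ, ℝ) (model E) (translate v (s v)) 0) u) u := by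
    rw [← hg]
    exact h
  have h1 := h'.clm_apply (contMDiffAt_const (c := (1 : ℝ)))
  rw [SmoothT, contMDiffAt_section]
  refine h1.congr_of_eventuallyEq ?_
  filter_upwards [(trivializationAt (E × (E × (E →L[ℝ] ℝ)))
    (TangentSpace (model E) : Total E M → Type _) u).open_baseSet.mem_nhds
      (FiberBundle.mem_baseSet_trivializationAt' u)] with v hv
  have e1 : (trivializationAt ℝ (TangentSpace 𝓘(ℝ, ℝ) : ℝ → Type _) 0).symmL ℝ 0 (1 : ℝ)
      = (1 : ℝ) := by
    simp
    rfl
  rw [vlift_eq_mfderiv]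
  let Q := (trivializationAt (E × (E × (E →L[ℝ] ℝ)))
    (TangentSpace (model E) : Total E M → Type _) u).continuousLinearMapAt ℝ v
  let D : ℝ →L[ℝ] TangentSpace (model E) v := mfderiv 𝓘(ℝ, ℝ) (model E) (translate v (s v)) 0
  refine Eq.trans ?_ (congrArg (fun t => Q (D t)) e1.symm)
  exact (congrFun (Trivialization.coe_linearMapAt_of_mem (R := ℝ) _ hv) (D 1)).symm

variable [FiniteDimensional ℝ E]

theorem smoothHom_vlift :
    SmoothHom (model E) (E × (E →L[ℝ] ℝ)) (E × (E × (E →L[ℝ] ℝ)))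
      (vlift : ∀ _ : Total E M, _) :=
  fun _ => contMDiffAt_hom_of_apply fun _ hs => SmoothV.smoothT_vlift hs

/-- The differential of the projection of the big tangent manifold on `M`. -/
def dproj (u : Total E M) : TangentSpace (model E) u →L[ℝ] V1 E M u :=
  mfderiv (model E) 𝓘(ℝ, E) (p E M) u

theorem smoothHom_dproj :
    SmoothHom (model E) (E × (E × (E →L[ℝ] ℝ))) E (dproj : ∀ _ : Total E M, _) := by
  intro u
  refine contMDiffAt_hom_of_apply fun X hX => ?_
  have h := ((p E M).contMDiff.contMDiff_tangentMap (m := ∞) (by simp)).contMDiffAt.comp u hX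
  rw [contMDiffAt_section]
  exact (contMDiffAt_totalSpace.1 h).2

theorem mfderiv_proj_comp_fibreIncl (x : M) (y w : E × (E →L[ℝ] ℝ)) :
    (mfderiv (model E) 𝓘(ℝ, E) (p E M) ⟨x, y⟩ : E × (E × (E →L[ℝ] ℝ)) →L[ℝ] E)
      ((mfderiv 𝓘(ℝ, E × (E →L[ℝ] ℝ)) (model E)
        (fun w : E × (E →L[ℝ] ℝ) => (⟨x, w⟩ : Total E M)) y :
          E × (E →L[ℝ] ℝ) →L[ℝ] E × (E × (E →L[ℝ] ℝ))) w) = 0 := by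
  have hc : MDifferentiableAt 𝓘(ℝ, E × (E →L[ℝ] ℝ)) (model E)
      (fun w : E × (E →L[ℝ] ℝ) => (⟨x, w⟩ : Total E M)) y :=
    (contMDiff_fibreIncl (E := E) x).contMDiffAt.mdifferentiableAt (by simp)
  have hp : MDifferentiableAt (model E) 𝓘(ℝ, E) (p E M) (⟨x, y⟩ : Total E M) :=
    (p E M).contMDiff.contMDiffAt.mdifferentiableAt (by simp)
  have h := mfderiv_comp y hp hc
  have h2 : (p E M) ∘ (fun w : E × (E →L[ℝ] ℝ) => (⟨x, w⟩ : Total E M)) = fun _ => x := rfl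
  rw [h2, mfderiv_const] at h
  exact (congrArg (fun L : (E × (E →L[ℝ] ℝ)) →L[ℝ] E => L w) h).symm

theorem dproj_vlift (u : Total E M) (w : V E M u) : dproj u (vlift u w) = 0 :=
  mfderiv_proj_comp_fibreIncl (E := E) (M := M) u.proj u.2 w

/-- A local section of p through u is a right inverse of p, and its differential splits that of p.
-/
theorem dproj_surjective (u : Total E M) : Function.Surjective (dproj u) := by
  let c : M → Total E M := fun x =>
    ⟨x, FiberBundle.extend (E × (E →L[ℝ] ℝ)) (E := Fibre E M) u.2 x⟩
  have hcu : c u.proj = u := by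
    change (⟨u.proj, FiberBundle.extend (E × (E →L[ℝ] ℝ)) (E := Fibre E M) u.2 u.proj⟩ :
      Total E M) = u
    rw [FiberBundle.extend_apply_self]
  have hc : MDifferentiableAt 𝓘(ℝ, E) (model E) c u.proj :=
    FiberBundle.mdifferentiableAt_extend 𝓘(ℝ, E) (E × (E →L[ℝ] ℝ)) u.2
  have hp : MDifferentiableAt (model E) 𝓘(ℝ, E) (p E M) (c u.proj) :=
    (p E M).contMDiff.contMDiffAt.mdifferentiableAt (by simp)
  have h := mfderiv_comp u.proj hp hc
  have h2 : p E M ∘ c = id := rfl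
  rw [h2, mfderiv_id] at h
  -- The chain rule is at `c u.proj`, which equals `u` only propositionally. All tangent spaces are
  -- the same model space, and the equality is transported there.
  let q : Total E M → (E × (E × (E →L[ℝ] ℝ)) →L[ℝ] E) := fun v => mfderiv (model E) 𝓘(ℝ, E) (p E M) v
  have h3 : (mfderiv (model E) 𝓘(ℝ, E) (p E M) (c u.proj) :
      E × (E × (E →L[ℝ] ℝ)) →L[ℝ] E) = dproj u :=
    congrArg q hcu
  intro Y
  let Z : E × (E × (E →L[ℝ] ℝ)) := mfderiv 𝓘(ℝ, E) (model E) c u.proj Y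
  have h4 : (mfderiv (model E) 𝓘(ℝ, E) (p E M) (c u.proj) :
      E × (E × (E →L[ℝ] ℝ)) →L[ℝ] E) Z = Y :=
    (congrArg (fun L : E →L[ℝ] E => L Y) h).symm
  rw [h3] at h4
  exact ⟨Z, h4⟩

end VerticalLift
end BigTangent

/-! ### Smoothness and pull-back of bilinear forms -/

namespace BundleAux

section SmoothForms

variable {EB : Type*} [NormedAddCommGroup EB] [NormedSpace ℝ EB]
  {HB : Type*} [TopologicalSpace HB] {I : ModelWithCorners ℝ EB HB}
  {B : Type*} [TopologicalSpace B] [ChartedSpace HB B]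
  {F₁ : Type*} [NormedAddCommGroup F₁] [NormedSpace ℝ F₁]
  {V₁ : B → Type*} [TopologicalSpace (TotalSpace F₁ V₁)]
  [∀ x, AddCommGroup (V₁ x)] [∀ x, Module ℝ (V₁ x)] [∀ x, TopologicalSpace (V₁ x)]
  [∀ x, IsTopologicalAddGroup (V₁ x)] [∀ x, ContinuousSMul ℝ (V₁ x)]
  [FiberBundle F₁ V₁] [VectorBundle ℝ F₁ V₁] [FiniteDimensional ℝ F₁]
  [ContMDiffVectorBundle ∞ F₁ V₁ I]

/-- A bilinear form is smooth if its values on smooth sections are. -/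
theorem contMDiffAt_form_of_apply {b : Π x, V₁ x →L[ℝ] V₁ x →L[ℝ] ℝ} {x : B}
    (h : ∀ s t : Π y, V₁ y,
      ContMDiffAt I (I.prod 𝓘(ℝ, F₁)) ∞ (fun y => TotalSpace.mk' F₁ y (s y)) x →
      ContMDiffAt I (I.prod 𝓘(ℝ, F₁)) ∞ (fun y => TotalSpace.mk' F₁ y (t y)) x →
      ContMDiffAt I 𝓘(ℝ, ℝ) ∞ (fun y => b y (s y) (t y)) x) :
    ContMDiffAt I (I.prod 𝓘(ℝ, F₁ →L[ℝ] F₁ →L[ℝ] ℝ)) ∞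
      (fun y => TotalSpace.mk' (F₁ →L[ℝ] F₁ →L[ℝ] ℝ)
        (E := fun y => V₁ y →L[ℝ] V₁ y →L[ℝ] ℝ) y (b y)) x := by
  refine contMDiffAt_hom_of_apply (V₂ := fun y => V₁ y →L[ℝ] Bundle.Trivial B ℝ y)
    fun s hs => ?_
  refine contMDiffAt_hom_of_apply (V₂ := fun y => Bundle.Trivial B ℝ y) fun t ht => ?_
  rw [contMDiffAt_section]
  exact h s t hs ht

end SmoothForms

/-- The pull-back of a bilinear form by a linear map. -/
def pullForm {F G : Type*} [AddCommGroup F] [Module ℝ F] [TopologicalSpace F]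
    [IsTopologicalAddGroup F] [ContinuousSMul ℝ F]
    [AddCommGroup G] [Module ℝ G] [TopologicalSpace G]
    [IsTopologicalAddGroup G] [ContinuousSMul ℝ G] (b : F →L[ℝ] F →L[ℝ] ℝ) (A : G →L[ℝ] F) :
    G →L[ℝ] G →L[ℝ] ℝ :=
  (ContinuousLinearMap.precomp ℝ A) ∘L b ∘L A

end BundleAux

/-! ### The splitting of `V` into eigenbundles, and the metrics `g_V`, `g` and `g_σ` -/

namespace BigTangent
open BundleAux

section Structure

variable {E : Type*} [NormedAddCommGroup E] [NormedSpace ℝ E]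
  {M : Type*} [TopologicalSpace M] [ChartedSpace E M] [IsManifold 𝓘(ℝ, E) ∞ M]

theorem Smooth1.const_smul {Y : Π u, V1 E M u} {u : Total E M} (c : ℝ) (h : Smooth1 Y u) :
    Smooth1 (fun v => c • Y v) u :=
  ContMDiffAt.const_smul_section (a := c) h

theorem Smooth2.sub {Y Y' : Π u : Total E M, V1 E M u →L[ℝ] ℝ} {u : Total E M}
    (h : Smooth2 Y u) (h' : Smooth2 Y' u) : Smooth2 (fun v => Y v - Y' v) u :=
  ContMDiffAt.sub_section (V := fun v => V1 E M v →L[ℝ] Trivial (Total E M) ℝ v) h h'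

end Structure

namespace DoubleField

variable {E : Type*} [NormedAddCommGroup E] [NormedSpace ℝ E]
  {M : Type*} [TopologicalSpace M] [ChartedSpace E M] [IsManifold 𝓘(ℝ, E) ∞ M]
  (Φ : DoubleField E M)

/-- `ι_ε` as a continuous linear map. -/
def iotaL (ε : ℝ) (u : Total E M) : V1 E M u →L[ℝ] V E M u :=
  inclV1 u + inclV2 u ∘L (Φ.ψ u + ε • Φ.σ u)

theorem iotaL_apply (ε : ℝ) (u : Total E M) (Y : V1 E M u) : Φ.iotaL ε u Y = Φ.iota ε u Y := rfl

/-- The `V₁`-component of the projection on the eigenbundle `U_ε` of `φ`. -/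
def coordU (ε : ℝ) (u : Total E M) : V E M u →L[ℝ] V1 E M u :=
  (1 / 2 : ℝ) • (prV1 u + ε • (Φ.sharp u ∘L (prV2 u - Φ.ψ u ∘L prV1 u)))

theorem coordU_apply (ε : ℝ) (u : Total E M) (w : V E M u) :
    Φ.coordU ε u w =
      (1 / 2 : ℝ) • (prV1 u w + ε • Φ.sharp u (prV2 u w - Φ.ψ u (prV1 u w))) := rfl

theorem prV1_prU (ε : ℝ) (u : Total E M) (w : V E M u) :
    prV1 u (Φ.prU ε u w) = Φ.coordU ε u w := by
  rw [prU, map_smul, map_add, map_smul, prV1_phi, coordU_apply]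

theorem prV1_iota (ε : ℝ) (u : Total E M) (Y : V1 E M u) : prV1 u (Φ.iota ε u Y) = Y := by
  rw [iota, map_add, prV1_inclV1, prV1_inclV2, add_zero]

theorem prV2_iota (ε : ℝ) (u : Total E M) (Y : V1 E M u) :
    prV2 u (Φ.iota ε u Y) = Φ.ψ u Y + ε • Φ.σ u Y := by
  rw [iota, map_add, prV2_inclV1, prV2_inclV2, zero_add]

theorem iota_zero (ε : ℝ) (u : Total E M) : Φ.iota ε u 0 = 0 := map_zero (Φ.iotaL ε u)

theorem iota_sub (ε : ℝ) (u : Total E M) (Y Y' : V1 E M u) :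
    Φ.iota ε u (Y - Y') = Φ.iota ε u Y - Φ.iota ε u Y' :=
  map_sub (Φ.iotaL ε u) Y Y'

variable [FiniteDimensional ℝ E]

/-- With α = (♭_ψ + ε' ♭_σ)Y the term ♯_σ(α - ♭_ψ Y) is ε' Y. For signs ε, ε' the factor is 1 or 0
according to whether they agree. -/
theorem coordU_iota (ε ε' : ℝ) (u : Total E M) (Y : V1 E M u) :
    Φ.coordU ε u (Φ.iota ε' u Y) = ((1 + ε * ε') / 2) • Y := by
  rw [coordU_apply, prV1_iota, prV2_iota, add_sub_cancel_left, map_smul, sharp_sigma]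
  module

theorem coordU_iota_self {ε : ℝ} (hε : ε = 1 ∨ ε = -1) (u : Total E M) (Y : V1 E M u) :
    Φ.coordU ε u (Φ.iota ε u Y) = Y := by
  rw [coordU_iota]
  rcases hε with rfl | rfl <;> norm_num

theorem coordU_neg_iota {ε : ℝ} (hε : ε = 1 ∨ ε = -1) (u : Total E M) (Y : V1 E M u) :
    Φ.coordU (-ε) u (Φ.iota ε u Y) = 0 := by
  rw [coordU_iota]
  rcases hε with rfl | rfl <;> norm_num

theorem coordU_iota_neg {ε : ℝ} (hε : ε = 1 ∨ ε = -1) (u : Total E M) (Y : V1 E M u) :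
    Φ.coordU ε u (Φ.iota (-ε) u Y) = 0 := by
  rw [coordU_iota]
  rcases hε with rfl | rfl <;> norm_num

/-- This is the decomposition V = U₊ ⊕ U₋ expressed through two sections of V₁; it reduces
statements about V to σ on V₁. -/
theorem iota_coordU_add (u : Total E M) (w : V E M u) :
    Φ.iota 1 u (Φ.coordU 1 u w) + Φ.iota (-1) u (Φ.coordU (-1) u w) = w := by
  refine V_ext ?_ ?_
  · rw [map_add, prV1_iota, prV1_iota, coordU_apply, coordU_apply]
    module
  · rw [map_add, prV2_iota, prV2_iota, coordU_apply, coordU_apply]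
    simp only [map_add, map_smul, sigma_sharp]
    generalize Φ.ψ u (Φ.sharp u (prV2 u w - Φ.ψ u (prV1 u w))) = a
    generalize Φ.ψ u (prV1 u w) = b
    generalize Φ.σ u (prV1 u w) = c
    generalize prV2 u w = d
    module

theorem prU_eq {ε : ℝ} (hε : ε = 1 ∨ ε = -1) (u : Total E M) (w : V E M u) :
    Φ.prU ε u w = Φ.iota ε u (Φ.coordU ε u w) := by
  have hε2 : ε * ε = 1 := by rcases hε with rfl | rfl <;> norm_num
  rw [prU]
  conv_lhs => rw [← Φ.iota_coordU_add u w]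
  rw [map_add, phi_iota _ _ (Or.inl rfl), phi_iota _ _ (Or.inr rfl)]
  rcases hε with rfl | rfl <;> module

/-- With Z = ♯_σ(α - ♭_ψ Y) the form is σ(Y, Y') + σ(Z, Z') and the coordinates are (Y ± Z)/2, so
this is the parallelogram identity. -/
theorem gV_eq (u : Total E M) (w w' : V E M u) :
    Φ.gV u w w' = 2 * (Φ.σ u (Φ.coordU 1 u w) (Φ.coordU 1 u w') +
      Φ.σ u (Φ.coordU (-1) u w) (Φ.coordU (-1) u w')) := by
  rw [gV_apply]
  simp only [coordU_apply]
  have h : (prV2 u w' - Φ.ψ u (prV1 u w')) (Φ.sharp u (prV2 u w - Φ.ψ u (prV1 u w))) =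
      Φ.σ u (Φ.sharp u (prV2 u w - Φ.ψ u (prV1 u w)))
        (Φ.sharp u (prV2 u w' - Φ.ψ u (prV1 u w'))) := by
    rw [sigma_sharp, sharp_symm]
  rw [h]
  generalize Φ.sharp u (prV2 u w - Φ.ψ u (prV1 u w)) = Z
  generalize Φ.sharp u (prV2 u w' - Φ.ψ u (prV1 u w')) = Z'
  generalize prV1 u w = Y
  generalize prV1 u w' = Y'
  simp only [map_add, map_smul, add_apply, smul_apply, smul_eq_mul]
  ring

/-- By skewness of ψ, 2g equals σ(Z, Y') + σ(Z', Y) with Z = ♯_σ(α - ♭_ψ Y), Z' likewise.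
Polarization in (Y ± Z)/2 gives a difference where `gV_eq` has a sum. -/
theorem g_eq (u : Total E M) (w w' : V E M u) :
    g u w w' = Φ.σ u (Φ.coordU 1 u w) (Φ.coordU 1 u w') -
      Φ.σ u (Φ.coordU (-1) u w) (Φ.coordU (-1) u w') := by
  rw [g_apply]
  simp only [coordU_apply]
  have h : (prV2 u w (prV1 u w') + prV2 u w' (prV1 u w)) =
      Φ.σ u (Φ.sharp u (prV2 u w - Φ.ψ u (prV1 u w))) (prV1 u w') +
      Φ.σ u (Φ.sharp u (prV2 u w' - Φ.ψ u (prV1 u w'))) (prV1 u w) := by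
    rw [sigma_sharp, sigma_sharp, sub_apply, sub_apply, Φ.psi_neg u (prV1 u w)]
    ring
  rw [h]
  generalize Φ.sharp u (prV2 u w - Φ.ψ u (prV1 u w)) = Z
  generalize Φ.sharp u (prV2 u w' - Φ.ψ u (prV1 u w')) = Z'
  generalize prV1 u w = Y
  generalize prV1 u w' = Y'
  rw [Φ.σ_symm u Z' Y]
  simp only [map_add, map_smul, add_apply, smul_apply, smul_eq_mul]
  ring

theorem gV_iota_iota_neg {ε : ℝ} (hε : ε = 1 ∨ ε = -1) (u : Total E M) (Y Y' : V1 E M u) :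
    Φ.gV u (Φ.iota ε u Y) (Φ.iota (-ε) u Y') = 0 := by
  simp only [gV_eq, coordU_iota]
  rcases hε with rfl | rfl <;> norm_num

/-- `g_V` as a continuous bilinear form. -/
def gVL (u : Total E M) : V E M u →L[ℝ] V E M u →L[ℝ] ℝ :=
  (2 : ℝ) • (pullForm (Φ.σ u) (Φ.coordU 1 u) +
    pullForm (Φ.σ u) (Φ.coordU (-1) u))

theorem gVL_apply (u : Total E M) (w w' : V E M u) : Φ.gVL u w w' = Φ.gV u w w' := by
  rw [gV_eq]
  rfl

/-- The isomorphism of a finite dimensional space on its dual defined by a non degenerate form. -/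
theorem isInvertible_of_nondegenerate {F : Type*} [AddCommGroup F] [Module ℝ F]
    [TopologicalSpace F] [IsTopologicalAddGroup F] [ContinuousSMul ℝ F] [T2Space F]
    [FiniteDimensional ℝ F] (b : F →L[ℝ] F →L[ℝ] ℝ)
    (hb : ∀ Y, (∀ Y', b Y Y' = 0) → Y = 0) : b.IsInvertible := by
  have hinj : Function.Injective b.toLinearMap :=
    (injective_iff_map_eq_zero b.toLinearMap).2 fun Y hY =>
      hb Y fun Y' => congrArg (fun h : F →L[ℝ] ℝ => h Y') hY
  have hdim : Module.finrank ℝ F = Module.finrank ℝ (F →L[ℝ] ℝ) := by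
    rw [← (LinearMap.toContinuousLinearMap : (F →ₗ[ℝ] ℝ) ≃ₗ[ℝ] (F →L[ℝ] ℝ)).finrank_eq]
    exact (Subspace.dual_finrank_eq (K := ℝ) (V := F)).symm
  let e : F ≃L[ℝ] (F →L[ℝ] ℝ) :=
    (LinearEquiv.ofInjectiveOfFinrankEq b.toLinearMap hinj hdim).toContinuousLinearEquiv
  exact ⟨e, by ext x y; rfl⟩

theorem gVL_isInvertible (u : Total E M) : (Φ.gVL u).IsInvertible := by
  let b : (E × (E →L[ℝ] ℝ)) →L[ℝ] (E × (E →L[ℝ] ℝ)) →L[ℝ] ℝ := Φ.gVL u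
  refine isInvertible_of_nondegenerate b fun w hw => ?_
  exact (Φ.gV_nondegenerate u).1 w fun w' => (Φ.gVL_apply u w w').symm.trans (hw w')

/-! ### Smoothness of the structure -/

theorem smoothHom_vert :
    SmoothHom (model E) (E × (E × (E →L[ℝ] ℝ))) (E × (E →L[ℝ] ℝ)) Φ.H.vert :=
  fun u => Φ.H.smooth u

theorem contMDiffAt_sigma {Y Y' : Π u, V1 E M u} {u : Total E M} (h : Smooth1 Y u)
    (h' : Smooth1 Y' u) : ContMDiffAt (model E) 𝓘(ℝ, ℝ) ∞ (fun v => Φ.σ v (Y v) (Y' v)) u :=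
  contMDiffAt_form (Φ.σ_smooth u) h h'

theorem contMDiffAt_psi {Y Y' : Π u, V1 E M u} {u : Total E M} (h : Smooth1 Y u)
    (h' : Smooth1 Y' u) : ContMDiffAt (model E) 𝓘(ℝ, ℝ) ∞ (fun v => Φ.ψ v (Y v) (Y' v)) u :=
  contMDiffAt_form (Φ.ψ_smooth u) h h'

theorem mdifferentiableAt_sigma {Y Y' : Π u, V1 E M u} {u : Total E M} (h : Diff1 Y u)
    (h' : Diff1 Y' u) : MDifferentiableAt (model E) 𝓘(ℝ, ℝ) (fun v => Φ.σ v (Y v) (Y' v)) u :=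
  mdifferentiableAt_form (Φ.σ_smooth u) h h'

theorem mdifferentiableAt_psi {Y Y' : Π u, V1 E M u} {u : Total E M} (h : Diff1 Y u)
    (h' : Diff1 Y' u) : MDifferentiableAt (model E) 𝓘(ℝ, ℝ) (fun v => Φ.ψ v (Y v) (Y' v)) u :=
  mdifferentiableAt_form (Φ.ψ_smooth u) h h'

theorem smooth2_sigma {Y : Π u, V1 E M u} {u : Total E M} (h : Smooth1 Y u) :
    Smooth2 (fun v => Φ.σ v (Y v)) u :=
  ContMDiffAt.clm_bundle_apply (E₂ := fun v => V1 E M v →L[ℝ] Trivial (Total E M) ℝ v)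
    (Φ.σ_smooth u) h

theorem smooth2_psi {Y : Π u, V1 E M u} {u : Total E M} (h : Smooth1 Y u) :
    Smooth2 (fun v => Φ.ψ v (Y v)) u :=
  ContMDiffAt.clm_bundle_apply (E₂ := fun v => V1 E M v →L[ℝ] Trivial (Total E M) ℝ v)
    (Φ.ψ_smooth u) h

theorem smooth1_sharp {a : Π u : Total E M, V1 E M u →L[ℝ] ℝ} {u : Total E M} (h : Smooth2 a u) :
    Smooth1 (fun v => Φ.sharp v (a v)) u :=
  ContMDiffAt.clm_bundle_apply (E₁ := fun v => V1 E M v →L[ℝ] Trivial (Total E M) ℝ v)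
    (contMDiffAt_hom_inverse (V₂ := fun v => V1 E M v →L[ℝ] Trivial (Total E M) ℝ v)
      Φ.sigma_isInvertible (Φ.σ_smooth u)) h

theorem smoothHom_iotaL (ε : ℝ) :
    SmoothHom (model E) E (E × (E →L[ℝ] ℝ)) (Φ.iotaL ε) :=
  fun _ => contMDiffAt_hom_of_apply fun _ hY =>
    SmoothV.add (smoothHom_inclV1.contMDiffAt hY) (smoothHom_inclV2.contMDiffAt
      (Smooth2.add (Φ.smooth2_psi hY) (Smooth2.const_smul ε (Φ.smooth2_sigma hY))))

theorem smoothHom_coordU (ε : ℝ) :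
    SmoothHom (model E) (E × (E →L[ℝ] ℝ)) E (Φ.coordU ε) :=
  fun _ => contMDiffAt_hom_of_apply fun _ hs =>
    have h1 := smoothHom_prV1.contMDiffAt hs
    Smooth1.const_smul _ (Smooth1.add h1 (Smooth1.const_smul ε (Φ.smooth1_sharp
      (Smooth2.sub (smoothHom_prV2.contMDiffAt hs) (Φ.smooth2_psi h1)))))

theorem contMDiffAt_gVL (u : Total E M) :
    ContMDiffAt (model E) ((model E).prod
      𝓘(ℝ, (E × (E →L[ℝ] ℝ)) →L[ℝ] (E × (E →L[ℝ] ℝ)) →L[ℝ] ℝ)) ∞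
      (fun v => TotalSpace.mk' ((E × (E →L[ℝ] ℝ)) →L[ℝ] (E × (E →L[ℝ] ℝ)) →L[ℝ] ℝ)
        (E := fun v => V E M v →L[ℝ] V E M v →L[ℝ] ℝ) v (Φ.gVL v)) u := by
  refine contMDiffAt_form_of_apply fun s t hs ht => ?_
  have h1 := Φ.contMDiffAt_sigma ((Φ.smoothHom_coordU 1).contMDiffAt hs)
    ((Φ.smoothHom_coordU 1).contMDiffAt ht)
  have h2 := Φ.contMDiffAt_sigma ((Φ.smoothHom_coordU (-1)).contMDiffAt hs)
    ((Φ.smoothHom_coordU (-1)).contMDiffAt ht)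
  exact (contMDiffAt_const (c := (2 : ℝ))).mul (h1.add h2)

/-- `g_σ` as a continuous bilinear form. -/
def gSigmaL (u : Total E M) :
    TangentSpace (model E) u →L[ℝ] TangentSpace (model E) u →L[ℝ] ℝ :=
  pullForm (Φ.σ u) (dproj u) +
  pullForm (Φ.σ u) (prV1 u ∘L Φ.H.vert u) +
  pullForm (Φ.σ u) (Φ.sharp u ∘L prV2 u ∘L Φ.H.vert u)

theorem gSigmaL_apply (u : Total E M) (Z Z' : TangentSpace (model E) u) :
    Φ.gSigmaL u Z Z' = Φ.gSigma u Z Z' := by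
  have h : Φ.σ u (Φ.sharp u (prV2 u (Φ.H.vert u Z))) (Φ.sharp u (prV2 u (Φ.H.vert u Z'))) =
      prV2 u (Φ.H.vert u Z') (Φ.sharp u (prV2 u (Φ.H.vert u Z))) := by
    rw [sigma_sharp, sharp_symm]
  rw [gSigma, ← h]
  rfl

theorem gSigma_symm (u : Total E M) (Z Z' : TangentSpace (model E) u) :
    Φ.gSigma u Z Z' = Φ.gSigma u Z' Z := by
  simp only [gSigma]
  rw [Φ.σ_symm u, Φ.σ_symm u (prV1 u (Φ.H.vert u Z)), Φ.sharp_symm u]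

/-- A lift of Y can be corrected by vertical vectors, which `dproj` does not see, to obtain any
prescribed vertical component. -/
theorem vert_surjective_pair (u : Total E M) (Y : V1 E M u) (w : V E M u) :
    ∃ Z, dproj u Z = Y ∧ Φ.H.vert u Z = w := by
  obtain ⟨Z, hZ⟩ := dproj_surjective u Y
  refine ⟨Z - vlift u (Φ.H.vert u Z) + vlift u w, ?_, ?_⟩
  · rw [map_add, map_sub, dproj_vlift, dproj_vlift, hZ, sub_zero, add_zero]
  · rw [map_add, map_sub, Φ.H.vert_vlift, Φ.H.vert_vlift, sub_self, zero_add]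

/-- The pair of maps is a surjection between spaces both equal to the model E × (E × E^*), hence
injective by dimension. -/
theorem dproj_vert_injective (u : Total E M) (Z : TangentSpace (model E) u)
    (h1 : dproj u Z = 0) (h2 : Φ.H.vert u Z = 0) : Z = 0 := by
  let L : (E × (E × (E →L[ℝ] ℝ))) →ₗ[ℝ] (E × (E × (E →L[ℝ] ℝ))) :=
    LinearMap.prod (dproj u).toLinearMap (Φ.H.vert u).toLinearMap
  have hs : Function.Surjective L := by
    rintro ⟨Y, w⟩
    obtain ⟨Z, h1, h2⟩ := Φ.vert_surjective_pair u Y w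
    exact ⟨Z, Prod.ext h1 h2⟩
  have hi : Function.Injective L := LinearMap.injective_iff_surjective.2 hs
  have h0 : L Z = 0 := Prod.ext h1 h2
  exact (map_eq_zero_iff L hi).1 h0

/-- The components of Z' along H, V₁ and V₂ can be chosen independently, so the three summands are
tested one at a time. -/
theorem gSigma_nondegenerate (u : Total E M) (Z : TangentSpace (model E) u)
    (h : ∀ Z', Φ.gSigmaL u Z Z' = 0) : Z = 0 := by
  have key : ∀ (Y : V1 E M u) (w : V E M u), Φ.σ u (dproj u Z) Y +
      Φ.σ u (prV1 u (Φ.H.vert u Z)) (prV1 u w) +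
      prV2 u w (Φ.sharp u (prV2 u (Φ.H.vert u Z))) = 0 := by
    intro Y w
    obtain ⟨Z', h1, h2⟩ := Φ.vert_surjective_pair u Y w
    have h3 := h Z'
    rw [gSigmaL_apply] at h3
    rw [← h1, ← h2]
    exact h3
  have e1 : dproj u Z = 0 := Φ.σ_nondegenerate u _ fun Y => by simpa using key Y 0
  refine Φ.dproj_vert_injective u Z e1 (V_ext ?_ ?_)
  · rw [map_zero]
    refine Φ.σ_nondegenerate u _ fun Y => ?_
    have h3 := key 0 (inclV1 u Y)
    rw [prV1_inclV1, prV2_inclV1, zero_apply, map_zero, zero_add, add_zero] at h3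
    exact h3
  · have h4 : Φ.sharp u (prV2 u (Φ.H.vert u Z)) = 0 := by
      refine Φ.σ_nondegenerate u _ fun Y => ?_
      have h3 := key 0 (inclV2 u (Φ.σ u Y))
      rw [prV1_inclV2, prV2_inclV2, map_zero, map_zero, zero_add, zero_add] at h3
      rw [Φ.σ_symm]
      exact h3
    rw [map_zero, ← Φ.sigma_sharp u (prV2 u (Φ.H.vert u Z)), h4, map_zero]

theorem gSigmaL_isInvertible (u : Total E M) : (Φ.gSigmaL u).IsInvertible := by
  let b : (E × (E × (E →L[ℝ] ℝ))) →L[ℝ] (E × (E × (E →L[ℝ] ℝ))) →L[ℝ] ℝ := Φ.gSigmaL u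
  exact isInvertible_of_nondegenerate b fun w hw => Φ.gSigma_nondegenerate u w hw

theorem contMDiffAt_gSigmaL (u : Total E M) :
    ContMDiffAt (model E) ((model E).prod
      𝓘(ℝ, (E × (E × (E →L[ℝ] ℝ))) →L[ℝ] (E × (E × (E →L[ℝ] ℝ))) →L[ℝ] ℝ)) ∞
      (fun v => TotalSpace.mk' ((E × (E × (E →L[ℝ] ℝ))) →L[ℝ] (E × (E × (E →L[ℝ] ℝ))) →L[ℝ] ℝ)
        (E := fun v : Total E M => TangentSpace (model E) v →L[ℝ] TangentSpace (model E) v →L[ℝ] ℝ)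
        v (Φ.gSigmaL v)) u := by
  refine contMDiffAt_form_of_apply fun X X' hX hX' => ?_
  have h1 := Φ.contMDiffAt_sigma (smoothHom_dproj.contMDiffAt hX) (smoothHom_dproj.contMDiffAt hX')
  have hv := Φ.smoothHom_vert.contMDiffAt hX
  have hv' := Φ.smoothHom_vert.contMDiffAt hX'
  have h2 := Φ.contMDiffAt_sigma (smoothHom_prV1.contMDiffAt hv) (smoothHom_prV1.contMDiffAt hv')
  have h3 := Φ.contMDiffAt_sigma (Φ.smooth1_sharp (smoothHom_prV2.contMDiffAt hv))
    (Φ.smooth1_sharp (smoothHom_prV2.contMDiffAt hv'))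
  exact (h1.add h2).add h3

end DoubleField
end BigTangent

namespace BundleAux

/-! ### The Levi-Civita connection of a smooth non degenerate form -/

section Koszul

open VectorField

variable {EB : Type*} [NormedAddCommGroup EB] [NormedSpace ℝ EB] [FiniteDimensional ℝ EB]
  {HB : Type*} [TopologicalSpace HB] {I : ModelWithCorners ℝ EB HB}
  {B : Type*} [TopologicalSpace B] [ChartedSpace HB B] [IsManifold I ∞ B] [IsManifold I 1 B]
  [IsManifold I 2 B]

variable (I) in
/-- Differentiability of vector fields at a point. -/
def DiffField (X : Π x : B, TangentSpace I x) (x : B) : Prop :=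
  MDifferentiableAt I (I.prod 𝓘(ℝ, EB)) (fun y => TotalSpace.mk' EB y (X y)) x

theorem bracket_smul_right {f : B → ℝ} {X Y : Π x : B, TangentSpace I x} {x : B}
    (hf : MDifferentiableAt I 𝓘(ℝ, ℝ) f x) (hY : DiffField I Y x) :
    mlieBracket I X (f • Y) x = mvfderiv I f x (X x) • Y x + f x • mlieBracket I X Y x :=
  haveI := FiniteDimensional.complete ℝ EB
  mlieBracket_smul_right hf hY

theorem bracket_smul_left {f : B → ℝ} {X Y : Π x : B, TangentSpace I x} {x : B}
    (hf : MDifferentiableAt I 𝓘(ℝ, ℝ) f x) (hX : DiffField I X x) :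
    mlieBracket I (f • X) Y x = -mvfderiv I f x (Y x) • X x + f x • mlieBracket I X Y x :=
  haveI := FiniteDimensional.complete ℝ EB
  mlieBracket_smul_left hf hX

theorem bracket_add_right {X Y Y' : Π x : B, TangentSpace I x} {x : B}
    (hY : DiffField I Y x) (hY' : DiffField I Y' x) :
    mlieBracket I X (Y + Y') x = mlieBracket I X Y x + mlieBracket I X Y' x :=
  haveI := FiniteDimensional.complete ℝ EB
  mlieBracket_add_right hY hY'

theorem bracket_add_left {X X' Y : Π x : B, TangentSpace I x} {x : B}
    (hX : DiffField I X x) (hX' : DiffField I X' x) :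
    mlieBracket I (X + X') Y x = mlieBracket I X Y x + mlieBracket I X' Y x :=
  haveI := FiniteDimensional.complete ℝ EB
  mlieBracket_add_left hX hX'

theorem contMDiffAt_bracket {X Y : Π x : B, TangentSpace I x} {x : B}
    (hX : ContMDiffAt I (I.prod 𝓘(ℝ, EB)) ∞ (fun y => TotalSpace.mk' EB y (X y)) x)
    (hY : ContMDiffAt I (I.prod 𝓘(ℝ, EB)) ∞ (fun y => TotalSpace.mk' EB y (Y y)) x) :
    ContMDiffAt I (I.prod 𝓘(ℝ, EB)) ∞ (fun y => TotalSpace.mk' EB y (mlieBracket I X Y y)) x :=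
  haveI := FiniteDimensional.complete ℝ EB
  haveI : IsManifold I (((⊤ : ℕ∞) : WithTop ℕ∞) + 1) B := inferInstanceAs (IsManifold I ∞ B)
  haveI : IsManifold I (minSmoothness ℝ 2) B := by simpa using (inferInstance : IsManifold I 2 B)
  ContMDiffAt.mlieBracket_vectorField (m := ⊤) (n := ⊤) hX hY (by simp)

theorem mvfderiv_mul_apply {f h : B → ℝ} {x : B} (hf : MDifferentiableAt I 𝓘(ℝ, ℝ) f x)
    (hh : MDifferentiableAt I 𝓘(ℝ, ℝ) h x) (Z : TangentSpace I x) :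
    mvfderiv I (fun y => f y * h y) x Z = f x * mvfderiv I h x Z + h x * mvfderiv I f x Z := by
  rw [mvfderiv_fun_mul hf hh]
  rfl

theorem mvfderiv_add_apply {f h : B → ℝ} {x : B} (hf : MDifferentiableAt I 𝓘(ℝ, ℝ) f x)
    (hh : MDifferentiableAt I 𝓘(ℝ, ℝ) h x) (Z : TangentSpace I x) :
    mvfderiv I (fun y => f y + h y) x Z = mvfderiv I f x Z + mvfderiv I h x Z := by
  rw [mvfderiv_fun_add hf hh]
  rfl

theorem contMDiffAt_mvfderiv {f : B → ℝ} {X : Π x : B, TangentSpace I x} {x : B}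
    (hf : ContMDiffAt I 𝓘(ℝ, ℝ) ∞ f x)
    (hX : ContMDiffAt I (I.prod 𝓘(ℝ, EB)) ∞ (fun y => TotalSpace.mk' EB y (X y)) x) :
    ContMDiffAt I 𝓘(ℝ, ℝ) ∞ (fun y => mvfderiv I f y (X y)) x := by
  have h := ContMDiffAt.mfderiv (m := ∞) (I := I) (I' := 𝓘(ℝ, ℝ))
    (fun (_ : B) (t : B) => f t) (fun y => y) (x₀ := x)
    (ContMDiffAt.comp (x, x) (g := f) hf contMDiffAt_snd) contMDiffAt_id (by simp)
  have h2 := (contMDiffAt_section x).1 hX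
  have h3 := h.clm_apply h2
  refine h3.congr_of_eventuallyEq ?_
  filter_upwards [(trivializationAt EB (TangentSpace I : B → Type _) x).open_baseSet.mem_nhds
      (FiberBundle.mem_baseSet_trivializationAt' x)] with y hy
  have e : (trivializationAt EB (TangentSpace I : B → Type _) x).symmL ℝ y
      (trivializationAt EB (TangentSpace I : B → Type _) x ⟨y, X y⟩).2 = X y := by
    rw [Trivialization.symmL_apply _ hy]
    exact Trivialization.symm_proj_apply _ (⟨y, X y⟩ : TangentBundle I B) hy
  simp only [inTangentCoordinates, ContinuousLinearMap.inCoordinates,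
    ContinuousLinearMap.comp_apply, e]
  rw [TangentBundle.continuousLinearMapAt_model_space]
  rfl

/-- The right hand side of the Koszul formula. -/
def koszul (b : Π x : B, TangentSpace I x →L[ℝ] TangentSpace I x →L[ℝ] ℝ)
    (X Y W : Π x : B, TangentSpace I x) (x : B) : ℝ :=
  (mvfderiv I (fun y => b y (Y y) (W y)) x (X x) + mvfderiv I (fun y => b y (X y) (W y)) x (Y x) -
    mvfderiv I (fun y => b y (X y) (Y y)) x (W x) + b x (mlieBracket I X Y x) (W x) -
    b x (mlieBracket I X W x) (Y x) - b x (mlieBracket I Y W x) (X x)) / 2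

variable {b : Π x : B, TangentSpace I x →L[ℝ] TangentSpace I x →L[ℝ] ℝ}

theorem contMDiffAt_koszul
    (hb : ∀ x, ContMDiffAt I (I.prod 𝓘(ℝ, EB →L[ℝ] EB →L[ℝ] ℝ)) ∞
      (fun y => TotalSpace.mk' (EB →L[ℝ] EB →L[ℝ] ℝ)
        (E := fun y : B => TangentSpace I y →L[ℝ] TangentSpace I y →L[ℝ] ℝ) y (b y)) x)
    {x : B} {X Y W : Π x : B, TangentSpace I x}
    (hX : ContMDiffAt I (I.prod 𝓘(ℝ, EB)) ∞ (fun y => TotalSpace.mk' EB y (X y)) x)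
    (hY : ContMDiffAt I (I.prod 𝓘(ℝ, EB)) ∞ (fun y => TotalSpace.mk' EB y (Y y)) x)
    (hW : ContMDiffAt I (I.prod 𝓘(ℝ, EB)) ∞ (fun y => TotalSpace.mk' EB y (W y)) x) :
    ContMDiffAt I 𝓘(ℝ, ℝ) ∞ (koszul b X Y W) x := by
  have h1 := contMDiffAt_mvfderiv (contMDiffAt_form (hb x) hY hW) hX
  have h2 := contMDiffAt_mvfderiv (contMDiffAt_form (hb x) hX hW) hY
  have h3 := contMDiffAt_mvfderiv (contMDiffAt_form (hb x) hX hY) hW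
  have h4 := contMDiffAt_form (hb x) (contMDiffAt_bracket hX hY) hW
  have h5 := contMDiffAt_form (hb x) (contMDiffAt_bracket hX hW) hY
  have h6 := contMDiffAt_form (hb x) (contMDiffAt_bracket hY hW) hX
  exact (((((h1.add h2).sub h3).add h4).sub h5).sub h6).div_const 2

/-- Metricity expands the three derivatives, torsion-freeness the three brackets, and all but one
pair of equal terms cancel. The Levi-Civita conditions become a formula that is visibly smooth and
natural. -/
theorem koszul_of_torsionFree_metric {D : CovariantDerivative I EB (TangentSpace I : B → Type _)}
    (hsymm : ∀ x Z Z', b x Z Z' = b x Z' Z)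
    (htor : ∀ (x : B) (X X' : Π x : B, TangentSpace I x), DiffField I X x → DiffField I X' x →
      D X' x (X x) - D X x (X' x) = mlieBracket I X X' x)
    (hmet : ∀ (x : B) (X X' : Π x : B, TangentSpace I x), DiffField I X x → DiffField I X' x →
      ∀ Z : TangentSpace I x, mvfderiv I (fun y => b y (X y) (X' y)) x Z =
        b x (D X x Z) (X' x) + b x (X x) (D X' x Z))
    {x : B} {X Y W : Π x : B, TangentSpace I x} (hX : DiffField I X x) (hY : DiffField I Y x)
    (hW : DiffField I W x) : b x (D Y x (X x)) (W x) = koszul b X Y W x := by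
  rw [koszul, hmet x Y W hY hW, hmet x X W hX hW, hmet x X Y hX hY, ← htor x X Y hX hY,
    ← htor x X W hX hW, ← htor x Y W hY hW]
  simp only [map_sub, sub_apply]
  rw [hsymm x (X x), hsymm x (Y x), hsymm x (X x)]
  ring

/-- The derivatives of f coming from b(fX, ·) cancel those from the brackets when X or W is
rescaled, and add up to one Leibniz term when Y is. The remaining properties are symmetries of the
Koszul expression. -/
theorem exists_leviCivita (hsymm : ∀ x Z Z', b x Z Z' = b x Z' Z)
    (hinv : ∀ x, (b x).IsInvertible)
    (hb : ∀ x, ContMDiffAt I (I.prod 𝓘(ℝ, EB →L[ℝ] EB →L[ℝ] ℝ)) ∞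
      (fun y => TotalSpace.mk' (EB →L[ℝ] EB →L[ℝ] ℝ)
        (E := fun y : B => TangentSpace I y →L[ℝ] TangentSpace I y →L[ℝ] ℝ) y (b y)) x) :
    ∃ D : CovariantDerivative I EB (TangentSpace I : B → Type _),
      (∀ (x : B) (X X' : Π x : B, TangentSpace I x), DiffField I X x → DiffField I X' x →
        D X' x (X x) - D X x (X' x) = mlieBracket I X X' x) ∧
      ∀ (x : B) (X X' : Π x : B, TangentSpace I x), DiffField I X x → DiffField I X' x →
        ∀ Z : TangentSpace I x, mvfderiv I (fun y => b y (X y) (X' y)) x Z =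
          b x (D X x Z) (X' x) + b x (X x) (D X' x Z) := by
  have hd : ∀ {x : B} {X Y : Π x : B, TangentSpace I x}, DiffField I X x → DiffField I Y x →
      MDifferentiableAt I 𝓘(ℝ, ℝ) (fun y => b y (X y) (Y y)) x :=
    fun {x _ _} hX hY => mdifferentiableAt_form (hb x) hX hY
  have el : ∀ (f : B → ℝ) (X Y : Π x : B, TangentSpace I x),
      (fun y => b y ((f • X) y) (Y y)) = fun y => f y * b y (X y) (Y y) := by
    intro f X Y
    funext y
    simp
  have er : ∀ (f : B → ℝ) (X Y : Π x : B, TangentSpace I x),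
      (fun y => b y (X y) ((f • Y) y)) = fun y => f y * b y (X y) (Y y) := by
    intro f X Y
    funext y
    simp
  have al : ∀ (X X' Y : Π x : B, TangentSpace I x),
      (fun y => b y ((X + X') y) (Y y)) = fun y => b y (X y) (Y y) + b y (X' y) (Y y) := by
    intro X X' Y
    funext y
    simp
  have ar : ∀ (X Y Y' : Π x : B, TangentSpace I x),
      (fun y => b y (X y) ((Y + Y') y)) = fun y => b y (X y) (Y y) + b y (X y) (Y' y) := by
    intro X X' Y
    funext y
    simp
  obtain ⟨D, hD⟩ := exists_connection_of_form (I := I) (F := EB) (V := (TangentSpace I : B → Type _))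
    (b := b) (K := koszul b) hinv
    (by
      intro x Y W hY hW
      refine ⟨fun {f X} hf hX => ?_, fun {X X'} hX hX' => ?_⟩
      · simp only [koszul, el, bracket_smul_left hf hX, mvfderiv_mul_apply hf (hd hX hW),
          mvfderiv_mul_apply hf (hd hX hY)]
        simp only [Pi.smul_apply', map_add, map_smul, add_apply, smul_apply, smul_eq_mul]
        rw [hsymm x (X x) (W x), hsymm x (X x) (Y x)]
        ring
      · simp only [koszul, al, bracket_add_left hX hX', mvfderiv_add_apply (hd hX hW) (hd hX' hW),
          mvfderiv_add_apply (hd hX hY) (hd hX' hY)]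
        simp only [Pi.add_apply, map_add, add_apply]
        ring)
    (by
      intro x X Y hX hY
      refine ⟨fun {f W} hf hW => ?_, fun {W W'} hW hW' => ?_⟩
      · simp only [koszul, er, bracket_smul_right hf hW, mvfderiv_mul_apply hf (hd hY hW),
          mvfderiv_mul_apply hf (hd hX hW)]
        simp only [Pi.smul_apply', map_add, map_smul, add_apply, smul_apply, smul_eq_mul]
        rw [hsymm x (X x) (W x), hsymm x (Y x) (W x)]
        ring
      · simp only [koszul, ar, bracket_add_right hW hW', mvfderiv_add_apply (hd hX hW) (hd hX hW'),
          mvfderiv_add_apply (hd hY hW) (hd hY hW')]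
        simp only [Pi.add_apply, map_add, add_apply]
        ring)
    (by
      intro x X Y Y' W hX hY hY' hW
      simp only [koszul, ar, al, bracket_add_right hY hY', bracket_add_left hY hY',
        mvfderiv_add_apply (hd hX hY) (hd hX hY'), mvfderiv_add_apply (hd hY hW) (hd hY' hW)]
      simp only [Pi.add_apply, map_add, add_apply]
      ring)
    (by
      intro x f X Y W hf hX hY hW
      simp only [koszul, er, el, bracket_smul_right hf hY, bracket_smul_left hf hY,
        mvfderiv_mul_apply hf (hd hX hY), mvfderiv_mul_apply hf (hd hY hW)]
      simp only [Pi.smul_apply', map_add, map_smul, add_apply, smul_apply, smul_eq_mul, neg_smul,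
        map_neg, neg_apply]
      rw [hsymm x (X x) (Y x)]
      ring)
  have hext : ∀ (x : B) (Z Z' : TangentSpace I x),
      (∀ W : Π x : B, TangentSpace I x, DiffField I W x → b x Z (W x) = b x Z' (W x)) →
      Z = Z' := by
    intro x Z Z' h
    refine (hinv x).injective ?_
    ext w
    simpa using h (FiberBundle.extend EB w) (FiberBundle.mdifferentiableAt_extend I EB w)
  refine ⟨D, fun x X Y hX hY => ?_, fun x Y W hY hW Z => ?_⟩
  -- The part of the Koszul expression that changes sign under X ↔ Y is half of b([X, Y], W).
  · refine hext x _ _ fun W hW => ?_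
    rw [map_sub, sub_apply, hD x X Y W hX hY hW, hD x Y X W hY hX hW, koszul, koszul,
      mlieBracket_swap_apply (V := Y) (W := X)]
    have e : (fun y => b y (Y y) (X y)) = fun y => b y (X y) (Y y) :=
      funext fun y => hsymm y _ _
    rw [e, map_neg, neg_apply]
    ring
  -- The sum of the Koszul expressions for (X, Y, W) and (X, W, Y) is the derivative of b(Y, W)
  -- along X, an extension of Z.
  · let X : Π x : B, TangentSpace I x := FiberBundle.extend EB Z
    have hX : DiffField I X x := FiberBundle.mdifferentiableAt_extend I EB Z
    have hXx : X x = Z := FiberBundle.extend_apply_self _ _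
    rw [← hXx, hsymm x (Y x), hD x X Y W hX hY hW, hD x X W Y hX hW hY, koszul, koszul,
      mlieBracket_swap_apply (V := W) (W := Y)]
    have e : (fun y => b y (W y) (Y y)) = fun y => b y (Y y) (W y) :=
      funext fun y => hsymm y _ _
    rw [e, map_neg, neg_apply]
    ring

end Koszul

end BundleAux

/-! ### The connection `D'⁰`, metrization and the deformation by `d_{V₁}ψ` -/

namespace BigTangent
open BundleAux VectorField

section Structure

variable {E : Type*} [NormedAddCommGroup E] [NormedSpace ℝ E] [FiniteDimensional ℝ E]
  {M : Type*} [TopologicalSpace M] [ChartedSpace E M] [IsManifold 𝓘(ℝ, E) ∞ M]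
  {u : Total E M}

theorem Diff1.diffV_inclV1 {Y : Π u, V1 E M u} (h : Diff1 Y u) :
    DiffV (fun v => inclV1 v (Y v)) u :=
  smoothHom_inclV1.mdifferentiableAt h

theorem DiffV.diffT_vlift {s : Π u, V E M u} (h : DiffV s u) : DiffT (fun v => vlift v (s v)) u :=
  smoothHom_vlift.mdifferentiableAt h

theorem DiffV.inclV2_prV2 {s : Π u, V E M u} (h : DiffV s u) :
    DiffV (fun v => inclV2 v (prV2 v (s v))) u :=
  smoothHom_inclV2.mdifferentiableAt (smoothHom_prV2.mdifferentiableAt h)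

theorem Diff1.diffT_field1 {Y : Π u, V1 E M u} (h : Diff1 Y u) : DiffT (field1 Y) u :=
  h.diffV_inclV1.diffT_vlift

theorem Smooth1.smoothT_field1 {Y : Π u, V1 E M u} (h : Smooth1 Y u) : SmoothT (field1 Y) u :=
  SmoothV.smoothT_vlift (smoothHom_inclV1.contMDiffAt h)

theorem field1_smul (f : Total E M → ℝ) (Y : Π u, V1 E M u) :
    field1 (f • Y) = f • field1 Y := by
  funext v
  simp [field1]

theorem field1_add (Y Y' : Π u, V1 E M u) : field1 (Y + Y') = field1 Y + field1 Y' := by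
  funext v
  simp [field1]

theorem exists_diff1 (u : Total E M) (Y : V1 E M u) :
    ∃ Y' : Π u, V1 E M u, Smooth1 Y' u ∧ Y' u = Y :=
  ⟨FiberBundle.extend E Y, FiberBundle.contMDiffAt_extend (model E) E Y,
    FiberBundle.extend_apply_self _ _⟩

theorem exists_diffV (u : Total E M) (w : V E M u) :
    ∃ s : Π u, V E M u, SmoothV s u ∧ s u = w :=
  ⟨FiberBundle.extend (E × (E →L[ℝ] ℝ)) w,
    FiberBundle.contMDiffAt_extend (model E) (E × (E →L[ℝ] ℝ)) w,
    FiberBundle.extend_apply_self _ _⟩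

theorem exists_diffT (u : Total E M) (Z : TangentSpace (model E) u) :
    ∃ X : Π u : Total E M, TangentSpace (model E) u, SmoothT X u ∧ X u = Z :=
  ⟨FiberBundle.extend (E × (E × (E →L[ℝ] ℝ))) Z,
    FiberBundle.contMDiffAt_extend (model E) (E × (E × (E →L[ℝ] ℝ))) Z,
    FiberBundle.extend_apply_self _ _⟩

end Structure

namespace DoubleField

variable {E : Type*} [NormedAddCommGroup E] [NormedSpace ℝ E] [FiniteDimensional ℝ E]
  {M : Type*} [TopologicalSpace M] [ChartedSpace E M] [IsManifold 𝓘(ℝ, E) ∞ M]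
  (Φ : DoubleField E M) {u : Total E M}

theorem sigma_ext {Y Y' : V1 E M u}
    (h : ∀ W : Π u, V1 E M u, Diff1 W u → Φ.σ u Y (W u) = Φ.σ u Y' (W u)) : Y = Y' := by
  rw [← sub_eq_zero]
  refine Φ.σ_nondegenerate u _ fun w => ?_
  obtain ⟨W, hW, rfl⟩ := exists_diff1 u w
  rw [map_sub, sub_apply, h W hW.diff1, sub_self]

/-! ### The projection on `V₁` -/

/-- The projection of the tangent bundle of the big tangent manifold on `V₁`. -/
def prLeaf (u : Total E M) : TangentSpace (model E) u →L[ℝ] V1 E M u := prV1 u ∘L Φ.H.vert u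

/-- The projection of the tangent bundle of the big tangent manifold on the sum of the horizontal
bundle and of `V₂`. -/
def prTransverse (u : Total E M) : TangentSpace (model E) u →L[ℝ] TangentSpace (model E) u :=
  ContinuousLinearMap.id ℝ _ - vlift u ∘L inclV1 u ∘L Φ.prLeaf u

theorem prTransverse_apply (u : Total E M) (Z : TangentSpace (model E) u) :
    Φ.prTransverse u Z = Z - vlift u (inclV1 u (Φ.prLeaf u Z)) := rfl

theorem prLeaf_vlift (u : Total E M) (w : V E M u) : Φ.prLeaf u (vlift u w) = prV1 u w :=
  congrArg (prV1 u) (Φ.H.vert_vlift u w)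

theorem prLeaf_field1 (Y : Π u, V1 E M u) (u : Total E M) : Φ.prLeaf u (field1 Y u) = Y u :=
  (Φ.prLeaf_vlift u _).trans (prV1_inclV1 u _)

theorem prLeaf_prTransverse (u : Total E M) (Z : TangentSpace (model E) u) :
    Φ.prLeaf u (Φ.prTransverse u Z) = 0 := by
  rw [prTransverse_apply, map_sub, prLeaf_vlift, prV1_inclV1, sub_self]

theorem smoothT_prTransverse {X : Π u : Total E M, TangentSpace (model E) u} (h : SmoothT X u) :
    SmoothT (fun v => Φ.prTransverse v (X v)) u :=
  SmoothT.sub h (Smooth1.smoothT_field1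
    (smoothHom_prV1.contMDiffAt (Φ.smoothHom_vert.contMDiffAt h)))

theorem smoothHom_prTransverse :
    SmoothHom (model E) (E × (E × (E →L[ℝ] ℝ))) (E × (E × (E →L[ℝ] ℝ))) Φ.prTransverse :=
  fun _ => contMDiffAt_hom_of_apply fun _ hX => Φ.smoothT_prTransverse hX

theorem smoothHom_prLeaf : SmoothHom (model E) (E × (E × (E →L[ℝ] ℝ))) E Φ.prLeaf :=
  fun _ => contMDiffAt_hom_of_apply fun _ hX =>
    smoothHom_prV1.contMDiffAt (Φ.smoothHom_vert.contMDiffAt hX)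

theorem diff1_prLeaf {X : Π u : Total E M, TangentSpace (model E) u} (h : DiffT X u) :
    Diff1 (fun v => Φ.prLeaf v (X v)) u :=
  Φ.smoothHom_prLeaf.mdifferentiableAt h

theorem diffT_prTransverse {X : Π u : Total E M, TangentSpace (model E) u} (h : DiffT X u) :
    DiffT (fun v => Φ.prTransverse v (X v)) u :=
  Φ.smoothHom_prTransverse.mdifferentiableAt h

theorem diffV_vert {X : Π u : Total E M, TangentSpace (model E) u} (h : DiffT X u) :
    DiffV (fun v => Φ.H.vert v (X v)) u :=
  Φ.smoothHom_vert.mdifferentiableAt h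

/-! ### The connection `D'⁰` -/

/-- The value `D'⁰_X Y`, in terms of the Levi-Civita connection `Dσ`. -/
def primeExpr (Dσ : ConnT E M) (X : Π u : Total E M, TangentSpace (model E) u) (Y : Π u, V1 E M u)
    (u : Total E M) : V1 E M u :=
  Φ.prLeaf u (Dσ (field1 Y) u (field1 (fun v => Φ.prLeaf v (X v)) u) +
    mlieBracket (model E) (fun v => Φ.prTransverse v (X v)) (field1 Y) u)

section Prime

variable (Dσ : ConnT E M) {f : Total E M → ℝ} {X X' : Π u : Total E M, TangentSpace (model E) u}
  {Y Y' : Π u, V1 E M u}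

theorem primeExpr_eq (X : Π u : Total E M, TangentSpace (model E) u) (Y : Π u, V1 E M u) :
    Φ.primeExpr Dσ X Y u = Φ.prLeaf u (Dσ (field1 Y) u (vlift u (inclV1 u (Φ.prLeaf u (X u))))) +
      Φ.prLeaf u (mlieBracket (model E) (fun v => Φ.prTransverse v (X v)) (field1 Y) u) :=
  map_add (Φ.prLeaf u) _ _

/-- The derivative of f in the bracket multiplies the transverse part of X, which the projection on
V₁ kills. This is why only the transverse part of X enters the bracket. -/
theorem primeExpr_smul_left (hf : MDifferentiableAt (model E) 𝓘(ℝ, ℝ) f u) (hX : DiffT X u) :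
    Φ.primeExpr Dσ (f • X) Y u = f u • Φ.primeExpr Dσ X Y u := by
  have e1 : (fun v => Φ.prTransverse v ((f • X) v)) = f • fun v => Φ.prTransverse v (X v) :=
    funext fun v => map_smul (Φ.prTransverse v) (f v) (X v)
  have e2 : Φ.prLeaf u ((f • X) u) = f u • Φ.prLeaf u (X u) := map_smul (Φ.prLeaf u) (f u) (X u)
  rw [primeExpr_eq, primeExpr_eq, e1, bracket_smul_left hf (Φ.diffT_prTransverse hX), e2,
    map_smul (inclV1 u), map_smul (vlift u), (Dσ (field1 Y) u).map_smul, map_smul (Φ.prLeaf u),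
    map_add (Φ.prLeaf u), map_smul (Φ.prLeaf u), map_smul (Φ.prLeaf u), prLeaf_prTransverse,
    smul_zero, zero_add, smul_add]

theorem primeExpr_add_left (hX : DiffT X u) (hX' : DiffT X' u) :
    Φ.primeExpr Dσ (X + X') Y u = Φ.primeExpr Dσ X Y u + Φ.primeExpr Dσ X' Y u := by
  have e1 : (fun v => Φ.prTransverse v ((X + X') v)) =
      (fun v => Φ.prTransverse v (X v)) + fun v => Φ.prTransverse v (X' v) :=
    funext fun v => map_add (Φ.prTransverse v) (X v) (X' v)
  have e2 : Φ.prLeaf u ((X + X') u) = Φ.prLeaf u (X u) + Φ.prLeaf u (X' u) :=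
    map_add (Φ.prLeaf u) (X u) (X' u)
  rw [primeExpr_eq, primeExpr_eq, primeExpr_eq, e1,
    bracket_add_left (Φ.diffT_prTransverse hX) (Φ.diffT_prTransverse hX'), e2,
    map_add (inclV1 u), map_add (vlift u), (Dσ (field1 Y) u).map_add, map_add (Φ.prLeaf u),
    map_add (Φ.prLeaf u)]
  abel

theorem primeExpr_add_right (hY : Diff1 Y u) (hY' : Diff1 Y' u) :
    Φ.primeExpr Dσ X (Y + Y') u = Φ.primeExpr Dσ X Y u + Φ.primeExpr Dσ X Y' u := by
  have e1 : Dσ (field1 Y + field1 Y') u = Dσ (field1 Y) u + Dσ (field1 Y') u :=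
    Dσ.isCovariantDerivativeOnUniv.add hY.diffT_field1 hY'.diffT_field1
  rw [primeExpr_eq, primeExpr_eq, primeExpr_eq, field1_add, e1,
    bracket_add_right hY.diffT_field1 hY'.diffT_field1, add_apply, map_add (Φ.prLeaf u),
    map_add (Φ.prLeaf u)]
  abel

theorem primeExpr_smul_right (hf : MDifferentiableAt (model E) 𝓘(ℝ, ℝ) f u) (hY : Diff1 Y u) :
    Φ.primeExpr Dσ X (f • Y) u =
      f u • Φ.primeExpr Dσ X Y u + mvfderiv (model E) f u (X u) • Y u := by
  have e1 : Dσ (f • field1 Y) u = f u • Dσ (field1 Y) u +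
      (mvfderiv (model E) f u).smulRight (field1 Y u) :=
    Dσ.isCovariantDerivativeOnUniv.leibniz hY.diffT_field1 hf
  -- The Levi-Civita term supplies the derivative of f along the V₁-part of X, the bracket the
  -- derivative along the transverse part; together they form the Leibniz term.
  have e5 : mvfderiv (model E) f u (X u) =
      mvfderiv (model E) f u (vlift u (inclV1 u (Φ.prLeaf u (X u)))) +
        mvfderiv (model E) f u (Φ.prTransverse u (X u)) := by
    rw [← map_add, prTransverse_apply]
    congr 1
    abel
  rw [primeExpr_eq, primeExpr_eq, field1_smul, e1, bracket_smul_right hf hY.diffT_field1, e5,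
    add_apply, smul_apply, ContinuousLinearMap.smulRight_apply, map_add (Φ.prLeaf u),
    map_add (Φ.prLeaf u), map_smul (Φ.prLeaf u), map_smul (Φ.prLeaf u), map_smul (Φ.prLeaf u),
    map_smul (Φ.prLeaf u), prLeaf_field1]
  module

end Prime

theorem exists_prime (Dσ : ConnT E M) : ∃ D : Conn1 E M,
    ∀ (u : Total E M) (X : Π u : Total E M, TangentSpace (model E) u) (Y : Π u, V1 E M u),
      DiffT X u → Diff1 Y u → D Y u (X u) = Φ.primeExpr Dσ X Y u := by
  obtain ⟨D, hD⟩ := exists_connection_of_form (I := model E) (F := E) (V := V1 E M) (b := Φ.σ)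
    (K := fun X Y W u => Φ.σ u (Φ.primeExpr Dσ X Y u) (W u)) Φ.sigma_isInvertible
    (by
      intro u Y W hY hW
      refine ⟨fun {f X} hf hX => ?_, fun {X X'} hX hX' => ?_⟩
      · rw [Φ.primeExpr_smul_left Dσ hf hX, map_smul, smul_apply]
      · rw [Φ.primeExpr_add_left Dσ hX hX', map_add, add_apply])
    (by
      intro u X Y hX hY
      exact ⟨fun _ _ => map_smul _ _ _, fun _ _ => map_add _ _ _⟩)
    (by
      intro u X Y Y' W hX hY hY' hW
      rw [Φ.primeExpr_add_right Dσ hY hY', map_add, add_apply])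
    (by
      intro u f X Y W hf hX hY hW
      rw [Φ.primeExpr_smul_right Dσ hf hY, map_add, add_apply, map_smul, map_smul, smul_apply,
        smul_apply, smul_eq_mul, smul_eq_mul])
  exact ⟨D, fun u X Y hX hY => Φ.sigma_ext fun W hW => hD u X Y W hX hY hW⟩

/-- The three conditions on D'⁰ speak of V₁, V₂ and H separately. Splitting X along them and using
additivity of the bracket gives one formula valid for every X. -/
theorem prime_formula (C : Φ.FieldAdapted) {X : Π u : Total E M, TangentSpace (model E) u}
    {Y : Π u, V1 E M u} (hX : DiffT X u) (hY : Diff1 Y u) :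
    C.Dprime0 Y u (X u) = Φ.primeExpr C.Dσ X Y u := by
  let s : Π u, V E M u := fun v => inclV2 v (prV2 v (Φ.H.vert v (X v)))
  let X' : Π u : Total E M, TangentSpace (model E) u := fun v => X v - vlift v (Φ.H.vert v (X v))
  have hs : DiffV s u := (Φ.diffV_vert hX).inclV2_prV2
  have hX' : DiffT X' u := mdifferentiableAt_sub_section hX (Φ.diffV_vert hX).diffT_vlift
  have e1 := C.Dprime0_V1 u Y hY (Φ.prLeaf u (X u))
  have e2 := C.Dprime0_V2 u Y s hY hs fun v => prV1_inclV2 v _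
  have e3 := C.Dprime0_H u Y X' hY hX' fun v => by
    change Φ.H.vert v (X v - vlift v (Φ.H.vert v (X v))) = 0
    rw [map_sub, Φ.H.vert_vlift, sub_self]
  have hv : ∀ v, Φ.H.vert v (X v) = inclV1 v (Φ.prLeaf v (X v)) + s v := by
    intro v
    refine V_ext ?_ ?_
    · rw [map_add, prV1_inclV1, prV1_inclV2, add_zero]
      rfl
    · rw [map_add, prV2_inclV1, prV2_inclV2, zero_add]
  have e4 : (fun v => Φ.prTransverse v (X v)) = (fun v => vlift v (s v)) + X' := by
    funext v
    change X v - vlift v (inclV1 v (Φ.prLeaf v (X v))) = vlift v (s v) +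
      (X v - vlift v (Φ.H.vert v (X v)))
    rw [hv v, map_add]
    abel
  have e5 : X u = vlift u (inclV1 u (Φ.prLeaf u (X u))) + vlift u (s u) + X' u := by
    change X u = _ + (X u - vlift u (Φ.H.vert u (X u)))
    rw [hv u, map_add]
    abel
  rw [primeExpr, e4, bracket_add_left hs.diffT_vlift hX']
  conv_lhs => rw [e5]
  rw [map_add, map_add, e1, e2, e3, map_add, map_add, ← add_assoc]
  rfl

/-! ### Metrization -/

/-- The Leibniz term arises once from the derivative of σ(Y, W) and once from D'Y, and the factor
1/2 makes it one. In W the derivative of σ(Y, W) and the term with D'W cancel, which leaves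
tensoriality. -/
theorem exists_metrization (D' : Conn1 E M) : ∃ D : Conn1 E M, Φ.IsMetrization D' D := by
  have hd : ∀ {u : Total E M} {Y W : Π u, V1 E M u}, Diff1 Y u → Diff1 W u →
      MDifferentiableAt (model E) 𝓘(ℝ, ℝ) (fun v => Φ.σ v (Y v) (W v)) u :=
    fun hY hW => Φ.mdifferentiableAt_sigma hY hW
  obtain ⟨D, hD⟩ := exists_connection_of_form (I := model E) (F := E) (V := V1 E M) (b := Φ.σ)
    (K := fun X Y W u => (dirDeriv (fun v => Φ.σ v (Y v) (W v)) u (X u) +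
      Φ.σ u (D' Y u (X u)) (W u) - Φ.σ u (Y u) (D' W u (X u))) / 2) Φ.sigma_isInvertible
    (by
      intro u Y W hY hW
      refine ⟨fun {f X} hf hX => ?_, fun {X X'} hX hX' => ?_⟩
      · simp only [dirDeriv, Pi.smul_apply', map_smul, smul_apply, smul_eq_mul]
        ring
      · simp only [dirDeriv, Pi.add_apply, map_add, add_apply]
        ring)
    (by
      intro u X Y hX hY
      refine ⟨fun {f W} hf hW => ?_, fun {W W'} hW hW' => ?_⟩
      · have e : (fun v => Φ.σ v (Y v) ((f • W) v)) = fun v => f v * Φ.σ v (Y v) (W v) := by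
          funext v; simp
        simp only [dirDeriv, e, mvfderiv_mul_apply hf (hd hY hW),
          D'.isCovariantDerivativeOnUniv.leibniz hW hf]
        simp only [Pi.smul_apply', map_smul, map_add, add_apply, smul_apply, smul_eq_mul,
          ContinuousLinearMap.smulRight_apply]
        ring
      · have e : (fun v => Φ.σ v (Y v) ((W + W') v)) =
            fun v => Φ.σ v (Y v) (W v) + Φ.σ v (Y v) (W' v) := by
          funext v; simp
        simp only [dirDeriv, e, mvfderiv_add_apply (hd hY hW) (hd hY hW'),
          D'.isCovariantDerivativeOnUniv.add hW hW']
        simp only [Pi.add_apply, map_add, add_apply]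
        ring)
    (by
      intro u X Y Y' W hX hY hY' hW
      have e : (fun v => Φ.σ v ((Y + Y') v) (W v)) =
          fun v => Φ.σ v (Y v) (W v) + Φ.σ v (Y' v) (W v) := by
        funext v; simp
      simp only [dirDeriv, e, mvfderiv_add_apply (hd hY hW) (hd hY' hW),
        D'.isCovariantDerivativeOnUniv.add hY hY']
      simp only [Pi.add_apply, map_add, add_apply]
      ring)
    (by
      intro u f X Y W hf hX hY hW
      have e : (fun v => Φ.σ v ((f • Y) v) (W v)) = fun v => f v * Φ.σ v (Y v) (W v) := by
        funext v; simp
      simp only [dirDeriv, e, mvfderiv_mul_apply hf (hd hY hW),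
        D'.isCovariantDerivativeOnUniv.leibniz hY hf]
      simp only [Pi.smul_apply', map_smul, map_add, add_apply, smul_apply, smul_eq_mul,
        ContinuousLinearMap.smulRight_apply]
      ring)
  refine ⟨D, fun u Y W hY hW Z => ?_⟩
  obtain ⟨X, hX, rfl⟩ := exists_diffT u Z
  rw [map_sub, sub_apply, hD u X Y W hX.diffT hY hW]
  ring

variable {Φ} in
theorem IsMetrization.formula {D' D : Conn1 E M} (h : Φ.IsMetrization D' D)
    {Y W : Π u, V1 E M u} (hY : Diff1 Y u) (hW : Diff1 W u) (Z : TangentSpace (model E) u) :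
    Φ.σ u (D Y u Z) (W u) = (dirDeriv (fun v => Φ.σ v (Y v) (W v)) u Z +
      Φ.σ u (D' Y u Z) (W u) - Φ.σ u (Y u) (D' W u Z)) / 2 := by
  have := h u Y W hY hW Z
  rw [map_sub, sub_apply] at this
  linarith

/-- The connection `D` on `V₁` preserves `σ`. -/
def PreservesSigma (D : Conn1 E M) : Prop :=
  ∀ (u : Total E M) (Y W : Π u, V1 E M u), Diff1 Y u → Diff1 W u →
    ∀ Z : TangentSpace (model E) u,
      dirDeriv (fun v => Φ.σ v (Y v) (W v)) u Z = Φ.σ u (D Y u Z) (W u) + Φ.σ u (Y u) (D W u Z)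

variable {Φ} in
-- The metrization is the average of D' and its σ-adjoint: adding the formulas for (Y, W) and (W, Y)
-- cancels all terms in D'.
theorem IsMetrization.preservesSigma {D' D : Conn1 E M} (h : Φ.IsMetrization D' D) :
    Φ.PreservesSigma D := by
  intro u Y W hY hW Z
  have e : (fun v => Φ.σ v (W v) (Y v)) = fun v => Φ.σ v (Y v) (W v) :=
    funext fun v => Φ.σ_symm v _ _
  rw [Φ.σ_symm u (Y u), h.formula hY hW, h.formula hW hY, e, Φ.σ_symm u (W u),
    Φ.σ_symm u (Y u)]
  ring

/-! ### The deformation by the `2`-form -/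

/-- Cyclic invariance reduces tensoriality in all three arguments to tensoriality in the first. -/
theorem leafDPsi_rotate (Y Y' Y'' : Π u, V1 E M u) (u : Total E M) :
    Φ.leafDPsi Y Y' Y'' u = Φ.leafDPsi Y' Y'' Y u := by
  simp only [leafDPsi]
  ring

/-- The derivatives of f along Y' and Y'' produced by the derivative terms are cancelled by those in
the two brackets containing fY; skewness of ψ accounts for the sign. -/
theorem leafDPsi_tensorial {Y' Y'' : Π u, V1 E M u} (h' : Diff1 Y' u) (h'' : Diff1 Y'' u) :
    TensorialAt (model E) E (fun Y => Φ.leafDPsi Y Y' Y'' u) u := by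
  have hd : ∀ {Y W : Π u, V1 E M u}, Diff1 Y u → Diff1 W u →
      MDifferentiableAt (model E) 𝓘(ℝ, ℝ) (fun v => Φ.ψ v (Y v) (W v)) u :=
    fun hY hW => Φ.mdifferentiableAt_psi hY hW
  refine ⟨fun {f Y} hf hY => ?_, fun {Y Z} hY hZ => ?_⟩
  · have hY' := Diff1.diffT_field1 hY
    have e1 : (fun v => Φ.ψ v (Y'' v) ((f • Y) v)) = fun v => f v * Φ.ψ v (Y'' v) (Y v) := by
      funext v; simp
    have e2 : (fun v => Φ.ψ v ((f • Y) v) (Y' v)) = fun v => f v * Φ.ψ v (Y v) (Y' v) := by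
      funext v; simp
    have e3 : field1 (f • Y) u = f u • field1 Y u := by rw [field1_smul]; rfl
    have e4 : Φ.leafBracket (f • Y) Y' u =
        -mvfderiv (model E) f u (field1 Y' u) • Y u + f u • Φ.leafBracket Y Y' u := by
      simp only [leafBracket, field1_smul]
      rw [bracket_smul_left hf hY', map_add, map_add, map_smul, map_smul, map_smul, map_smul]
      exact congrArg (fun y => -mvfderiv (model E) f u (field1 Y' u) • y + _)
        (Φ.prLeaf_field1 Y u)
    have e5 : Φ.leafBracket Y'' (f • Y) u =
        mvfderiv (model E) f u (field1 Y'' u) • Y u + f u • Φ.leafBracket Y'' Y u := by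
      simp only [leafBracket, field1_smul]
      rw [bracket_smul_right hf hY', map_add, map_add, map_smul, map_smul, map_smul, map_smul]
      exact congrArg (fun y => mvfderiv (model E) f u (field1 Y'' u) • y + _)
        (Φ.prLeaf_field1 Y u)
    simp only [leafDPsi, e1, e2, e3, e4, e5]
    simp only [dirDeriv, mvfderiv_mul_apply hf (hd h'' hY), mvfderiv_mul_apply hf (hd hY h')]
    simp only [map_add, map_smul, Pi.smul_apply', add_apply, smul_apply, smul_eq_mul]
    rw [Φ.psi_neg u (Y'' u) (Y u)]
    ring
  · have hY' := Diff1.diffT_field1 hY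
    have hZ' := Diff1.diffT_field1 hZ
    have e1 : (fun v => Φ.ψ v (Y'' v) ((Y + Z) v)) =
        fun v => Φ.ψ v (Y'' v) (Y v) + Φ.ψ v (Y'' v) (Z v) := by
      funext v; simp
    have e2 : (fun v => Φ.ψ v ((Y + Z) v) (Y' v)) =
        fun v => Φ.ψ v (Y v) (Y' v) + Φ.ψ v (Z v) (Y' v) := by
      funext v; simp
    have e3 : field1 (Y + Z) u = field1 Y u + field1 Z u := by rw [field1_add]; rfl
    have e4 : Φ.leafBracket (Y + Z) Y' u = Φ.leafBracket Y Y' u + Φ.leafBracket Z Y' u := by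
      simp only [leafBracket, field1_add]
      rw [bracket_add_left hY' hZ', map_add, map_add]
    have e5 : Φ.leafBracket Y'' (Y + Z) u = Φ.leafBracket Y'' Y u + Φ.leafBracket Y'' Z u := by
      simp only [leafBracket, field1_add]
      rw [bracket_add_right hY' hZ', map_add, map_add]
    simp only [leafDPsi, e1, e2, e3, e4, e5]
    simp only [dirDeriv, mvfderiv_add_apply (hd h'' hY) (hd h'' hZ),
      mvfderiv_add_apply (hd hY h') (hd hZ h')]
    simp only [map_add, Pi.add_apply, add_apply]
    ring

theorem leafDPsi_tensorial_middle {Y Y'' : Π u, V1 E M u} (h : Diff1 Y u) (h'' : Diff1 Y'' u) :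
    TensorialAt (model E) E (fun Y' => Φ.leafDPsi Y Y' Y'' u) u := by
  have := Φ.leafDPsi_tensorial h'' h
  simpa only [← Φ.leafDPsi_rotate] using this

theorem leafDPsi_tensorial_right {Y Y' : Π u, V1 E M u} (h : Diff1 Y u) (h' : Diff1 Y' u) :
    TensorialAt (model E) E (fun Y'' => Φ.leafDPsi Y Y' Y'' u) u := by
  have := Φ.leafDPsi_tensorial h h'
  simpa only [Φ.leafDPsi_rotate] using this

theorem exists_psiDeformation (ε : ℝ) (D0 : Conn1 E M) :
    ∃ D : Conn1 E M, Φ.IsPsiDeformation ε D0 D := by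
  obtain ⟨D, hD⟩ := exists_connection_of_form (I := model E) (F := E) (V := V1 E M) (b := Φ.σ)
    (K := fun X Y W u => Φ.σ u (D0 Y u (X u)) (W u) +
      ε / 2 * Φ.leafDPsi (fun v => Φ.prLeaf v (X v)) Y W u) Φ.sigma_isInvertible
    (by
      intro u Y W hY hW
      have ht := Φ.leafDPsi_tensorial hY hW
      refine ⟨fun {f X} hf hX => ?_, fun {X X'} hX hX' => ?_⟩
      · have e : (fun v => Φ.prLeaf v ((f • X) v)) = f • fun v => Φ.prLeaf v (X v) := by
          funext v; simp
        simp only [e, ht.smul hf (Φ.diff1_prLeaf hX)]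
        simp only [Pi.smul_apply', map_smul, smul_apply, smul_eq_mul]
        ring
      · have e : (fun v => Φ.prLeaf v ((X + X') v)) =
            (fun v => Φ.prLeaf v (X v)) + fun v => Φ.prLeaf v (X' v) := by
          funext v; simp
        simp only [e, ht.add (Φ.diff1_prLeaf hX) (Φ.diff1_prLeaf hX')]
        simp only [Pi.add_apply, map_add, add_apply]
        ring)
    (by
      intro u X Y hX hY
      have ht := Φ.leafDPsi_tensorial_right (Φ.diff1_prLeaf hX) hY
      refine ⟨fun {f W} hf hW => ?_, fun {W W'} hW hW' => ?_⟩
      · simp only [ht.smul hf hW]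
        simp only [Pi.smul_apply', map_smul, smul_eq_mul]
        ring
      · simp only [ht.add hW hW']
        simp only [Pi.add_apply, map_add]
        ring)
    (by
      intro u X Y Y' W hX hY hY' hW
      have ht := Φ.leafDPsi_tensorial_middle (Φ.diff1_prLeaf hX) hW
      simp only [ht.add hY hY', D0.isCovariantDerivativeOnUniv.add hY hY']
      simp only [map_add, add_apply]
      ring)
    (by
      intro u f X Y W hf hX hY hW
      have ht := Φ.leafDPsi_tensorial_middle (Φ.diff1_prLeaf hX) hW
      simp only [ht.smul hf hY, D0.isCovariantDerivativeOnUniv.leibniz hY hf]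
      simp only [map_smul, map_add, add_apply, smul_apply, smul_eq_mul,
        ContinuousLinearMap.smulRight_apply]
      ring)
  refine ⟨D, fun u Z₁ Y W hZ₁ hY hW Z hZ => ?_⟩
  obtain ⟨X, hX, rfl⟩ := exists_diffT u Z
  -- Tensoriality makes the value independent of how the V₁-component of Z is extended.
  have e : Φ.leafDPsi Z₁ Y W u = Φ.leafDPsi (fun v => Φ.prLeaf v (X v)) Y W u :=
    (Φ.leafDPsi_tensorial hY hW).pointwise hZ₁ (Φ.diff1_prLeaf hX.diffT) hZ.symm
  rw [map_sub, sub_apply, hD u X Y W hX.diffT hY hW, e]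
  ring

end DoubleField
end BigTangent

/-! ### Derivatives of scalar combinations, and alternating `3`-forms -/

namespace BigTangent
open BundleAux VectorField

theorem mdifferentiableAt_const_mul {EB HB B : Type*} [NormedAddCommGroup EB] [NormedSpace ℝ EB]
    [TopologicalSpace HB] {I : ModelWithCorners ℝ EB HB} [TopologicalSpace B] [ChartedSpace HB B]
    {h : B → ℝ} {x : B} (c : ℝ) (hh : MDifferentiableAt I 𝓘(ℝ, ℝ) h x) :
    MDifferentiableAt I 𝓘(ℝ, ℝ) (fun y => c * h y) x :=
  mdifferentiableAt_const.mul hh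

theorem mdifferentiableAt_fun_add {EB HB B : Type*} [NormedAddCommGroup EB] [NormedSpace ℝ EB]
    [TopologicalSpace HB] {I : ModelWithCorners ℝ EB HB} [TopologicalSpace B] [ChartedSpace HB B]
    {f h : B → ℝ} {x : B} (hf : MDifferentiableAt I 𝓘(ℝ, ℝ) f x)
    (hh : MDifferentiableAt I 𝓘(ℝ, ℝ) h x) :
    MDifferentiableAt I 𝓘(ℝ, ℝ) (fun y => f y + h y) x :=
  hf.add hh

theorem mvfderiv_const_mul_apply {EB HB B : Type*} [NormedAddCommGroup EB] [NormedSpace ℝ EB]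
    [TopologicalSpace HB] {I : ModelWithCorners ℝ EB HB} [TopologicalSpace B] [ChartedSpace HB B]
    {h : B → ℝ} {x : B} (c : ℝ) (hh : MDifferentiableAt I 𝓘(ℝ, ℝ) h x) (Z : TangentSpace I x) :
    mvfderiv I (fun y => c * h y) x Z = c * mvfderiv I h x Z := by
  rw [mvfderiv_fun_mul mdifferentiableAt_const hh, mvfderiv_const, smul_zero, add_zero]
  rfl

/-- An alternating `3`-form from a trilinear, cyclic and alternating function. -/
theorem exists_alternatingMap {V : Type*} [AddCommGroup V] [Module ℝ V] (t : V → V → V → ℝ)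
    (hadd : ∀ x x' y z, t (x + x') y z = t x y z + t x' y z)
    (hsmul : ∀ (c : ℝ) x y z, t (c • x) y z = c * t x y z)
    (hcyc : ∀ x y z, t x y z = t y z x) (halt : ∀ x z, t x x z = 0) :
    ∃ T : V [⋀^Fin 3]→ₗ[ℝ] ℝ, ∀ x y z, T ![x, y, z] = t x y z := by
  -- Cyclicity brings each argument to the first place, where linearity is assumed.
  have hadd1 : ∀ x y y' z, t x (y + y') z = t x y z + t x y' z := fun x y y' z => by
    rw [hcyc x (y + y'), hadd, hcyc x y, hcyc x y']
  have hadd2 : ∀ x y z z', t x y (z + z') = t x y z + t x y z' := fun x y z z' => by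
    rw [← hcyc (z + z') x y, hadd, hcyc z, hcyc z']
  have hsmul1 : ∀ (c : ℝ) x y z, t x (c • y) z = c * t x y z := fun c x y z => by
    rw [hcyc x (c • y), hsmul, hcyc x y]
  have hsmul2 : ∀ (c : ℝ) x y z, t x y (c • z) = c * t x y z := fun c x y z => by
    rw [← hcyc (c • z) x y, hsmul, hcyc z]
  have h3 : ∀ i : Fin 3, i = 0 ∨ i = 1 ∨ i = 2 := by decide
  have h01 : (0 : Fin 3) ≠ 1 := by decide
  have h02 : (0 : Fin 3) ≠ 2 := by decide
  have h12 : (1 : Fin 3) ≠ 2 := by decide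
  refine ⟨{ toFun := fun m => t (m 0) (m 1) (m 2)
            map_update_add' := ?_
            map_update_smul' := ?_
            map_eq_zero_of_eq' := ?_ }, fun x y z => rfl⟩
  · intro _ m i x y
    rcases h3 i with rfl | rfl | rfl <;>
      simp only [Function.update_self, Function.update_of_ne h01, Function.update_of_ne h02,
        Function.update_of_ne h12, Function.update_of_ne h01.symm, Function.update_of_ne h02.symm,
        Function.update_of_ne h12.symm, hadd, hadd1, hadd2]
  · intro _ m i c x
    rcases h3 i with rfl | rfl | rfl <;>
      simp only [Function.update_self, Function.update_of_ne h01, Function.update_of_ne h02,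
        Function.update_of_ne h12, Function.update_of_ne h01.symm, Function.update_of_ne h02.symm,
        Function.update_of_ne h12.symm, hsmul, hsmul1, hsmul2, smul_eq_mul]
  · intro m i j hij hne
    have e02 : ∀ x y, t x y x = 0 := fun x y => by rw [← hcyc x x y, halt]
    have e12 : ∀ x y, t x y y = 0 := fun x y => by rw [hcyc, halt]
    change t (m 0) (m 1) (m 2) = 0
    rcases h3 i with rfl | rfl | rfl <;> rcases h3 j with rfl | rfl | rfl <;>
      first
      | exact absurd rfl hne
      | (rw [hij]
         first
         | exact halt _ _
         | exact e02 _ _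
         | exact e12 _ _)

namespace DoubleField

variable {E : Type*} [NormedAddCommGroup E] [NormedSpace ℝ E] [FiniteDimensional ℝ E]
  {M : Type*} [TopologicalSpace M] [ChartedSpace E M] [IsManifold 𝓘(ℝ, E) ∞ M]
  (Φ : DoubleField E M) {u : Total E M}

theorem diff1_coordU (ε : ℝ) {s : Π u, V E M u} (h : DiffV s u) :
    Diff1 (fun v => Φ.coordU ε v (s v)) u :=
  (Φ.smoothHom_coordU ε).mdifferentiableAt h

theorem diffV_iota (ε : ℝ) {Y : Π u, V1 E M u} (h : Diff1 Y u) :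
    DiffV (fun v => Φ.iota ε v (Y v)) u :=
  (Φ.smoothHom_iotaL ε).mdifferentiableAt h

theorem gV_ext {w w' : V E M u} (h : ∀ w'', Φ.gV u w w'' = Φ.gV u w' w'') : w = w' := by
  rw [← sub_eq_zero]
  refine (Φ.gV_nondegenerate u).1 _ fun w'' => ?_
  rw [map_sub, LinearMap.sub_apply, h, sub_self]

/-! ### Connections of pairs -/

/-- The connection is ι₊ D⁺ c₊ + ι₋ D⁻ c₋. Since ι_± and c_± are linear over functions, the Leibniz
terms recombine to df ⊗ s by the splitting of s. -/
theorem exists_pair (Dp Dm : Conn1 E M) : ∃ D : ConnV E M, Φ.IsPair Dp Dm D := by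
  refine ⟨⟨fun s u => Φ.iotaL 1 u ∘L Dp (fun v => Φ.coordU 1 v (s v)) u +
    Φ.iotaL (-1) u ∘L Dm (fun v => Φ.coordU (-1) v (s v)) u, ⟨?_, ?_⟩⟩, ?_⟩
  · intro s s' u hs hs' _
    have e : ∀ ε : ℝ, (fun v => Φ.coordU ε v ((s + s') v)) =
        (fun v => Φ.coordU ε v (s v)) + fun v => Φ.coordU ε v (s' v) :=
      fun ε => funext fun v => map_add (Φ.coordU ε v) (s v) (s' v)
    rw [e, e, Dp.isCovariantDerivativeOnUniv.add (Φ.diff1_coordU 1 hs) (Φ.diff1_coordU 1 hs'),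
      Dm.isCovariantDerivativeOnUniv.add (Φ.diff1_coordU _ hs) (Φ.diff1_coordU _ hs'),
      ContinuousLinearMap.comp_add, ContinuousLinearMap.comp_add]
    abel
  · intro s f u hs hf _
    have e : ∀ ε : ℝ, (fun v => Φ.coordU ε v ((f • s) v)) =
        f • (fun v => Φ.coordU ε v (s v)) :=
      fun ε => funext fun v => map_smul (Φ.coordU ε v) (f v) (s v)
    rw [e, e, Dp.isCovariantDerivativeOnUniv.leibniz (Φ.diff1_coordU 1 hs) hf,
      Dm.isCovariantDerivativeOnUniv.leibniz (Φ.diff1_coordU _ hs) hf]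
    ext1 Z
    conv_rhs => rw [← Φ.iota_coordU_add u (s u)]
    simp only [add_apply, smul_apply, ContinuousLinearMap.comp_apply,
      ContinuousLinearMap.smulRight_apply, map_add, map_smul, iotaL_apply]
    module
  · intro u Y hY Z
    have h0 : ∀ D : Conn1 E M, D (fun v => (0 : V1 E M v)) u = 0 := fun D =>
      D.isCovariantDerivativeOnUniv.zero
    have e1 : (fun v => Φ.coordU 1 v (Φ.iota 1 v (Y v))) = Y :=
      funext fun v => Φ.coordU_iota_self (Or.inl rfl) v (Y v)
    have e2 : (fun v => Φ.coordU (-1) v (Φ.iota 1 v (Y v))) = fun v => (0 : V1 E M v) :=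
      funext fun v => Φ.coordU_neg_iota (Or.inl rfl) v (Y v)
    have e3 : (fun v => Φ.coordU 1 v (Φ.iota (-1) v (Y v))) = fun v => (0 : V1 E M v) :=
      funext fun v => Φ.coordU_iota_neg (Or.inl rfl) v (Y v)
    have e4 : (fun v => Φ.coordU (-1) v (Φ.iota (-1) v (Y v))) = Y :=
      funext fun v => Φ.coordU_iota_self (Or.inr rfl) v (Y v)
    constructor
    · change Φ.iotaL 1 u (Dp (fun v => Φ.coordU 1 v (Φ.iota 1 v (Y v))) u Z) +
        Φ.iotaL (-1) u (Dm (fun v => Φ.coordU (-1) v (Φ.iota 1 v (Y v))) u Z) = _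
      rw [e1, e2, h0, zero_apply, map_zero, add_zero, iotaL_apply]
    · change Φ.iotaL 1 u (Dp (fun v => Φ.coordU 1 v (Φ.iota (-1) v (Y v))) u Z) +
        Φ.iotaL (-1) u (Dm (fun v => Φ.coordU (-1) v (Φ.iota (-1) v (Y v))) u Z) = _
      rw [e3, e4, h0, zero_apply, map_zero, zero_add, iotaL_apply]

section Pair

variable {Φ}
variable {Dp Dm : Conn1 E M} {D : ConnV E M} (h : Φ.IsPair Dp Dm D)
include h

/-- The pair condition concerns only sections ι_± Y, but every section is a sum of two of them, so
it determines D. -/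
theorem IsPair.formula {s : Π u, V E M u} (hs : DiffV s u) (Z : TangentSpace (model E) u) :
    D s u Z = Φ.iota 1 u (Dp (fun v => Φ.coordU 1 v (s v)) u Z) +
      Φ.iota (-1) u (Dm (fun v => Φ.coordU (-1) v (s v)) u Z) := by
  have e : s = (fun v => Φ.iota 1 v (Φ.coordU 1 v (s v))) +
      fun v => Φ.iota (-1) v (Φ.coordU (-1) v (s v)) :=
    funext fun v => (Φ.iota_coordU_add v (s v)).symm
  have h1 := Φ.diff1_coordU 1 hs
  have h2 := Φ.diff1_coordU (-1) hs
  conv_lhs => rw [e]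
  rw [D.isCovariantDerivativeOnUniv.add (Φ.diffV_iota 1 h1) (Φ.diffV_iota (-1) h2), add_apply,
    (h u _ h1 Z).1, (h u _ h2 Z).2]

theorem IsPair.coordU_one {s : Π u, V E M u} (hs : DiffV s u) (Z : TangentSpace (model E) u) :
    Φ.coordU 1 u (D s u Z) = Dp (fun v => Φ.coordU 1 v (s v)) u Z := by
  rw [h.formula hs, map_add, coordU_iota_self _ (Or.inl rfl), coordU_iota_neg _ (Or.inl rfl),
    add_zero]

theorem IsPair.coordU_neg_one {s : Π u, V E M u} (hs : DiffV s u)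
    (Z : TangentSpace (model E) u) :
    Φ.coordU (-1) u (D s u Z) = Dm (fun v => Φ.coordU (-1) v (s v)) u Z := by
  rw [h.formula hs, map_add, coordU_iota_self _ (Or.inr rfl), coordU_neg_iota _ (Or.inl rfl),
    zero_add]

/-- In the coordinates c_± both forms are combinations of σ(c₊, c₊) and σ(c₋, c₋) with constant
coefficients, and each term is differentiated by its own σ-metric connection. -/
theorem IsPair.isDoubleMetric (hp : Φ.PreservesSigma Dp) (hm : Φ.PreservesSigma Dm) :
    Φ.IsDoubleMetric D := by
  constructor
  · intro u s s' hs hs' Z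
    have e : (fun v => g v (s v) (s' v)) = fun v =>
        Φ.σ v (Φ.coordU 1 v (s v)) (Φ.coordU 1 v (s' v)) +
          (-1 : ℝ) * Φ.σ v (Φ.coordU (-1) v (s v)) (Φ.coordU (-1) v (s' v)) := by
      funext v
      rw [Φ.g_eq]
      ring
    have d1 := Φ.mdifferentiableAt_sigma (Φ.diff1_coordU 1 hs) (Φ.diff1_coordU 1 hs')
    have d2 := Φ.mdifferentiableAt_sigma (Φ.diff1_coordU (-1) hs) (Φ.diff1_coordU (-1) hs')
    have h1 := hp u _ _ (Φ.diff1_coordU 1 hs) (Φ.diff1_coordU 1 hs') Z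
    have h2 := hm u _ _ (Φ.diff1_coordU (-1) hs) (Φ.diff1_coordU (-1) hs') Z
    rw [dirDeriv] at h1 h2
    beta_reduce
    rw [e, dirDeriv, mvfderiv_add_apply d1 (mdifferentiableAt_const_mul _ d2),
      mvfderiv_const_mul_apply _ d2, h1, h2, Φ.g_eq, Φ.g_eq,
      h.coordU_one hs, h.coordU_one hs', h.coordU_neg_one hs, h.coordU_neg_one hs']
    ring
  · intro u s s' hs hs' Z
    have e : (fun v => Φ.gV v (s v) (s' v)) = fun v => (2 : ℝ) *
        (Φ.σ v (Φ.coordU 1 v (s v)) (Φ.coordU 1 v (s' v)) +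
          Φ.σ v (Φ.coordU (-1) v (s v)) (Φ.coordU (-1) v (s' v))) := by
      funext v
      rw [Φ.gV_eq]
    have d1 := Φ.mdifferentiableAt_sigma (Φ.diff1_coordU 1 hs) (Φ.diff1_coordU 1 hs')
    have d2 := Φ.mdifferentiableAt_sigma (Φ.diff1_coordU (-1) hs) (Φ.diff1_coordU (-1) hs')
    have h1 := hp u _ _ (Φ.diff1_coordU 1 hs) (Φ.diff1_coordU 1 hs') Z
    have h2 := hm u _ _ (Φ.diff1_coordU (-1) hs) (Φ.diff1_coordU (-1) hs') Z
    rw [dirDeriv] at h1 h2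
    beta_reduce
    rw [e, dirDeriv, mvfderiv_const_mul_apply _ (mdifferentiableAt_fun_add d1 d2),
      mvfderiv_add_apply d1 d2, h1, h2, Φ.gV_eq, Φ.gV_eq,
      h.coordU_one hs, h.coordU_one hs', h.coordU_neg_one hs, h.coordU_neg_one hs']
    ring

theorem IsPair.apply_iota {ε : ℝ} (hε : ε = 1 ∨ ε = -1) (hD : Dp = Dm) {Y : Π u, V1 E M u}
    (hY : Diff1 Y u) (Z : TangentSpace (model E) u) :
    D (fun v => Φ.iota ε v (Y v)) u Z = Φ.iota ε u (Dp Y u Z) := by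
  rcases hε with rfl | rfl
  · exact (h u Y hY Z).1
  · rw [(h u Y hY Z).2, hD]

end Pair

/-! ### The modification by the metric bracket -/

theorem prU_add_prU_neg (ε : ℝ) (u : Total E M) (w : V E M u) :
    Φ.prU ε u w + Φ.prU (-ε) u w = w := by
  rw [prU, prU]
  module

/-- The pair connection preserves U₊ and U₋, which are g_V-orthogonal. Hence the wedge of a section
of U_{-ε} with one of U_ε vanishes, the derivative of the former stays in U_{-ε}, and only the
derivative of ι_ε Y survives the projection on U_ε. -/
theorem metricBracket_iota {D0 : Conn1 E M} {DD0 : ConnV E M} (h : Φ.IsPair D0 D0 DD0)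
    {ε : ℝ} (hε : ε = 1 ∨ ε = -1) {Y : Π u, V1 E M u} {s : Π u, V E M u} (hY : Diff1 Y u)
    (hs : DiffV s u) :
    prV1 u (Φ.prU ε u (Φ.metricBracket DD0 (fun v => Φ.prU (-ε) v (s v))
      (fun v => Φ.iota ε v (Y v)) u)) = D0 Y u (vlift u (Φ.prU (-ε) u (s u))) := by
  have hε' : -ε = 1 ∨ -ε = -1 := by rcases hε with rfl | rfl <;> norm_num
  have e : (fun v => Φ.prU (-ε) v (s v)) = fun v => Φ.iota (-ε) v (Φ.coordU (-ε) v (s v)) :=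
    funext fun v => Φ.prU_eq hε' v (s v)
  have hc := Φ.diff1_coordU (-ε) hs
  have hw : Φ.wedge DD0 (fun v => Φ.iota (-ε) v (Φ.coordU (-ε) v (s v)))
      (fun v => Φ.iota ε v (Y v)) u = 0 := by
    refine Φ.gV_ext fun w => ?_
    rw [gV_symm, gV_wedge, h.apply_iota hε rfl hY, h.apply_iota hε' rfl hc,
      Φ.gV_symm u (Φ.iota (-ε) u _), gV_iota_iota_neg _ hε, gV_iota_iota_neg _ hε, map_zero,
      LinearMap.zero_apply]
    norm_num
  rw [prV1_prU, e, metricBracket, hw, sub_zero, map_sub, h.apply_iota hε rfl hY,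
    h.apply_iota hε' rfl hc, coordU_iota_self _ hε, coordU_iota_neg _ hε, sub_zero,
    Φ.prU_eq hε']

/-- The endomorphism `Z ↦ pr_{U_ε} (pr_V Z)` of the tangent bundle. -/
def prUT (ε : ℝ) (u : Total E M) : TangentSpace (model E) u →L[ℝ] TangentSpace (model E) u :=
  vlift u ∘L Φ.iotaL ε u ∘L Φ.coordU ε u ∘L Φ.H.vert u

theorem prUT_apply {ε : ℝ} (hε : ε = 1 ∨ ε = -1) (u : Total E M)
    (Z : TangentSpace (model E) u) :
    Φ.prUT ε u Z = vlift u (Φ.prU ε u (Φ.H.vert u Z)) :=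
  congrArg (vlift u) (Φ.prU_eq hε u _).symm

/-- By `metricBracket_iota` the modified connection is D + (D⁰ - D) ∘ pr_{U_{-ε}}. The difference D⁰
- D is tensorial, so the Leibniz rule is that of D. -/
theorem exists_bracketModification {D0 : Conn1 E M} {DD0 : ConnV E M} (h : Φ.IsPair D0 D0 DD0)
    {ε : ℝ} (hε : ε = 1 ∨ ε = -1) (D : Conn1 E M) :
    ∃ D' : Conn1 E M, Φ.IsBracketModification ε DD0 D D' := by
  have hε' : -ε = 1 ∨ -ε = -1 := by rcases hε with rfl | rfl <;> norm_num
  refine ⟨⟨fun Y u => D Y u + (D0 Y u - D Y u) ∘L Φ.prUT (-ε) u, ⟨?_, ?_⟩⟩, ?_, ?_⟩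
  · intro Y Y' u hY hY' _
    rw [D.isCovariantDerivativeOnUniv.add hY hY', D0.isCovariantDerivativeOnUniv.add hY hY']
    ext1 Z
    simp only [add_apply, ContinuousLinearMap.comp_apply, sub_apply]
    abel
  · intro Y f u hY hf _
    rw [D.isCovariantDerivativeOnUniv.leibniz hY hf, D0.isCovariantDerivativeOnUniv.leibniz hY hf]
    ext1 Z
    simp only [add_apply, ContinuousLinearMap.comp_apply, sub_apply, smul_apply,
      ContinuousLinearMap.smulRight_apply]
    module
  · intro u Y hY X hX
    have h0 : Φ.prUT (-ε) u X = 0 := by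
      have : Φ.H.vert u X = 0 := hX
      rw [prUT_apply _ hε', this, prU_eq _ hε', map_zero, iota_zero, map_zero]
    change D Y u X + (D0 Y u - D Y u) (Φ.prUT (-ε) u X) = D Y u X
    rw [h0, ContinuousLinearMap.map_zero, add_zero]
  · intro u Y s hY hs
    change D Y u (vlift u (s u)) + (D0 Y u - D Y u) (Φ.prUT (-ε) u (vlift u (s u))) = _
    rw [Φ.metricBracket_iota h hε hY hs, prUT_apply _ hε', Φ.H.vert_vlift, sub_apply]
    conv_lhs => rw [← Φ.prU_add_prU_neg ε u (s u)]
    have e : Φ.prU (-ε) u (Φ.prU ε u (s u) + Φ.prU (-ε) u (s u)) = Φ.prU (-ε) u (s u) := by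
      rw [prU_add_prU_neg]
    rw [e, map_add, ContinuousLinearMap.map_add]
    abel

variable {Φ} in
theorem IsBracketModification.formula {D0 D D' : Conn1 E M} {DD0 : ConnV E M}
    (h : Φ.IsPair D0 D0 DD0) {ε : ℝ} (hε : ε = 1 ∨ ε = -1)
    (hD : Φ.IsBracketModification ε DD0 D D') {Y : Π u, V1 E M u} (hY : Diff1 Y u)
    (Z : TangentSpace (model E) u) :
    D' Y u Z = D Y u Z + (D0 Y u (vlift u (Φ.prU (-ε) u (Φ.H.vert u Z))) -
      D Y u (vlift u (Φ.prU (-ε) u (Φ.H.vert u Z)))) := by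
  obtain ⟨s, hs, hsu⟩ := exists_diffV u (Φ.H.vert u Z)
  have h1 := hD.1 u Y hY (Z - vlift u (Φ.H.vert u Z)) (by
    change Φ.H.vert u (Z - vlift u (Φ.H.vert u Z)) = 0
    rw [map_sub, Φ.H.vert_vlift, sub_self])
  have h2 := hD.2 u Y s hY hs.diffV
  rw [Φ.metricBracket_iota h hε hY hs.diffV, hsu] at h2
  have e1 : D Y u (vlift u (Φ.H.vert u Z)) = D Y u (vlift u (Φ.prU ε u (Φ.H.vert u Z))) +
      D Y u (vlift u (Φ.prU (-ε) u (Φ.H.vert u Z))) := by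
    rw [← ContinuousLinearMap.map_add, ← map_add, prU_add_prU_neg]
  rw [ContinuousLinearMap.map_sub, ContinuousLinearMap.map_sub, h2, e1] at h1
  rw [sub_eq_iff_eq_add] at h1
  rw [h1]
  abel

variable {Φ} in
-- In D_Z + D⁰_{PZ} - D_{PZ}, with P the projection on U_{-ε}, all three terms are σ-metric and the
-- derivatives of σ(Y, W) along PZ cancel.
theorem IsBracketModification.preservesSigma {D0 D D' : Conn1 E M} {DD0 : ConnV E M}
    (h : Φ.IsPair D0 D0 DD0) {ε : ℝ} (hε : ε = 1 ∨ ε = -1)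
    (hD : Φ.IsBracketModification ε DD0 D D') (h0 : Φ.PreservesSigma D0)
    (h1 : Φ.PreservesSigma D) : Φ.PreservesSigma D' := by
  intro u Y W hY hW Z
  have e1 := h1 u Y W hY hW Z
  have e2 := h0 u Y W hY hW (vlift u (Φ.prU (-ε) u (Φ.H.vert u Z)))
  have e3 := h1 u Y W hY hW (vlift u (Φ.prU (-ε) u (Φ.H.vert u Z)))
  rw [hD.formula h hε hY, hD.formula h hε hW, e1]
  simp only [map_add, map_sub, add_apply, sub_apply]
  linarith

/-! ### The Gualtieri torsion -/

/-- The difference of two connections on `V`, as a trilinear form on sections. -/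
def contorsion (D D0 : ConnV E M) (s s' s'' : Π u, V E M u) (u : Total E M) : ℝ :=
  Φ.gV u (D s' u (vlift u (s u)) - D0 s' u (vlift u (s u))) (s'' u)

/-- The metric bracket consists of derivatives and a wedge of 𝒟⁰, which match those of D in the
torsion term by term. Only D - 𝒟⁰ remains; the factor 1/2 is that of the wedge. -/
theorem gualtieriTorsion_eq (D0 D : ConnV E M) (s s' s'' : Π u, V E M u) (u : Total E M) :
    Φ.gualtieriTorsion D0 D s s' s'' u = Φ.contorsion D D0 s s' s'' u -
      Φ.contorsion D D0 s' s s'' u - (Φ.contorsion D D0 s'' s' s u -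
        Φ.contorsion D D0 s'' s s' u) / 2 := by
  have h1 := Φ.gV_wedge D s s' u (s'' u)
  have h2 := Φ.gV_wedge D0 s s' u (s'' u)
  rw [gV_symm] at h1 h2
  simp only [gualtieriTorsion, deformedTorsion, deformedBracket, metricBracket, contorsion,
    map_sub, map_add, LinearMap.sub_apply, LinearMap.add_apply, h1, h2]
  rw [Φ.gV_symm u (s u), Φ.gV_symm u (s u), Φ.gV_symm u (s' u), Φ.gV_symm u (s' u)]
  ring

/-- The difference of two connections on `V`, as a trilinear form. -/
def contorsionForm (D D0 : ConnV E M) (u : Total E M) (a b c : V E M u) : ℝ :=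
  Φ.gV u (D.difference D0 u b (vlift u a)) c

theorem contorsionForm_apply (D D0 : ConnV E M) {s s' s'' : Π u, V E M u} (hs' : DiffV s' u) :
    Φ.contorsionForm D D0 u (s u) (s' u) (s'' u) = Φ.contorsion D D0 s s' s'' u := by
  have h : D.difference D0 u (s' u) = D s' u - D0 s' u :=
    IsCovariantDerivativeOn.difference_apply _ _ (hσ := hs')
  rw [contorsionForm, h]
  rfl

/-- Both connections compute the same derivative of g_V(s', s''); subtracting the two expressions
gives the skewness. -/
theorem contorsionForm_skew {D D0 : ConnV E M}
    (h : PreservesV D fun u w w' => Φ.gV u w w') (h0 : PreservesV D0 fun u w w' => Φ.gV u w w')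
    (a b c : V E M u) : Φ.contorsionForm D D0 u a b c = -Φ.contorsionForm D D0 u a c b := by
  obtain ⟨s, hs, rfl⟩ := exists_diffV u a
  obtain ⟨s', hs', rfl⟩ := exists_diffV u b
  obtain ⟨s'', hs'', rfl⟩ := exists_diffV u c
  rw [Φ.contorsionForm_apply D D0 hs'.diffV, Φ.contorsionForm_apply D D0 hs''.diffV]
  have e := h u s' s'' hs'.diffV hs''.diffV (vlift u (s u))
  have e0 := h0 u s' s'' hs'.diffV hs''.diffV (vlift u (s u))
  simp only [contorsion, map_sub, LinearMap.sub_apply]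
  beta_reduce at e e0
  rw [Φ.gV_symm u (s' u)] at e e0
  linarith

/-- The cyclic sum of the difference of two connections on `V`. -/
def torsionForm (D D0 : ConnV E M) (u : Total E M) (a b c : V E M u) : ℝ :=
  Φ.contorsionForm D D0 u a b c + Φ.contorsionForm D D0 u b c a + Φ.contorsionForm D D0 u c a b

section TorsionForm

variable {D D0 : ConnV E M}

theorem torsionForm_rotate (a b c : V E M u) :
    Φ.torsionForm D D0 u a b c = Φ.torsionForm D D0 u b c a := by
  simp only [torsionForm]
  ring

theorem torsionForm_add (a a' b c : V E M u) :
    Φ.torsionForm D D0 u (a + a') b c =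
      Φ.torsionForm D D0 u a b c + Φ.torsionForm D D0 u a' b c := by
  simp only [torsionForm, contorsionForm, ContinuousLinearMap.map_add, LinearMap.map_add,
    add_apply, LinearMap.add_apply]
  ring

theorem torsionForm_smul (r : ℝ) (a b c : V E M u) :
    Φ.torsionForm D D0 u (r • a) b c = r * Φ.torsionForm D D0 u a b c := by
  simp only [torsionForm, contorsionForm, ContinuousLinearMap.map_smul, LinearMap.map_smul,
    smul_apply, LinearMap.smul_apply, smul_eq_mul]
  ring

/-- Reversing the last two arguments of each summand turns the cyclic sum for (a, b, c) into minus
the one for (a, c, b). Together with cyclic invariance this is total skewness. -/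
theorem torsionForm_skew (h : PreservesV D fun u w w' => Φ.gV u w w')
    (h0 : PreservesV D0 fun u w w' => Φ.gV u w w') (a b c : V E M u) :
    Φ.torsionForm D D0 u a b c = -Φ.torsionForm D D0 u a c b := by
  simp only [torsionForm]
  rw [Φ.contorsionForm_skew h h0 a b, Φ.contorsionForm_skew h h0 b c,
    Φ.contorsionForm_skew h h0 c a]
  ring

theorem torsionForm_self (h : PreservesV D fun u w w' => Φ.gV u w w')
    (h0 : PreservesV D0 fun u w w' => Φ.gV u w w') (a c : V E M u) :
    Φ.torsionForm D D0 u a a c = 0 := by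
  have h1 := Φ.torsionForm_skew h h0 c a a
  rw [← torsionForm_rotate] at h1
  rw [torsionForm_rotate, torsionForm_rotate]
  have h2 := Φ.torsionForm_skew h h0 c a a
  linarith

/-- Write A for the contorsion. Skewness gives -A(b, a, c) = A(b, c, a) and merges the two halves of
the wedge into A(c, a, b). -/
theorem gualtieriTorsion_eq_torsionForm (h : PreservesV D fun u w w' => Φ.gV u w w')
    (h0 : PreservesV D0 fun u w w' => Φ.gV u w w') {s s' s'' : Π u, V E M u}
    (hs : DiffV s u) (hs' : DiffV s' u) :
    Φ.gualtieriTorsion D0 D s s' s'' u = Φ.torsionForm D D0 u (s u) (s' u) (s'' u) := by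
  rw [gualtieriTorsion_eq, torsionForm, ← Φ.contorsionForm_apply D D0 hs,
    ← Φ.contorsionForm_apply D D0 hs', ← Φ.contorsionForm_apply D D0 hs',
    ← Φ.contorsionForm_apply D D0 hs, Φ.contorsionForm_skew h h0 (s' u) (s u),
    Φ.contorsionForm_skew h h0 (s'' u) (s' u)]
  ring

theorem exists_torsion_alternatingMap (h : PreservesV D fun u w w' => Φ.gV u w w')
    (h0 : PreservesV D0 fun u w w' => Φ.gV u w w') (u : Total E M) :
    ∃ T : V E M u [⋀^Fin 3]→ₗ[ℝ] ℝ, ∀ s s' s'' : Π v, V E M v,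
      DiffV s u → DiffV s' u → DiffV s'' u →
        Φ.gualtieriTorsion D0 D s s' s'' u = T ![s u, s' u, s'' u] := by
  obtain ⟨T, hT⟩ := exists_alternatingMap (Φ.torsionForm D D0 u) Φ.torsionForm_add
    Φ.torsionForm_smul Φ.torsionForm_rotate (Φ.torsionForm_self h h0)
  refine ⟨T, fun s s' s'' hs hs' _ => ?_⟩
  rw [hT, Φ.gualtieriTorsion_eq_torsionForm h h0 hs hs']

/-- The connection obtained by subtracting a third of the Gualtieri torsion. -/
theorem exists_field_adapted_connection (h : PreservesV D fun u w w' => Φ.gV u w w')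
    (h0 : PreservesV D0 fun u w w' => Φ.gV u w w') :
    ∃ Dbar : ConnV E M,
      (∀ (u : Total E M) (s : Π u, V E M u), DiffV s u → ∀ X ∈ Φ.H.space u,
        Dbar s u X = D s u X) ∧
      ∀ (u : Total E M) (s s' s'' : Π u, V E M u), DiffV s u → DiffV s' u → DiffV s'' u →
        Φ.gV u (Dbar s' u (vlift u (s u)) - D s' u (vlift u (s u))) (s'' u) =
          -(1 / 3) * Φ.gualtieriTorsion D0 D s s' s'' u := by
  have add3 : ∀ {u : Total E M} (a b c c' : V E M u), Φ.torsionForm D D0 u a b (c + c') =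
      Φ.torsionForm D D0 u a b c + Φ.torsionForm D D0 u a b c' := fun a b c c' => by
    rw [← Φ.torsionForm_rotate (c + c'), torsionForm_add, Φ.torsionForm_rotate c,
      Φ.torsionForm_rotate c']
  have smul3 : ∀ {u : Total E M} (r : ℝ) (a b c : V E M u), Φ.torsionForm D D0 u a b (r • c) =
      r * Φ.torsionForm D D0 u a b c := fun r a b c => by
    rw [← Φ.torsionForm_rotate (r • c), torsionForm_smul, Φ.torsionForm_rotate c]
  have add2 : ∀ {u : Total E M} (a b b' c : V E M u), Φ.torsionForm D D0 u a (b + b') c =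
      Φ.torsionForm D D0 u a b c + Φ.torsionForm D D0 u a b' c := fun a b b' c => by
    rw [Φ.torsionForm_rotate a, torsionForm_add, Φ.torsionForm_rotate a, Φ.torsionForm_rotate a]
  have smul2 : ∀ {u : Total E M} (r : ℝ) (a b c : V E M u), Φ.torsionForm D D0 u a (r • b) c =
      r * Φ.torsionForm D D0 u a b c := fun r a b c => by
    rw [Φ.torsionForm_rotate a, torsionForm_smul, Φ.torsionForm_rotate a]
  -- The correction is evaluated on the vertical part of X, so it vanishes on horizontal vectors and
  -- one formula contains both prescriptions. It is tensorial in all arguments and leaves the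
  -- Leibniz rule of D intact.
  obtain ⟨Dbar, hD⟩ := exists_connection_of_form (I := model E) (F := E × (E →L[ℝ] ℝ))
    (V := V E M) (b := Φ.gVL)
    (K := fun X s' s'' u => Φ.gVL u (D s' u (X u)) (s'' u) -
      1 / 3 * Φ.torsionForm D D0 u (Φ.H.vert u (X u)) (s' u) (s'' u)) Φ.gVL_isInvertible
    (by
      intro u Y W hY hW
      refine ⟨fun {f X} hf hX => ?_, fun {X X'} hX hX' => ?_⟩
      · simp only [Pi.smul_apply', map_smul, smul_apply, smul_eq_mul, torsionForm_smul]
        ring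
      · simp only [Pi.add_apply, map_add, add_apply, torsionForm_add]
        ring)
    (by
      intro u X Y hX hY
      refine ⟨fun {f W} hf hW => ?_, fun {W W'} hW hW' => ?_⟩
      · simp only [Pi.smul_apply', map_smul, smul_eq_mul, smul3]
        ring
      · simp only [Pi.add_apply, map_add, add3]
        ring)
    (by
      intro u X Y Y' W hX hY hY' hW
      simp only [D.isCovariantDerivativeOnUniv.add hY hY', Pi.add_apply, map_add, add_apply, add2]
      ring)
    (by
      intro u f X Y W hf hX hY hW
      simp only [D.isCovariantDerivativeOnUniv.leibniz hY hf, Pi.smul_apply', map_smul, map_add,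
        add_apply, smul_apply, smul_eq_mul, ContinuousLinearMap.smulRight_apply, smul2]
      ring)
  have hD' : ∀ (u : Total E M) (s' s'' : Π u, V E M u) (Z : TangentSpace (model E) u),
      DiffV s' u → DiffV s'' u → Φ.gV u (Dbar s' u Z) (s'' u) = Φ.gV u (D s' u Z) (s'' u) -
        1 / 3 * Φ.torsionForm D D0 u (Φ.H.vert u Z) (s' u) (s'' u) := by
    intro u s' s'' Z hs' hs''
    obtain ⟨X, hX, rfl⟩ := exists_diffT u Z
    have := hD u X s' s'' hX.diffT hs' hs''
    rwa [gVL_apply, gVL_apply] at this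
  refine ⟨Dbar, fun u s hs X hX => ?_, fun u s s' s'' hs hs' hs'' => ?_⟩
  · refine Φ.gV_ext fun w => ?_
    obtain ⟨t, ht, rfl⟩ := exists_diffV u w
    have h0 : Φ.H.vert u X = 0 := hX
    have h1 : Φ.torsionForm D D0 u 0 (s u) (t u) = 0 := by
      simpa using Φ.torsionForm_smul (D := D) (D0 := D0) 0 0 (s u) (t u)
    rw [hD' u s t X hs ht.diffV, h0, h1, mul_zero, sub_zero]
  · rw [map_sub, LinearMap.sub_apply, hD' u s' s'' _ hs' hs'', Φ.H.vert_vlift,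
      Φ.gualtieriTorsion_eq_torsionForm h h0 hs hs']
    ring

end TorsionForm

/-! ### Existence -/

theorem nonempty_fieldAdapted : Nonempty Φ.FieldAdapted := by
  obtain ⟨Dσ, htor, hmet⟩ := exists_leviCivita (I := model E) (b := Φ.gSigmaL)
    (fun u Z Z' => by rw [gSigmaL_apply, gSigmaL_apply, gSigma_symm]) Φ.gSigmaL_isInvertible
    Φ.contMDiffAt_gSigmaL
  obtain ⟨D'0, hD'0⟩ := Φ.exists_prime Dσ
  obtain ⟨D0, hD0⟩ := Φ.exists_metrization D'0
  obtain ⟨DD0, hDD0⟩ := Φ.exists_pair D0 D0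
  obtain ⟨D'p, hD'p⟩ := Φ.exists_psiDeformation 1 D0
  obtain ⟨D'm, hD'm⟩ := Φ.exists_psiDeformation (-1) D0
  obtain ⟨Dp, hDp⟩ := Φ.exists_metrization D'p
  obtain ⟨Dm, hDm⟩ := Φ.exists_metrization D'm
  obtain ⟨Dtp, hDtp⟩ := Φ.exists_bracketModification hDD0 (Or.inl rfl) Dp
  obtain ⟨Dtm, hDtm⟩ := Φ.exists_bracketModification hDD0 (Or.inr rfl) Dm
  obtain ⟨Dt, hDt⟩ := Φ.exists_pair Dtp Dtm
  -- Metricity enters the existence of the last connection: it makes the Gualtieri torsion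
  -- tensorial.
  have m0 := hDD0.isDoubleMetric hD0.preservesSigma hD0.preservesSigma
  have mt := hDt.isDoubleMetric
    (hDtp.preservesSigma hDD0 (Or.inl rfl) hD0.preservesSigma hDp.preservesSigma)
    (hDtm.preservesSigma hDD0 (Or.inr rfl) hD0.preservesSigma hDm.preservesSigma)
  obtain ⟨Db, hDb1, hDb2⟩ := Φ.exists_field_adapted_connection mt.2 m0.2
  refine ⟨{ Dσ := Dσ, Dσ_torsion := htor, Dσ_metric := ?_, Dprime0 := D'0, Dprime0_V1 := ?_,
            Dprime0_V2 := ?_, Dprime0_H := ?_, D0 := D0, D0_metrization := hD0, DD0 := DD0,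
            DD0_pair := hDD0, DprimePlus := D'p, DprimeMinus := D'm, DprimePlus_psi := hD'p,
            DprimeMinus_psi := hD'm, DPlus := Dp, DMinus := Dm, DPlus_metrization := hDp,
            DMinus_metrization := hDm, DtildePlus := Dtp, DtildeMinus := Dtm,
            DtildePlus_modification := hDtp, DtildeMinus_modification := hDtm, Dtilde := Dt,
            Dtilde_pair := hDt, Dbar := Db, Dbar_horizontal := hDb1, Dbar_vertical := hDb2 }⟩
  · intro u X X' hX hX' Z
    have h := hmet u X X' hX hX' Z
    simp only [gSigmaL_apply] at h
    exact h
  -- The formula `primeExpr` restricts to the three prescribed rules: fields in V₁ have no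
  -- transverse part, and fields in V₂ or H are their own transverse part.
  · intro u Y hY Z₁
    obtain ⟨Y', hY', rfl⟩ := exists_diff1 u Z₁
    have h := hD'0 u (field1 Y') Y hY'.diff1.diffT_field1 hY
    have e1 : (fun v => Φ.prTransverse v (field1 Y' v)) = 0 := by
      funext v
      rw [prTransverse_apply, prLeaf_field1]
      exact sub_self _
    rw [primeExpr_eq, e1, mlieBracket_zero_left, prLeaf_field1] at h
    exact h.trans ((congrArg _ (map_zero (Φ.prLeaf u))).trans (add_zero _))
  · intro u Y s hY hs hs1
    have h := hD'0 u (fun v => vlift v (s v)) Y hs.diffT_vlift hY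
    have e1 : (fun v => Φ.prTransverse v (vlift v (s v))) = fun v => vlift v (s v) := by
      funext v
      rw [prTransverse_apply, prLeaf_vlift, hs1, map_zero, map_zero, sub_zero]
    rw [primeExpr_eq, e1, prLeaf_vlift, hs1, map_zero, map_zero, ContinuousLinearMap.map_zero,
      map_zero, zero_add] at h
    exact h
  · intro u Y X hY hX hXH
    have h := hD'0 u X Y hX hY
    have e0 : ∀ v, Φ.prLeaf v (X v) = 0 := fun v =>
      (congrArg (prV1 v) (hXH v)).trans (map_zero (prV1 v))
    have e1 : (fun v => Φ.prTransverse v (X v)) = X := by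
      funext v
      rw [prTransverse_apply, e0, map_zero, map_zero, sub_zero]
    rw [primeExpr_eq, e1, e0, map_zero, map_zero, ContinuousLinearMap.map_zero,
      map_zero, zero_add] at h
    exact h

end DoubleField
end BigTangent

namespace BigTangent
open BundleAux VectorField

namespace DoubleField

variable {E : Type*} [NormedAddCommGroup E] [NormedSpace ℝ E] [FiniteDimensional ℝ E]
  {M : Type*} [TopologicalSpace M] [ChartedSpace E M] [IsManifold 𝓘(ℝ, E) ∞ M]
  {Φ : DoubleField E M} {u : Total E M}

/-! ### Smoothness -/

theorem contMDiffAt_dirDeriv {f : Total E M → ℝ} {X : Π u : Total E M, TangentSpace (model E) u}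
    (hf : ContMDiffAt (model E) 𝓘(ℝ, ℝ) ∞ f u) (hX : SmoothT X u) :
    ContMDiffAt (model E) 𝓘(ℝ, ℝ) ∞ (fun v => dirDeriv f v (X v)) u :=
  contMDiffAt_mvfderiv hf hX

theorem contMDiffAt_gV {s s' : Π u, V E M u} (h : SmoothV s u) (h' : SmoothV s' u) :
    ContMDiffAt (model E) 𝓘(ℝ, ℝ) ∞ (fun v => Φ.gV v (s v) (s' v)) u := by
  have := contMDiffAt_form (Φ.contMDiffAt_gVL u) h h'
  simpa only [gVL_apply] using this

theorem smooth1_prLeaf (Φ : DoubleField E M) {X : Π u : Total E M, TangentSpace (model E) u}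
    (h : SmoothT X u) : Smooth1 (fun v => Φ.prLeaf v (X v)) u :=
  Φ.smoothHom_prLeaf.contMDiffAt h

theorem smoothV_vert (Φ : DoubleField E M) {X : Π u : Total E M, TangentSpace (model E) u}
    (h : SmoothT X u) : SmoothV (fun v => Φ.H.vert v (X v)) u :=
  Φ.smoothHom_vert.contMDiffAt h

theorem smooth1_coordU (Φ : DoubleField E M) (ε : ℝ) {s : Π u, V E M u} (h : SmoothV s u) :
    Smooth1 (fun v => Φ.coordU ε v (s v)) u :=
  (Φ.smoothHom_coordU ε).contMDiffAt h

theorem smoothV_iota (Φ : DoubleField E M) (ε : ℝ) {Y : Π u, V1 E M u} (h : Smooth1 Y u) :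
    SmoothV (fun v => Φ.iota ε v (Y v)) u :=
  (Φ.smoothHom_iotaL ε).contMDiffAt h

theorem smooth1_leafBracket {Y Y' : Π u, V1 E M u} (h : Smooth1 Y u) (h' : Smooth1 Y' u) :
    Smooth1 (Φ.leafBracket Y Y') u :=
  Φ.smooth1_prLeaf (contMDiffAt_bracket h.smoothT_field1 h'.smoothT_field1)

theorem contMDiffAt_leafDPsi {Y Y' Y'' : Π u, V1 E M u} (h : Smooth1 Y u) (h' : Smooth1 Y' u)
    (h'' : Smooth1 Y'' u) : ContMDiffAt (model E) 𝓘(ℝ, ℝ) ∞ (Φ.leafDPsi Y Y' Y'') u := by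
  have h1 := contMDiffAt_dirDeriv (Φ.contMDiffAt_psi h' h'') h.smoothT_field1
  have h2 := contMDiffAt_dirDeriv (Φ.contMDiffAt_psi h'' h) h'.smoothT_field1
  have h3 := contMDiffAt_dirDeriv (Φ.contMDiffAt_psi h h') h''.smoothT_field1
  have h4 := Φ.contMDiffAt_psi (smooth1_leafBracket (Φ := Φ) h h') h''
  have h5 := Φ.contMDiffAt_psi (smooth1_leafBracket (Φ := Φ) h' h'') h
  have h6 := Φ.contMDiffAt_psi (smooth1_leafBracket (Φ := Φ) h'' h) h'
  exact ((((h1.add h2).add h3).sub h4).sub h5).sub h6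

theorem FieldAdapted.koszul_formula (C : Φ.FieldAdapted)
    {X Y W : Π u : Total E M, TangentSpace (model E) u} (hX : DiffT X u) (hY : DiffT Y u)
    (hW : DiffT W u) : Φ.gSigmaL u (C.Dσ Y u (X u)) (W u) = koszul Φ.gSigmaL X Y W u := by
  refine koszul_of_torsionFree_metric
    (fun u Z Z' => by rw [gSigmaL_apply, gSigmaL_apply, gSigma_symm]) C.Dσ_torsion
    (fun v X X' hX hX' Z => ?_) hX hY hW
  simp only [gSigmaL_apply]
  exact C.Dσ_metric v X X' hX hX' Z

/-- Smoothness is not part of the data: a torsion-free metric connection obeys the Koszul formula,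
whose right hand side is smooth. -/
theorem FieldAdapted.smoothConnection_Dσ (C : Φ.FieldAdapted) : SmoothConnection C.Dσ :=
  smoothConnection_of_form (K := koszul Φ.gSigmaL) Φ.gSigmaL_isInvertible Φ.contMDiffAt_gSigmaL
    (fun _ _ _ _ hX hY hW => C.koszul_formula hX hY hW)
    (fun _ _ _ _ hX hY hW => contMDiffAt_koszul Φ.contMDiffAt_gSigmaL hX hY hW)

theorem FieldAdapted.smoothConnection_Dprime0 (C : Φ.FieldAdapted) :
    SmoothConnection C.Dprime0 := by
  refine smoothConnection_of_form (b := Φ.σ)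
    (K := fun X Y W u => Φ.σ u (Φ.primeExpr C.Dσ X Y u) (W u)) Φ.sigma_isInvertible
    (fun u => Φ.σ_smooth u) (fun u X Y W hX hY hW => ?_) (fun u X Y W hX hY hW => ?_)
  · rw [Φ.prime_formula C hX hY]
  · have h1 : SmoothT (field1 (fun v => Φ.prLeaf v (X v))) u :=
      (Φ.smooth1_prLeaf hX).smoothT_field1
    have h2 : SmoothT (fun v => C.Dσ (field1 Y) v (field1 (fun v => Φ.prLeaf v (X v)) v)) u :=
      C.smoothConnection_Dσ.apply h1 (Smooth1.smoothT_field1 hY)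
    have h3 : SmoothT (mlieBracket (model E) (fun v => Φ.prTransverse v (X v)) (field1 Y)) u :=
      contMDiffAt_bracket (Φ.smoothT_prTransverse hX) (Smooth1.smoothT_field1 hY)
    exact Φ.contMDiffAt_sigma (Φ.smooth1_prLeaf (h2.add h3)) hW

theorem IsMetrization.smoothConnection {D' D : Conn1 E M} (h : Φ.IsMetrization D' D)
    (hD : SmoothConnection D') : SmoothConnection D := by
  refine smoothConnection_of_form (b := Φ.σ)
    (K := fun X Y W u => (dirDeriv (fun v => Φ.σ v (Y v) (W v)) u (X u) +
      Φ.σ u (D' Y u (X u)) (W u) - Φ.σ u (Y u) (D' W u (X u))) / 2) Φ.sigma_isInvertible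
    (fun u => Φ.σ_smooth u) (fun u X Y W hX hY hW => h.formula hY hW _)
    (fun u X Y W hX hY hW => ?_)
  have h1 := contMDiffAt_dirDeriv (Φ.contMDiffAt_sigma hY hW) hX
  have h2 := Φ.contMDiffAt_sigma (hD.apply hX hY) hW
  have h3 := Φ.contMDiffAt_sigma hY (hD.apply hX hW)
  exact ((h1.add h2).sub h3).div_const 2

theorem IsPsiDeformation.formula {ε : ℝ} {D0 D : Conn1 E M} (h : Φ.IsPsiDeformation ε D0 D)
    {X : Π u : Total E M, TangentSpace (model E) u} {Y W : Π u, V1 E M u} (hX : DiffT X u)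
    (hY : Diff1 Y u) (hW : Diff1 W u) :
    Φ.σ u (D Y u (X u)) (W u) = Φ.σ u (D0 Y u (X u)) (W u) +
      ε / 2 * Φ.leafDPsi (fun v => Φ.prLeaf v (X v)) Y W u := by
  have := h u (fun v => Φ.prLeaf v (X v)) Y W (Φ.diff1_prLeaf hX) hY hW (X u) rfl
  rw [map_sub, sub_apply] at this
  linarith

theorem IsPsiDeformation.smoothConnection {ε : ℝ} {D0 D : Conn1 E M}
    (h : Φ.IsPsiDeformation ε D0 D) (hD : SmoothConnection D0) : SmoothConnection D := by
  refine smoothConnection_of_form (b := Φ.σ)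
    (K := fun X Y W u => Φ.σ u (D0 Y u (X u)) (W u) +
      ε / 2 * Φ.leafDPsi (fun v => Φ.prLeaf v (X v)) Y W u) Φ.sigma_isInvertible
    (fun u => Φ.σ_smooth u) (fun u X Y W hX hY hW => h.formula hX hY hW)
    (fun u X Y W hX hY hW => ?_)
  have h2 := Φ.contMDiffAt_sigma (hD.apply hX hY) hW
  exact h2.add (contMDiffAt_const.mul (contMDiffAt_leafDPsi (Φ.smooth1_prLeaf hX) hY hW))

theorem IsPair.smoothConnection {Dp Dm : Conn1 E M} {D : ConnV E M} (h : Φ.IsPair Dp Dm D)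
    (hp : SmoothConnection Dp) (hm : SmoothConnection Dm) : SmoothConnection D := by
  refine smoothConnection_of_form (b := Φ.gVL)
    (K := fun X s s' u => Φ.gV u (Φ.iota 1 u (Dp (fun v => Φ.coordU 1 v (s v)) u (X u)) +
      Φ.iota (-1) u (Dm (fun v => Φ.coordU (-1) v (s v)) u (X u))) (s' u)) Φ.gVL_isInvertible
    Φ.contMDiffAt_gVL (fun u X s s' hX hs hs' => ?_) (fun u X s s' hX hs hs' => ?_)
  · rw [h.formula hs, gVL_apply]
  · have h1 := Φ.smoothV_iota 1 (hp.apply hX (Φ.smooth1_coordU 1 hs))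
    have h2 := Φ.smoothV_iota (-1) (hm.apply hX (Φ.smooth1_coordU (-1) hs))
    exact contMDiffAt_gV (h1.add h2) hs'

theorem IsBracketModification.smoothConnection {D0 D D' : Conn1 E M} {DD0 : ConnV E M}
    (h : Φ.IsPair D0 D0 DD0) {ε : ℝ} (hε : ε = 1 ∨ ε = -1)
    (hD : Φ.IsBracketModification ε DD0 D D') (h0 : SmoothConnection D0)
    (h1 : SmoothConnection D) : SmoothConnection D' := by
  have hε' : -ε = 1 ∨ -ε = -1 := by rcases hε with rfl | rfl <;> norm_num
  refine smoothConnection_of_form (b := Φ.σ)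
    (K := fun X Y W u => Φ.σ u (D Y u (X u)) (W u) + (Φ.σ u (D0 Y u (Φ.prUT (-ε) u (X u))) (W u) -
      Φ.σ u (D Y u (Φ.prUT (-ε) u (X u))) (W u))) Φ.sigma_isInvertible
    (fun u => Φ.σ_smooth u) (fun u X Y W hX hY hW => ?_) (fun u X Y W hX hY hW => ?_)
  · rw [hD.formula h hε hY, Φ.prUT_apply hε', map_add, map_sub, add_apply, sub_apply]
  · have hX' : SmoothT (fun v => Φ.prUT (-ε) v (X v)) u :=
      SmoothV.smoothT_vlift (Φ.smoothV_iota (-ε) (Φ.smooth1_coordU (-ε) (Φ.smoothV_vert hX)))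
    have e1 := Φ.contMDiffAt_sigma (h1.apply hX hY) hW
    have e2 := Φ.contMDiffAt_sigma (h0.apply hX' hY) hW
    have e3 := Φ.contMDiffAt_sigma (h1.apply hX' hY) hW
    exact e1.add (e2.sub e3)

theorem contMDiffAt_contorsion {D D0 : ConnV E M} (hD : SmoothConnection D)
    (hD0 : SmoothConnection D0) {s s' s'' : Π u, V E M u} (hs : SmoothV s u) (hs' : SmoothV s' u)
    (hs'' : SmoothV s'' u) :
    ContMDiffAt (model E) 𝓘(ℝ, ℝ) ∞ (Φ.contorsion D D0 s s' s'') u := by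
  have h1 := contMDiffAt_gV (Φ := Φ) (hD.apply hs.smoothT_vlift hs') hs''
  have h2 := contMDiffAt_gV (Φ := Φ) (hD0.apply hs.smoothT_vlift hs') hs''
  have e : Φ.contorsion D D0 s s' s'' = fun v => Φ.gV v (D s' v (vlift v (s v))) (s'' v) -
      Φ.gV v (D0 s' v (vlift v (s v))) (s'' v) := by
    funext v
    rw [contorsion, map_sub, LinearMap.sub_apply]
  rw [e]
  exact h1.sub h2

theorem contMDiffAt_gualtieriTorsion {D D0 : ConnV E M} (hD : SmoothConnection D)
    (hD0 : SmoothConnection D0) {s s' s'' : Π u, V E M u} (hs : SmoothV s u) (hs' : SmoothV s' u)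
    (hs'' : SmoothV s'' u) :
    ContMDiffAt (model E) 𝓘(ℝ, ℝ) ∞ (Φ.gualtieriTorsion D0 D s s' s'') u := by
  have e : Φ.gualtieriTorsion D0 D s s' s'' = fun u => Φ.contorsion D D0 s s' s'' u -
      Φ.contorsion D D0 s' s s'' u - (Φ.contorsion D D0 s'' s' s u -
        Φ.contorsion D D0 s'' s s' u) / 2 :=
    funext fun u => Φ.gualtieriTorsion_eq D0 D s s' s'' u
  rw [e]
  exact ((contMDiffAt_contorsion hD hD0 hs hs' hs'').sub
    (contMDiffAt_contorsion hD hD0 hs' hs hs'')).sub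
    (((contMDiffAt_contorsion hD hD0 hs'' hs' hs).sub
      (contMDiffAt_contorsion hD hD0 hs'' hs hs')).div_const 2)

theorem isSmooth_of_smoothConnection {D : ConnV E M} (hD : SmoothConnection D) : IsSmooth D := by
  refine fun U hU => ⟨fun {s} hs u hu => ?_⟩
  have h : ContMDiffAt (model E) ((model E).prod 𝓘(ℝ, E × (E →L[ℝ] ℝ))) ∞
      (fun v => TotalSpace.mk' (E × (E →L[ℝ] ℝ)) v (s v)) u :=
    (hs.contMDiffAt (hU.mem_nhds hu)).of_le (by simp)
  exact (hD u s h).contMDiffWithinAt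

/-! ### Smoothness and metric properties along the construction -/

namespace FieldAdapted

variable (C : Φ.FieldAdapted)

theorem smoothConnection_D0 : SmoothConnection C.D0 :=
  C.D0_metrization.smoothConnection C.smoothConnection_Dprime0

theorem smoothConnection_DD0 : SmoothConnection C.DD0 :=
  C.DD0_pair.smoothConnection C.smoothConnection_D0 C.smoothConnection_D0

theorem smoothConnection_Dtilde : SmoothConnection C.Dtilde :=
  C.Dtilde_pair.smoothConnection
    (C.DtildePlus_modification.smoothConnection C.DD0_pair (Or.inl rfl) C.smoothConnection_D0
      (C.DPlus_metrization.smoothConnection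
        (C.DprimePlus_psi.smoothConnection C.smoothConnection_D0)))
    (C.DtildeMinus_modification.smoothConnection C.DD0_pair (Or.inr rfl) C.smoothConnection_D0
      (C.DMinus_metrization.smoothConnection
        (C.DprimeMinus_psi.smoothConnection C.smoothConnection_D0)))

theorem isDoubleMetric_DD0 : Φ.IsDoubleMetric C.DD0 :=
  C.DD0_pair.isDoubleMetric C.D0_metrization.preservesSigma C.D0_metrization.preservesSigma

theorem isDoubleMetric_Dtilde : Φ.IsDoubleMetric C.Dtilde :=
  C.Dtilde_pair.isDoubleMetric
    (C.DtildePlus_modification.preservesSigma C.DD0_pair (Or.inl rfl)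
      C.D0_metrization.preservesSigma C.DPlus_metrization.preservesSigma)
    (C.DtildeMinus_modification.preservesSigma C.DD0_pair (Or.inr rfl)
      C.D0_metrization.preservesSigma C.DMinus_metrization.preservesSigma)

/-! ### The field-adapted connection -/

/-- Z differs from the lift of its vertical part by a horizontal vector, so the two conditions on
the field-adapted connection combine into one. -/
theorem Dbar_formula {s s' s'' : Π u, V E M u} {Z : TangentSpace (model E) u} (hs : DiffV s u)
    (hs' : DiffV s' u) (hs'' : DiffV s'' u) (hZ : Φ.H.vert u Z = s u) :
    Φ.gV u (C.Dbar s' u Z) (s'' u) = Φ.gV u (C.Dtilde s' u Z) (s'' u) -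
      1 / 3 * Φ.gualtieriTorsion C.DD0 C.Dtilde s s' s'' u := by
  have h1 := C.Dbar_horizontal u s' hs' (Z - vlift u (s u)) (by
    change Φ.H.vert u (Z - vlift u (s u)) = 0
    rw [map_sub, Φ.H.vert_vlift, hZ, sub_self])
  have h2 := C.Dbar_vertical u s s' s'' hs hs' hs''
  rw [ContinuousLinearMap.map_sub, ContinuousLinearMap.map_sub] at h1
  rw [map_sub, LinearMap.sub_apply] at h2
  have h3 := congrArg (fun w => Φ.gV u w (s'' u)) h1
  simp only [map_sub, LinearMap.sub_apply] at h3
  linarith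

theorem Dbar_formula_torsionForm {s' s'' : Π u, V E M u} (Z : TangentSpace (model E) u)
    (hs' : DiffV s' u) (hs'' : DiffV s'' u) :
    Φ.gV u (C.Dbar s' u Z) (s'' u) = Φ.gV u (C.Dtilde s' u Z) (s'' u) -
      1 / 3 * Φ.torsionForm C.Dtilde C.DD0 u (Φ.H.vert u Z) (s' u) (s'' u) := by
  obtain ⟨s, hs, hsu⟩ := exists_diffV u (Φ.H.vert u Z)
  rw [C.Dbar_formula hs.diffV hs' hs'' hsu.symm, Φ.gualtieriTorsion_eq_torsionForm
    C.isDoubleMetric_Dtilde.2 C.isDoubleMetric_DD0.2 hs.diffV hs', hsu]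

theorem smoothConnection_Dbar : SmoothConnection C.Dbar := by
  refine smoothConnection_of_form (b := Φ.gVL)
    (K := fun X s' s'' u => Φ.gV u (C.Dtilde s' u (X u)) (s'' u) -
      1 / 3 * Φ.gualtieriTorsion C.DD0 C.Dtilde (fun v => Φ.H.vert v (X v)) s' s'' u)
    Φ.gVL_isInvertible
    Φ.contMDiffAt_gVL (fun u X s s' hX hs hs' => ?_) (fun u X s s' hX hs hs' => ?_)
  · rw [gVL_apply]
    exact C.Dbar_formula (Φ.diffV_vert hX) hs hs' rfl
  · have h1 := contMDiffAt_gV (Φ := Φ) (C.smoothConnection_Dtilde.apply hX hs) hs'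
    exact h1.sub (contMDiffAt_const.mul (contMDiffAt_gualtieriTorsion C.smoothConnection_Dtilde
      C.smoothConnection_DD0 (Φ.smoothV_vert hX) hs hs'))

/-- The correction is skew in its last two arguments, so its two contributions to the derivative of
g_V(s, s') cancel. -/
theorem preservesV_gV_Dbar : PreservesV C.Dbar fun u w w' => Φ.gV u w w' := by
  intro u s s' hs hs' Z
  rw [C.isDoubleMetric_Dtilde.2 u s s' hs hs' Z]
  beta_reduce
  rw [Φ.gV_symm u (s u), Φ.gV_symm u (s u), C.Dbar_formula_torsionForm Z hs hs',
    C.Dbar_formula_torsionForm Z hs' hs,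
    Φ.torsionForm_skew C.isDoubleMetric_Dtilde.2 C.isDoubleMetric_DD0.2 _ (s' u)]
  ring

/-- On a totally skew B, the expression B(a,b,c) - B(b,a,c) - (B(c,b,a) - B(c,a,b))/2 equals 3B.
With B a third of the torsion this removes the torsion exactly. -/
theorem gualtieriTorsion_Dbar {s s' s'' : Π u, V E M u} (hs : DiffV s u)
    (hs' : DiffV s' u) (hs'' : DiffV s'' u) :
    Φ.gualtieriTorsion C.DD0 C.Dbar s s' s'' u = 0 := by
  have key : ∀ {a b c : Π u, V E M u}, DiffV b u → DiffV c u →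
      Φ.contorsion C.Dbar C.DD0 a b c u = Φ.contorsion C.Dtilde C.DD0 a b c u -
        1 / 3 * Φ.torsionForm C.Dtilde C.DD0 u (a u) (b u) (c u) := by
    intro a b c hb hc
    have := C.Dbar_formula_torsionForm (vlift u (a u)) hb hc
    rw [Φ.H.vert_vlift] at this
    simp only [contorsion, map_sub, LinearMap.sub_apply]
    linarith
  have h := Φ.gualtieriTorsion_eq C.DD0 C.Dtilde s s' s'' u
  rw [Φ.gualtieriTorsion_eq_torsionForm C.isDoubleMetric_Dtilde.2 C.isDoubleMetric_DD0.2
    hs hs'] at h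
  have sk := fun a b c : V E M u =>
    Φ.torsionForm_skew C.isDoubleMetric_Dtilde.2 C.isDoubleMetric_DD0.2 a b c
  have r1 : Φ.torsionForm C.Dtilde C.DD0 u (s' u) (s u) (s'' u) =
      -Φ.torsionForm C.Dtilde C.DD0 u (s u) (s' u) (s'' u) := by
    rw [sk, ← Φ.torsionForm_rotate (s u)]
  have r2 : Φ.torsionForm C.Dtilde C.DD0 u (s'' u) (s u) (s' u) =
      Φ.torsionForm C.Dtilde C.DD0 u (s u) (s' u) (s'' u) := Φ.torsionForm_rotate _ _ _
  have r3 : Φ.torsionForm C.Dtilde C.DD0 u (s'' u) (s' u) (s u) =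
      -Φ.torsionForm C.Dtilde C.DD0 u (s u) (s' u) (s'' u) := by
    rw [sk, r2]
  rw [gualtieriTorsion_eq, key hs' hs'', key hs hs'', key hs' hs, key hs hs', r1, r2, r3]
  linarith

end FieldAdapted

/-- Connections of pairs preserve U_ε, so their difference maps it into itself, and U_ε is
g_V-orthogonal to U_{-ε}. -/
theorem contorsionForm_iota_iota_neg {Dp Dm D0 : Conn1 E M} {D DD0 : ConnV E M}
    (h : Φ.IsPair Dp Dm D) (h0 : Φ.IsPair D0 D0 DD0) {ε : ℝ} (hε : ε = 1 ∨ ε = -1)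
    (w : V E M u) (a b : V1 E M u) :
    Φ.contorsionForm D DD0 u w (Φ.iota ε u a) (Φ.iota (-ε) u b) = 0 := by
  obtain ⟨s, hs, rfl⟩ := exists_diffV u w
  obtain ⟨Y, hY, rfl⟩ := exists_diff1 u a
  obtain ⟨W, hW, rfl⟩ := exists_diff1 u b
  have e := Φ.contorsionForm_apply D DD0 (s := s) (s' := fun v => Φ.iota ε v (Y v))
    (s'' := fun v => Φ.iota (-ε) v (W v)) (Φ.diffV_iota ε hY.diff1)
  refine e.trans ?_
  rw [contorsion, h0.apply_iota hε rfl hY.diff1]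
  rcases hε with rfl | rfl
  · rw [(h u Y hY.diff1 _).1, ← iota_sub, gV_iota_iota_neg _ (Or.inl rfl)]
  · rw [(h u Y hY.diff1 _).2, ← iota_sub, gV_iota_iota_neg _ (Or.inr rfl)]

theorem prU_iota_self {ε : ℝ} (hε : ε = 1 ∨ ε = -1) (a : V1 E M u) :
    Φ.prU ε u (Φ.iota ε u a) = Φ.iota ε u a := by
  rw [Φ.prU_eq hε, coordU_iota_self _ hε]

/-! ### Mixed components of the torsion, and preservation of `g` -/

namespace FieldAdapted

variable (C : Φ.FieldAdapted)

/-- This is the purpose of the bracket modification: along U_{-ε} it replaces D^ε by D⁰, so on U_ε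
the modified connection and 𝒟⁰ have the same derivatives in these directions. -/
theorem contorsionForm_iota_neg_iota {ε : ℝ} (hε : ε = 1 ∨ ε = -1) (a b : V1 E M u)
    (w : V E M u) :
    Φ.contorsionForm C.Dtilde C.DD0 u (Φ.iota (-ε) u a) (Φ.iota ε u b) w = 0 := by
  have hε' : -ε = 1 ∨ -ε = -1 := by rcases hε with rfl | rfl <;> norm_num
  obtain ⟨s, hs, rfl⟩ := exists_diffV u w
  obtain ⟨Y, hY, rfl⟩ := exists_diff1 u a
  obtain ⟨W, hW, rfl⟩ := exists_diff1 u b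
  have e := Φ.contorsionForm_apply C.Dtilde C.DD0 (s := fun v => Φ.iota (-ε) v (Y v))
    (s' := fun v => Φ.iota ε v (W v)) (s'' := s) (Φ.diffV_iota ε hW.diff1)
  refine e.trans ?_
  have hd : C.Dtilde (fun v => Φ.iota ε v (W v)) u (vlift u (Φ.iota (-ε) u (Y u))) =
      Φ.iota ε u (C.D0 W u (vlift u (Φ.iota (-ε) u (Y u)))) := by
    rcases hε with rfl | rfl
    · rw [(C.Dtilde_pair u W hW.diff1 _).1,
        C.DtildePlus_modification.formula C.DD0_pair (Or.inl rfl) hW.diff1, Φ.H.vert_vlift,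
        prU_iota_self hε', add_sub_cancel]
    · rw [(C.Dtilde_pair u W hW.diff1 _).2,
        C.DtildeMinus_modification.formula C.DD0_pair (Or.inr rfl) hW.diff1, Φ.H.vert_vlift,
        prU_iota_self hε', add_sub_cancel]
  rw [contorsion, C.DD0_pair.apply_iota hε rfl hW.diff1, hd, sub_self, map_zero,
    LinearMap.zero_apply]

/-- Take w in U₊ or in U₋. Each term of the cyclic sum then has its last two arguments in opposite
eigenbundles, where both connections preserving U_± gives 0, or its first two, where the bracket
modification gives 0. -/
theorem torsionForm_iota_iota_neg (w : V E M u) (a b : V1 E M u) :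
    Φ.torsionForm C.Dtilde C.DD0 u w (Φ.iota 1 u a) (Φ.iota (-1) u b) = 0 := by
  have f1 := fun {ε : ℝ} (hε : ε = 1 ∨ ε = -1) (w : V E M u) (a b : V1 E M u) =>
    contorsionForm_iota_iota_neg C.Dtilde_pair C.DD0_pair hε w a b
  have g1 : ∀ (w : V E M u) (a b : V1 E M u),
      Φ.contorsionForm C.Dtilde C.DD0 u w (Φ.iota (-1) u a) (Φ.iota 1 u b) = 0 := by
    intro w a b
    have := f1 (Or.inr rfl) w a b
    rwa [neg_neg] at this
  have g2 : ∀ (a b : V1 E M u) (w : V E M u),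
      Φ.contorsionForm C.Dtilde C.DD0 u (Φ.iota 1 u a) (Φ.iota (-1) u b) w = 0 := by
    intro a b w
    have := C.contorsionForm_iota_neg_iota (Or.inr rfl) a b w
    rwa [neg_neg] at this
  rw [← Φ.iota_coordU_add u w, torsionForm_add, torsionForm, torsionForm,
    f1 (Or.inl rfl), f1 (Or.inl rfl), g1, g1, g2,
    C.contorsionForm_iota_neg_iota (Or.inl rfl)]
  norm_num

theorem preservesV_g_Dbar : PreservesV C.Dbar fun u w w' => g u w w' := by
  intro u s s' hs hs' Z
  -- This is g(x, y) = g_V(x, φ y)/2 with φ = pr_{U₊} - pr_{U₋}; it transfers the formula for the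
  -- field-adapted connection from g_V to g.
  have hg : ∀ x y : V E M u, g u x y = (Φ.gV u x (Φ.iota 1 u (Φ.coordU 1 u y)) -
      Φ.gV u x (Φ.iota (-1) u (Φ.coordU (-1) u y))) / 2 := by
    intro x y
    rw [Φ.g_eq, gV_eq, gV_eq, coordU_iota_self _ (Or.inl rfl), coordU_iota_self _ (Or.inr rfl),
      coordU_neg_iota _ (Or.inl rfl), coordU_iota_neg _ (Or.inl rfl), map_zero, map_zero]
    ring
  let t := Φ.torsionForm C.Dtilde C.DD0 u (Φ.H.vert u Z)
  have ht : ∀ x y, t x y = -t y x := fun x y =>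
    Φ.torsionForm_skew C.isDoubleMetric_Dtilde.2 C.isDoubleMetric_DD0.2 _ x y
  have hadd : ∀ x x' y, t (x + x') y = t x y + t x' y := fun x x' y => by
    simp only [t]
    rw [torsionForm_rotate, torsionForm_add, Φ.torsionForm_rotate _ x, Φ.torsionForm_rotate _ x']
  have hmix : ∀ a b, t (Φ.iota 1 u a) (Φ.iota (-1) u b) = 0 := fun a b =>
    C.torsionForm_iota_iota_neg _ a b
  have hmix' : ∀ a b, t (Φ.iota (-1) u a) (Φ.iota 1 u b) = 0 := fun a b => by
    rw [ht, hmix, neg_zero]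
  have hp : ∀ x a, t x (Φ.iota 1 u a) = t (Φ.iota 1 u (Φ.coordU 1 u x)) (Φ.iota 1 u a) :=
    fun x a => by
      conv_lhs => rw [← Φ.iota_coordU_add u x]
      rw [hadd, hmix', add_zero]
  have hm : ∀ x a, t x (Φ.iota (-1) u a) =
      t (Φ.iota (-1) u (Φ.coordU (-1) u x)) (Φ.iota (-1) u a) :=
    fun x a => by
      conv_lhs => rw [← Φ.iota_coordU_add u x]
      rw [hadd, hmix, zero_add]
  -- Without mixed components only the blocks in U₊ and U₋ remain, and each is skew in s, s'. The
  -- constant is 1/3 from the correction times 1/2 from `hg`.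
  have key : ∀ {s s' : Π u, V E M u}, DiffV s u → DiffV s' u →
      g u (C.Dbar s u Z) (s' u) = g u (C.Dtilde s u Z) (s' u) - 1 / 6 *
        (t (Φ.iota 1 u (Φ.coordU 1 u (s u))) (Φ.iota 1 u (Φ.coordU 1 u (s' u))) -
          t (Φ.iota (-1) u (Φ.coordU (-1) u (s u)))
            (Φ.iota (-1) u (Φ.coordU (-1) u (s' u)))) := by
    intro s s' hs hs'
    have h1 := C.Dbar_formula_torsionForm Z hs (Φ.diffV_iota 1 (Φ.diff1_coordU 1 hs'))
    have h2 := C.Dbar_formula_torsionForm Z hs (Φ.diffV_iota (-1) (Φ.diff1_coordU (-1) hs'))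
    rw [hg, hg, h1, h2, ← hp, ← hm]
    ring
  have gs : ∀ x y : V E M u, g u x y = g u y x := fun x y => by
    rw [g_apply, g_apply, add_comm]
  rw [C.isDoubleMetric_Dtilde.1 u s s' hs hs' Z]
  beta_reduce
  rw [gs (s u), gs (s u), key hs hs', key hs' hs, ht (Φ.iota 1 u (Φ.coordU 1 u (s' u))),
    ht (Φ.iota (-1) u (Φ.coordU (-1) u (s' u)))]
  ring

theorem isDoubleMetric_Dbar : Φ.IsDoubleMetric C.Dbar :=
  ⟨C.preservesV_g_Dbar, C.preservesV_gV_Dbar⟩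

end FieldAdapted

end DoubleField
end BigTangent

namespace BigTangent
open BundleAux VectorField

section Lift

variable {E : Type*} [NormedAddCommGroup E] [NormedSpace ℝ E] [FiniteDimensional ℝ E]
  {M : Type*} [TopologicalSpace M] [ChartedSpace E M] [IsManifold 𝓘(ℝ, E) ∞ M]
  {E' : Type*} [NormedAddCommGroup E'] [NormedSpace ℝ E'] [FiniteDimensional ℝ E']
  {N : Type*} [TopologicalSpace N] [ChartedSpace E' N] [IsManifold 𝓘(ℝ, E') ∞ N]
  {f : M → N}

/-! ### The lift of a local diffeomorphism -/

theorem isInvertible_dBase (hf : IsLocalDiffeomorph 𝓘(ℝ, E) 𝓘(ℝ, E') ∞ f) (u : Total E M) :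
    (dBase (E' := E') f u).IsInvertible :=
  ⟨hf.mfderivToContinuousLinearEquiv (by simp) u.proj, rfl⟩

/-- In trivializations the lift is (y, z) ↦ (L y, z ∘ L⁻¹), with L the coordinate expression of df,
so its smoothness reduces to that of df and of operator inversion. -/
theorem liftMap_coordinates (hf : IsLocalDiffeomorph 𝓘(ℝ, E) 𝓘(ℝ, E') ∞ f) (x : M)
    (v : Total E M)
    (hv : v.proj ∈ (trivializationAt E (TangentSpace 𝓘(ℝ, E) : M → Type _) x).baseSet)
    (hv' : f v.proj ∈ (trivializationAt E' (TangentSpace 𝓘(ℝ, E') : N → Type _) (f x)).baseSet) :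
    ∃ L : E ≃L[ℝ] E', inTangentCoordinates 𝓘(ℝ, E) 𝓘(ℝ, E') id f
        (mfderiv 𝓘(ℝ, E) 𝓘(ℝ, E') f) x v.proj = (L : E →L[ℝ] E') ∧
      (trivializationAt (E' × (E' →L[ℝ] ℝ)) (Fibre E' N) (f x) (liftMap f v)).2 =
        (L (trivializationAt (E × (E →L[ℝ] ℝ)) (Fibre E M) x v).2.1,
          (trivializationAt (E × (E →L[ℝ] ℝ)) (Fibre E M) x v).2.2 ∘L (L.symm : E' →L[ℝ] E)) := by
  obtain ⟨d, hd⟩ := isInvertible_dBase hf v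
  let k := (trivializationAt E (TangentSpace 𝓘(ℝ, E) : M → Type _) x).continuousLinearEquivAt
    ℝ v.proj hv
  let k' := (trivializationAt E' (TangentSpace 𝓘(ℝ, E') : N → Type _)
    (f x)).continuousLinearEquivAt ℝ (f v.proj) hv'
  let L : E ≃L[ℝ] E' := k.symm.trans (d.trans k')
  have hinv : (dBase (E' := E') f v).inverse = d.symm := by
    rw [← hd, ContinuousLinearMap.inverse_equiv]
  refine ⟨L, ?_, Prod.ext ?_ ?_⟩
  · refine (ContinuousLinearMap.inCoordinates_eq hv hv').trans ?_
    have hd' : mfderiv 𝓘(ℝ, E) 𝓘(ℝ, E') f v.proj = d := hd.symm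
    rw [hd']
    rfl
  · change k' (dBase f v v.2.1) = k' (d (k.symm (k v.2.1)))
    rw [k.symm_apply_apply, ← hd]
    rfl
  · change ContinuousLinearMap.inCoordinates E' (TangentSpace 𝓘(ℝ, E') : N → Type _) ℝ
        (Trivial N ℝ) (f x) (f v.proj) (f x) (f v.proj)
        (v.2.2 ∘L (dBase (E' := E') f v).inverse) =
      ContinuousLinearMap.inCoordinates E (TangentSpace 𝓘(ℝ, E) : M → Type _) ℝ
        (Trivial M ℝ) x v.proj x v.proj v.2.2 ∘L (L.symm : E' →L[ℝ] E)
    rw [ContinuousLinearMap.inCoordinates_eq hv' (Set.mem_univ _),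
      ContinuousLinearMap.inCoordinates_eq hv (Set.mem_univ _), hinv]
    ext q
    change v.2.2 (d.symm (k'.symm q)) = v.2.2 (k.symm (k (d.symm (k'.symm q))))
    rw [k.symm_apply_apply]

open Filter Topology in
theorem contMDiff_liftMap (hf : IsLocalDiffeomorph 𝓘(ℝ, E) 𝓘(ℝ, E') ∞ f) :
    ContMDiff (model E) (model E') ∞ (liftMap (E := E) (E' := E') f) := by
  intro u
  have : CompleteSpace E := FiniteDimensional.complete ℝ E
  have hfp : ContMDiff (model E) 𝓘(ℝ, E') ∞ fun v : Total E M => f v.proj :=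
    hf.contMDiff.comp (p E M).contMDiff
  rw [contMDiffAt_totalSpace]
  refine ⟨hfp.contMDiffAt, ?_⟩
  let c : Total E M → E × (E →L[ℝ] ℝ) := fun v =>
    (trivializationAt (E × (E →L[ℝ] ℝ)) (Fibre E M) u.proj v).2
  have hc : ContMDiffAt (model E) 𝓘(ℝ, E × (E →L[ℝ] ℝ)) ∞ c u :=
    (contMDiffAt_totalSpace.1 (contMDiffAt_id (x := u))).2
  have hc' := (contMDiffAt_prod_module_iff (I := model E) (F₁ := E) (F₂ := E →L[ℝ] ℝ) c).1 hc
  let A : M → E →L[ℝ] E' :=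
    inTangentCoordinates 𝓘(ℝ, E) 𝓘(ℝ, E') id f (mfderiv 𝓘(ℝ, E) 𝓘(ℝ, E') f) u.proj
  have hA : ContMDiffAt 𝓘(ℝ, E) 𝓘(ℝ, E →L[ℝ] E') ∞ A u.proj :=
    ContMDiffAt.mfderiv_const (n := ∞) hf.contMDiff.contMDiffAt (by simp)
  have hA' : ContMDiffAt (model E) 𝓘(ℝ, E →L[ℝ] E') ∞ (fun v : Total E M => A v.proj) u :=
    ContMDiffAt.comp (I' := 𝓘(ℝ, E)) u hA (p E M).contMDiff.contMDiffAt
  have hu : ∀ᶠ v : Total E M in 𝓝 u,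
      v.proj ∈ (trivializationAt E (TangentSpace 𝓘(ℝ, E) : M → Type _) u.proj).baseSet ∧
      f v.proj ∈
        (trivializationAt E' (TangentSpace 𝓘(ℝ, E') : N → Type _) (f u.proj)).baseSet := by
    refine ((p E M).contMDiff.continuous.continuousAt.eventually_mem
      ((Trivialization.open_baseSet _).mem_nhds
        (FiberBundle.mem_baseSet_trivializationAt' _))).and ?_
    exact hfp.continuous.continuousAt.eventually_mem
      ((Trivialization.open_baseSet _).mem_nhds (FiberBundle.mem_baseSet_trivializationAt' _))
  have key : ∀ᶠ v in 𝓝 u, ∃ L : E ≃L[ℝ] E', A v.proj = (L : E →L[ℝ] E') ∧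
      (trivializationAt (E' × (E' →L[ℝ] ℝ)) (Fibre E' N) (f u.proj) (liftMap f v)).2 =
        (L (c v).1, (c v).2 ∘L (L.symm : E' →L[ℝ] E)) :=
    hu.mono fun v hv => liftMap_coordinates hf u.proj v hv.1 hv.2
  clear_value A c
  obtain ⟨L, hL, -⟩ := key.self_of_nhds
  -- The isomorphism L depends on the point with no stated regularity; it serves only to identify
  -- its inverse with `(A v.proj).inverse`, which is smooth.
  have hinv : ContMDiffAt (model E) 𝓘(ℝ, E' →L[ℝ] E) ∞ (fun v => (A v.proj).inverse) u :=
    (ContinuousLinearMap.IsInvertible.contDiffAt_map_inverse (n := ∞)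
      ⟨L, hL.symm⟩).contMDiffAt.comp u hA'
  have h1 : ContMDiffAt (model E) 𝓘(ℝ, E') ∞ (fun v => A v.proj (c v).1) u :=
    ContMDiffAt.clm_apply (g := fun v => A v.proj) hA' hc'.1
  have h2 : ContMDiffAt (model E) 𝓘(ℝ, E' →L[ℝ] ℝ) ∞
      (fun v => (c v).2 ∘L (A v.proj).inverse) u :=
    ContMDiffAt.clm_comp (g := fun v => (c v).2) hc'.2 hinv
  have hfin := h1.prodMk_space h2
  refine hfin.congr_of_eventuallyEq ?_
  filter_upwards [key] with v ⟨L, hL, h⟩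
  rw [hL, ContinuousLinearMap.inverse_equiv]
  exact h

end Lift
end BigTangent

/-! ### The differential of the lift -/

namespace BigTangent
open BundleAux VectorField

section Lift

variable {E : Type*} [NormedAddCommGroup E] [NormedSpace ℝ E] [FiniteDimensional ℝ E]
  {M : Type*} [TopologicalSpace M] [ChartedSpace E M] [IsManifold 𝓘(ℝ, E) ∞ M]
  {E' : Type*} [NormedAddCommGroup E'] [NormedSpace ℝ E'] [FiniteDimensional ℝ E']
  {N : Type*} [TopologicalSpace N] [ChartedSpace E' N] [IsManifold 𝓘(ℝ, E') ∞ N]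

/-- The differential of the lift of `f` to the big tangent manifolds. -/
def dLift (f : M → N) (u : Total E M) :
    TangentSpace (model E) u →L[ℝ] TangentSpace (model E') (liftMap (E' := E') f u) :=
  mfderiv (model E) (model E') (liftMap f) u

/-- `lift1` as a continuous linear map. -/
def lift1L (f : M → N) (u : Total E M) : V1 E M u →L[ℝ] V1 E' N (liftMap f u) :=
  dBase (E' := E') f u

/-- The inverse of `lift1`. -/
def colift1 (f : M → N) (u : Total E M) : V1 E' N (liftMap f u) →L[ℝ] V1 E M u :=
  (dBase (E' := E') f u).inverse

/-- `liftV` as a continuous linear map. -/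
def liftVL (f : M → N) (u : Total E M) : V E M u →L[ℝ] V E' N (liftMap f u) :=
  ContinuousLinearMap.prodMap (dBase (E' := E') f u)
    (ContinuousLinearMap.precomp ℝ (dBase (E' := E') f u).inverse)

variable {f : M → N}

theorem lift1L_apply (u : Total E M) (Y : V1 E M u) : lift1L (E' := E') f u Y = lift1 f u Y := rfl

theorem prV1_liftV (u : Total E M) (w : V E M u) :
    prV1 (liftMap f u) (liftV (E' := E') f u w) = lift1 f u (prV1 u w) := by
  rw [liftV, map_add, prV1_inclV1, prV1_inclV2, add_zero]

theorem prV2_liftV (u : Total E M) (w : V E M u) (Y : V1 E' N (liftMap f u)) :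
    prV2 (liftMap f u) (liftV (E' := E') f u w) Y =
      prV2 u w (colift1 f u Y) := by
  rw [liftV, map_add, prV2_inclV1, prV2_inclV2, zero_add]
  rfl

theorem liftVL_apply (u : Total E M) (w : V E M u) : liftVL (E' := E') f u w = liftV f u w := by
  refine V_ext ?_ ?_
  · rw [prV1_liftV]; rfl
  · ext Y
    rw [prV2_liftV]
    rfl

theorem prV1_pullV (s : Π u, V E' N u) (u : Total E M) :
    prV1 u (pullV f s u) = colift1 f u (prV1 _ (s (liftMap f u))) := by
  change prV1 u (inclV1 u (colift1 f u _) + inclV2 u _) = _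
  rw [map_add, prV1_inclV1, prV1_inclV2, add_zero]

theorem prV2_pullV (s : Π u, V E' N u) (u : Total E M) (Y : V1 E M u) :
    prV2 u (pullV f s u) Y = prV2 _ (s (liftMap f u)) (lift1 f u Y) := by
  change prV2 u (inclV1 u (colift1 f u _) + inclV2 u _) Y = _
  rw [map_add, prV2_inclV1, prV2_inclV2, zero_add]
  rfl

variable (hf : IsLocalDiffeomorph 𝓘(ℝ, E) 𝓘(ℝ, E') ∞ f)
include hf

theorem mdifferentiableAt_liftMap (u : Total E M) :
    MDifferentiableAt (model E) (model E') (liftMap (E := E) (E' := E') f) u :=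
  (contMDiff_liftMap hf).contMDiffAt.mdifferentiableAt (by simp)

theorem colift1_lift1 (u : Total E M) (Y : V1 E M u) :
    colift1 f u (lift1 (E' := E') f u Y) = Y := by
  obtain ⟨d, hd⟩ := isInvertible_dBase hf u
  change (dBase (E' := E') f u).inverse (dBase f u Y) = Y
  rw [← hd, ContinuousLinearMap.inverse_equiv]
  exact d.symm_apply_apply Y

theorem lift1_colift1 (u : Total E M) (Y : V1 E' N (liftMap f u)) :
    lift1 (E' := E') f u (colift1 f u Y) = Y := by
  obtain ⟨d, hd⟩ := isInvertible_dBase hf u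
  change dBase (E' := E') f u ((dBase (E' := E') f u).inverse Y) = Y
  rw [← hd, ContinuousLinearMap.inverse_equiv]
  exact d.apply_symm_apply Y

theorem lift1_injective (u : Total E M) : Function.Injective (lift1 (E' := E') f u) :=
  Function.LeftInverse.injective (g := colift1 f u) (colift1_lift1 hf u)

theorem prV2_liftV_lift1 (u : Total E M) (w : V E M u) (Y : V1 E M u) :
    prV2 (liftMap f u) (liftV (E' := E') f u w) (lift1 f u Y) = prV2 u w Y := by
  rw [prV2_liftV, colift1_lift1 hf]

theorem liftV_ext {u : Total E M} {w : V E M u} {w' : V E' N (liftMap f u)}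
    (h1 : prV1 _ w' = lift1 f u (prV1 u w))
    (h2 : ∀ Y, prV2 _ w' (lift1 f u Y) = prV2 u w Y) : w' = liftV f u w := by
  refine V_ext (by rw [h1, prV1_liftV]) ?_
  ext Y
  rw [← lift1_colift1 hf u Y, h2, prV2_liftV_lift1 hf]

theorem liftV_pullV (s : Π u, V E' N u) (u : Total E M) :
    liftV f u (pullV f s u) = s (liftMap f u) := by
  refine (liftV_ext hf ?_ fun Y => ?_).symm
  · rw [prV1_pullV, lift1_colift1 hf]
  · rw [prV2_pullV]

theorem liftV_injective (u : Total E M) : Function.Injective (liftV (E' := E') f u) := by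
  intro w w' h
  refine V_ext (lift1_injective hf u ?_) ?_
  · rw [← prV1_liftV, h, prV1_liftV]
  · ext Y
    rw [← prV2_liftV_lift1 hf, h, prV2_liftV_lift1 hf]

/-- Restricted to a fibre the lift is linear, equal to `liftVL`, so it is its own differential
there. -/
theorem dLift_vlift (u : Total E M) (w : V E M u) :
    dLift (E' := E') f u (vlift u w) = vlift (liftMap f u) (liftV f u w) := by
  let G : E × (E →L[ℝ] ℝ) →L[ℝ] E' × (E' →L[ℝ] ℝ) := liftVL (E' := E') f u
  let j : E × (E →L[ℝ] ℝ) → Total E M := fun w => ⟨u.proj, w⟩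
  let j' : E' × (E' →L[ℝ] ℝ) → Total E' N := fun w => ⟨f u.proj, w⟩
  have hj : MDifferentiableAt 𝓘(ℝ, E × (E →L[ℝ] ℝ)) (model E) j u.2 :=
    (contMDiff_fibreIncl (E := E) u.proj).contMDiffAt.mdifferentiableAt (by simp)
  have hj' : MDifferentiableAt 𝓘(ℝ, E' × (E' →L[ℝ] ℝ)) (model E') j' (G u.2) :=
    (contMDiff_fibreIncl (E := E') (f u.proj)).contMDiffAt.mdifferentiableAt (by simp)
  have hG : HasMFDerivAt 𝓘(ℝ, E × (E →L[ℝ] ℝ)) 𝓘(ℝ, E' × (E' →L[ℝ] ℝ)) G u.2 G :=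
    G.hasMFDerivAt
  let w₀ : E × (E →L[ℝ] ℝ) := u.2
  have h1 := (mdifferentiableAt_liftMap hf (j w₀)).hasMFDerivAt.comp w₀ hj.hasMFDerivAt
  have h2 := hj'.hasMFDerivAt.comp w₀ hG
  change HasMFDerivAt _ _ (j' ∘ G) w₀ _ at h1
  have h3 := hasMFDerivAt_unique h1 h2
  have h4 := congrArg (fun L : E × (E →L[ℝ] ℝ) →L[ℝ] E' × (E' × (E' →L[ℝ] ℝ)) => L w) h3
  rw [← liftVL_apply]
  exact h4

theorem dproj_dLift (u : Total E M) (Z : TangentSpace (model E) u) :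
    dproj (liftMap f u) (dLift (E' := E') f u Z) = lift1 f u (dproj u Z) := by
  have h : p E' N ∘ liftMap (E := E) (E' := E') f = f ∘ p E M := rfl
  have hp : MDifferentiableAt (model E) 𝓘(ℝ, E) (p E M) u :=
    (p E M).contMDiff.contMDiffAt.mdifferentiableAt (by simp)
  have hp' : MDifferentiableAt (model E') 𝓘(ℝ, E') (p E' N) (liftMap f u) :=
    (p E' N).contMDiff.contMDiffAt.mdifferentiableAt (by simp)
  have hf' : MDifferentiableAt 𝓘(ℝ, E) 𝓘(ℝ, E') f (p E M u) :=
    hf.contMDiff.contMDiffAt.mdifferentiableAt (by simp)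
  have h1 := hp'.hasMFDerivAt.comp u (mdifferentiableAt_liftMap hf u).hasMFDerivAt
  have h2 := hf'.hasMFDerivAt.comp u hp.hasMFDerivAt
  rw [h] at h1
  exact congrArg (fun L : E × (E × (E →L[ℝ] ℝ)) →L[ℝ] E' => L Z) (hasMFDerivAt_unique h1 h2)

omit hf in
theorem dLift_eq (u : Total E M) : mfderiv (model E) (model E') (liftMap f) u = dLift f u := rfl

variable {Φ : DoubleField E M} {Φ' : DoubleField E' N} (hΦ : IsPullback f Φ Φ')
include hΦ

/-- The differential intertwines the components along the base and along V with the injective maps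
`lift1` and `liftV`, hence is injective. The dimensions agree because df is invertible. -/
theorem isInvertible_dLift (u : Total E M) : (dLift (E' := E') f u).IsInvertible := by
  have hinj : Function.Injective (dLift (E' := E') f u) := by
    rw [injective_iff_map_eq_zero]
    intro Z hZ
    refine Φ.dproj_vert_injective u Z (lift1_injective hf u ?_) (liftV_injective hf u ?_)
    · rw [← dproj_dLift hf, hZ, map_zero, ← lift1L_apply, map_zero]
    · rw [← hΦ.H, dLift_eq, hZ, map_zero, ← liftVL_apply, map_zero]
  obtain ⟨d, -⟩ := isInvertible_dBase hf u
  let d' : E ≃L[ℝ] E' := d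
  let k : (E × (E × (E →L[ℝ] ℝ))) ≃L[ℝ] (E' × (E' × (E' →L[ℝ] ℝ))) :=
    d'.prodCongr (d'.prodCongr (d'.arrowCongr (ContinuousLinearEquiv.refl ℝ ℝ)))
  let L : (E × (E × (E →L[ℝ] ℝ))) →L[ℝ] (E' × (E' × (E' →L[ℝ] ℝ))) := dLift (E' := E') f u
  have hL : Function.Injective L.toLinearMap := hinj
  refine ⟨(L.toLinearMap.linearEquivOfInjective hL
    k.toLinearEquiv.finrank_eq).toContinuousLinearEquiv, ?_⟩
  rfl

end Lift
end BigTangent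

/-! ### Pull-backs of sections, vector fields and structures -/

namespace BigTangent
open BundleAux VectorField

section Lift

variable {E : Type*} [NormedAddCommGroup E] [NormedSpace ℝ E] [FiniteDimensional ℝ E]
  {M : Type*} [TopologicalSpace M] [ChartedSpace E M] [IsManifold 𝓘(ℝ, E) ∞ M]
  {E' : Type*} [NormedAddCommGroup E'] [NormedSpace ℝ E'] [FiniteDimensional ℝ E']
  {N : Type*} [TopologicalSpace N] [ChartedSpace E' N] [IsManifold 𝓘(ℝ, E') ∞ N]

/-- The pull-back of a section of `V₁` by `liftMap f`. -/
def pull1 (f : M → N) (Y : Π u, V1 E' N u) (u : Total E M) : V1 E M u :=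
  colift1 f u (Y (liftMap f u))

/-- The pull-back of a vector field by `liftMap f`. -/
def pullT (f : M → N) (X : Π u : Total E' N, TangentSpace (model E') u) (u : Total E M) :
    TangentSpace (model E) u :=
  mpullback (model E) (model E') (liftMap f) X u

variable {f : M → N} (hf : IsLocalDiffeomorph 𝓘(ℝ, E) 𝓘(ℝ, E') ∞ f)
  {Φ : DoubleField E M} {Φ' : DoubleField E' N} (hΦ : IsPullback f Φ Φ')

include hf in
theorem lift1_pull1 (Y : Π u, V1 E' N u) (u : Total E M) :
    lift1 f u (pull1 f Y u) = Y (liftMap f u) :=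
  lift1_colift1 hf u _

include hf in
theorem dirDeriv_dLift {h : Total E' N → ℝ} {u : Total E M}
    (hh : MDifferentiableAt (model E') 𝓘(ℝ, ℝ) h (liftMap f u)) (Z : TangentSpace (model E) u) :
    dirDeriv h (liftMap f u) (dLift f u Z) = dirDeriv (fun v => h (liftMap f v)) u Z :=
  (mvfderiv_comp_apply (I' := model E) (I := model E') u hh (mdifferentiableAt_liftMap hf u) Z).symm

include hf hΦ

theorem dLift_pullT (X : Π u : Total E' N, TangentSpace (model E') u) (u : Total E M) :
    dLift f u (pullT f X u) = X (liftMap f u) := by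
  obtain ⟨d, hd⟩ := isInvertible_dLift hf hΦ u
  change dLift f u ((dLift f u).inverse (X (liftMap f u))) = _
  rw [← hd, ContinuousLinearMap.inverse_equiv]
  exact d.apply_symm_apply _

theorem dLift_injective (u : Total E M) : Function.Injective (dLift (E' := E') f u) := by
  obtain ⟨d, hd⟩ := isInvertible_dLift hf hΦ u
  rw [← hd]
  exact d.injective

theorem pullT_eq_iff {X : Π u : Total E' N, TangentSpace (model E') u} {u : Total E M}
    {Z : TangentSpace (model E) u} : pullT f X u = Z ↔ X (liftMap f u) = dLift f u Z := by
  rw [← dLift_pullT hf hΦ X u]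
  exact (dLift_injective hf hΦ u).eq_iff.symm

theorem diffT_pullT {X : Π u : Total E' N, TangentSpace (model E') u} {u : Total E M}
    (hX : DiffT X (liftMap f u)) : DiffT (pullT f X) u := by
  have : CompleteSpace E := FiniteDimensional.complete ℝ E
  exact MDifferentiableAt.mpullback_vectorField (n := ∞) hX (contMDiff_liftMap hf).contMDiffAt
    (isInvertible_dLift hf hΦ u) (ENat.LEInfty.out)

theorem field1_pull1 (Y : Π u, V1 E' N u) : field1 (pull1 f Y) = pullT (E := E) f (field1 Y) := by
  funext u
  refine ((pullT_eq_iff hf hΦ).2 ?_).symm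
  rw [field1, field1, dLift_vlift hf]
  congr 1
  refine liftV_ext hf ?_ fun W => ?_
  · rw [prV1_inclV1, prV1_inclV1, lift1_pull1 hf]
  · rw [prV2_inclV1, prV2_inclV1, zero_apply, zero_apply]

theorem vlift_pullV (s : Π u, V E' N u) :
    (fun u => vlift u (pullV f s u)) = pullT (E := E) f fun u => vlift u (s u) := by
  funext u
  refine ((pullT_eq_iff hf hΦ).2 ?_).symm
  rw [dLift_vlift hf, liftV_pullV hf]

/-- The section is embedded in the tangent bundle by the vertical lift, pulled back as a vector
field, and recovered by the vertical projection. Differentiability then follows from the result for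
vector fields. -/
theorem diffV_pullV {s : Π u, V E' N u} {u : Total E M} (hs : DiffV s (liftMap f u)) :
    DiffV (pullV f s) u := by
  have h := Φ.diffV_vert (diffT_pullT hf hΦ hs.diffT_vlift)
  rw [← vlift_pullV hf hΦ] at h
  simpa only [Φ.H.vert_vlift] using h

theorem diff1_pull1 {Y : Π u, V1 E' N u} {u : Total E M} (hY : Diff1 Y (liftMap f u)) :
    Diff1 (pull1 f Y) u := by
  have h := Φ.diff1_prLeaf (diffT_pullT hf hΦ hY.diffT_field1)
  rw [← field1_pull1 hf hΦ] at h
  simpa only [field1, Φ.prLeaf_vlift, prV1_inclV1] using h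

theorem dLift_mlieBracket {X X' : Π u : Total E' N, TangentSpace (model E') u} {u : Total E M}
    (hX : DiffT X (liftMap f u)) (hX' : DiffT X' (liftMap f u)) :
    dLift f u (mlieBracket (model E) (pullT f X) (pullT f X') u) =
      mlieBracket (model E') X X' (liftMap f u) := by
  have : CompleteSpace E := FiniteDimensional.complete ℝ E
  have : CompleteSpace E' := FiniteDimensional.complete ℝ E'
  have h1 : IsManifold (model E) (minSmoothness ℝ 2) (Total E M) := by
    simpa using (inferInstance : IsManifold (model E) 2 (Total E M))
  have h2 : IsManifold (model E') (minSmoothness ℝ 2) (Total E' N) := by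
    simpa using (inferInstance : IsManifold (model E') 2 (Total E' N))
  refine ((pullT_eq_iff hf hΦ).1 ?_).symm
  exact mpullback_mlieBracket (n := ∞) hX hX' (contMDiff_liftMap hf).contMDiffAt
    (by
      rw [minSmoothness_of_isRCLikeNormedField]
      exact ENat.LEInfty.out)

/-! ### The structures of a double field and of its pull-back -/

theorem vert_dLift (u : Total E M) (Z : TangentSpace (model E) u) :
    Φ'.H.vert (liftMap f u) (dLift f u Z) = liftV f u (Φ.H.vert u Z) :=
  hΦ.H u Z

theorem prLeaf_dLift (u : Total E M) (Z : TangentSpace (model E) u) :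
    Φ'.prLeaf (liftMap f u) (dLift f u Z) = lift1 f u (Φ.prLeaf u Z) := by
  change prV1 _ (Φ'.H.vert (liftMap f u) (dLift f u Z)) = _
  rw [vert_dLift hf hΦ, prV1_liftV]
  rfl

theorem sharp_lift {u : Total E M} {a : V1 E' N (liftMap f u) →L[ℝ] ℝ} {b : V1 E M u →L[ℝ] ℝ}
    (h : ∀ Y, a (lift1 f u Y) = b Y) : Φ'.sharp _ a = lift1 f u (Φ.sharp u b) := by
  have h1 : Φ'.σ _ (lift1 f u (Φ.sharp u b)) = a := by
    ext Y
    rw [← lift1_colift1 hf u Y, hΦ.σ, Φ.sigma_sharp, h]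
  rw [← h1, Φ'.sharp_sigma]

theorem coordU_liftV (ε : ℝ) (u : Total E M) (w : V E M u) :
    Φ'.coordU ε _ (liftV f u w) = lift1 f u (Φ.coordU ε u w) := by
  have h : Φ'.sharp _ (prV2 _ (liftV f u w) - Φ'.ψ _ (prV1 _ (liftV f u w))) =
      lift1 f u (Φ.sharp u (prV2 u w - Φ.ψ u (prV1 u w))) := by
    refine sharp_lift hf hΦ fun Y => ?_
    rw [sub_apply, sub_apply, prV2_liftV_lift1 hf, prV1_liftV, hΦ.ψ]
  rw [DoubleField.coordU_apply, h, prV1_liftV, DoubleField.coordU_apply, ← lift1L_apply,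
    ← lift1L_apply, ← lift1L_apply, map_smul, map_add, map_smul]

theorem iota_lift1 (ε : ℝ) (u : Total E M) (Y : V1 E M u) :
    Φ'.iota ε _ (lift1 f u Y) = liftV f u (Φ.iota ε u Y) := by
  refine liftV_ext hf ?_ fun W => ?_
  · rw [Φ'.prV1_iota, Φ.prV1_iota]
  · rw [Φ'.prV2_iota, Φ.prV2_iota, add_apply, smul_apply, add_apply, smul_apply, hΦ.ψ, hΦ.σ]

theorem gV_liftV (u : Total E M) (w w' : V E M u) :
    Φ'.gV _ (liftV f u w) (liftV f u w') = Φ.gV u w w' := by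
  simp only [DoubleField.gV_eq, coordU_liftV hf hΦ, hΦ.σ]

theorem prU_liftV {ε : ℝ} (hε : ε = 1 ∨ ε = -1) (u : Total E M) (w : V E M u) :
    Φ'.prU ε _ (liftV f u w) = liftV f u (Φ.prU ε u w) := by
  rw [Φ'.prU_eq hε, Φ.prU_eq hε, coordU_liftV hf hΦ, iota_lift1 hf hΦ]

theorem gSigmaL_dLift (u : Total E M) (Z Z' : TangentSpace (model E) u) :
    Φ'.gSigmaL _ (dLift f u Z) (dLift f u Z') = Φ.gSigmaL u Z Z' := by
  have h : Φ'.sharp _ (prV2 _ (liftV f u (Φ.H.vert u Z))) =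
      lift1 f u (Φ.sharp u (prV2 u (Φ.H.vert u Z))) :=
    sharp_lift hf hΦ fun Y => prV2_liftV_lift1 hf u _ Y
  rw [Φ'.gSigmaL_apply, Φ.gSigmaL_apply]
  change Φ'.σ _ (dproj _ (dLift f u Z)) (dproj _ (dLift f u Z')) + _ + _ =
    Φ.σ u (dproj u Z) (dproj u Z') + _ + _
  rw [dproj_dLift hf, dproj_dLift hf, vert_dLift hf hΦ, vert_dLift hf hΦ, prV1_liftV, prV1_liftV,
    hΦ.σ, hΦ.σ, h, prV2_liftV_lift1 hf]

theorem prTransverse_dLift (u : Total E M) (Z : TangentSpace (model E) u) :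
    Φ'.prTransverse _ (dLift f u Z) = dLift f u (Φ.prTransverse u Z) := by
  have h : inclV1 _ (lift1 f u (Φ.prLeaf u Z)) = liftV (E' := E') f u (inclV1 u (Φ.prLeaf u Z)) := by
    refine liftV_ext hf ?_ fun W => ?_
    · rw [prV1_inclV1, prV1_inclV1]
    · rw [prV2_inclV1, prV2_inclV1, zero_apply, zero_apply]
  rw [Φ'.prTransverse_apply, Φ.prTransverse_apply, prLeaf_dLift hf hΦ,
    ContinuousLinearMap.map_sub, dLift_vlift hf, h]

/-! ### Pull-backs of sections -/

theorem sigma_pull1 (Y W : Π u, V1 E' N u) (u : Total E M) :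
    Φ.σ u (pull1 f Y u) (pull1 f W u) = Φ'.σ _ (Y (liftMap f u)) (W (liftMap f u)) := by
  rw [← lift1_pull1 hf Y, ← lift1_pull1 hf W, hΦ.σ]

theorem psi_pull1 (Y W : Π u, V1 E' N u) (u : Total E M) :
    Φ.ψ u (pull1 f Y u) (pull1 f W u) = Φ'.ψ _ (Y (liftMap f u)) (W (liftMap f u)) := by
  rw [← lift1_pull1 hf Y, ← lift1_pull1 hf W, hΦ.ψ]

theorem gSigmaL_pullT (X X' : Π u : Total E' N, TangentSpace (model E') u) (u : Total E M) :
    Φ.gSigmaL u (pullT f X u) (pullT f X' u) =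
      Φ'.gSigmaL _ (X (liftMap f u)) (X' (liftMap f u)) := by
  rw [← dLift_pullT hf hΦ X, ← dLift_pullT hf hΦ X', gSigmaL_dLift hf hΦ]

theorem pull1_prLeaf (X : Π u : Total E' N, TangentSpace (model E') u) :
    pull1 f (fun v => Φ'.prLeaf v (X v)) = fun v => Φ.prLeaf v (pullT f X v) := by
  funext u
  refine lift1_injective hf u ?_
  rw [lift1_pull1 hf, ← prLeaf_dLift hf hΦ, dLift_pullT hf hΦ]

theorem pullT_prTransverse (X : Π u : Total E' N, TangentSpace (model E') u) :
    pullT f (fun v => Φ'.prTransverse v (X v)) = fun v => Φ.prTransverse v (pullT f X v) := by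
  funext u
  rw [pullT_eq_iff hf hΦ, ← prTransverse_dLift hf hΦ, dLift_pullT hf hΦ]

theorem pull1_coordU (ε : ℝ) (s : Π u, V E' N u) :
    pull1 f (fun v => Φ'.coordU ε v (s v)) = fun v => Φ.coordU ε v (pullV f s v) := by
  funext u
  refine lift1_injective hf u ?_
  rw [lift1_pull1 hf, ← coordU_liftV hf hΦ, liftV_pullV hf]

theorem leafBracket_pull1 {Y Y' : Π u, V1 E' N u} {u : Total E M} (hY : Diff1 Y (liftMap f u))
    (hY' : Diff1 Y' (liftMap f u)) :
    Φ'.leafBracket Y Y' (liftMap f u) = lift1 f u (Φ.leafBracket (pull1 f Y) (pull1 f Y') u) := by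
  change Φ'.prLeaf _ _ = lift1 f u (Φ.prLeaf u _)
  rw [← dLift_mlieBracket hf hΦ hY.diffT_field1 hY'.diffT_field1, prLeaf_dLift hf hΦ,
    field1_pull1 hf hΦ, field1_pull1 hf hΦ]

theorem leafDPsi_pull1 {Y Y' Y'' : Π u, V1 E' N u} {u : Total E M} (hY : Diff1 Y (liftMap f u))
    (hY' : Diff1 Y' (liftMap f u)) (hY'' : Diff1 Y'' (liftMap f u)) :
    Φ'.leafDPsi Y Y' Y'' (liftMap f u) =
      Φ.leafDPsi (pull1 f Y) (pull1 f Y') (pull1 f Y'') u := by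
  have hd : ∀ {W W' W'' : Π u, V1 E' N u}, Diff1 W (liftMap f u) → Diff1 W' (liftMap f u) →
      dirDeriv (fun v => Φ'.ψ v (W v) (W' v)) (liftMap f u) (field1 W'' (liftMap f u)) =
        dirDeriv (fun v => Φ.ψ v (pull1 f W v) (pull1 f W' v)) u (field1 (pull1 f W'') u) := by
    intro W W' W'' hW hW'
    simp only [psi_pull1 hf hΦ]
    rw [← dirDeriv_dLift hf (Φ'.mdifferentiableAt_psi hW hW'), field1_pull1 hf hΦ,
      dLift_pullT hf hΦ]
  have hb : ∀ {W W' W'' : Π u, V1 E' N u}, Diff1 W (liftMap f u) → Diff1 W' (liftMap f u) →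
      Φ'.ψ _ (Φ'.leafBracket W W' (liftMap f u)) (W'' (liftMap f u)) =
        Φ.ψ u (Φ.leafBracket (pull1 f W) (pull1 f W') u) (pull1 f W'' u) := by
    intro W W' W'' hW hW'
    rw [leafBracket_pull1 hf hΦ hW hW', ← lift1_pull1 hf W'', hΦ.ψ]
  rw [DoubleField.leafDPsi, DoubleField.leafDPsi, hd hY' hY'', hd hY'' hY, hd hY hY', hb hY hY',
    hb hY' hY'', hb hY'' hY]

theorem koszul_pullT {X Y W : Π u : Total E' N, TangentSpace (model E') u} {u : Total E M}
    (hX : DiffT X (liftMap f u)) (hY : DiffT Y (liftMap f u)) (hW : DiffT W (liftMap f u)) :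
    koszul Φ'.gSigmaL X Y W (liftMap f u) =
      koszul Φ.gSigmaL (pullT f X) (pullT f Y) (pullT f W) u := by
  have hd : ∀ {X Y W : Π u : Total E' N, TangentSpace (model E') u}, DiffT X (liftMap f u) →
      DiffT Y (liftMap f u) →
      mvfderiv (model E') (fun v => Φ'.gSigmaL v (X v) (Y v)) (liftMap f u) (W (liftMap f u)) =
        mvfderiv (model E) (fun v => Φ.gSigmaL v (pullT f X v) (pullT f Y v)) u
          (pullT f W u) := by
    intro X Y W hX hY
    simp only [gSigmaL_pullT hf hΦ]
    rw [← dLift_pullT hf hΦ W u]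
    exact dirDeriv_dLift hf (mdifferentiableAt_form
      (Φ'.contMDiffAt_gSigmaL _) hX hY) _
  have hb : ∀ {X Y W : Π u : Total E' N, TangentSpace (model E') u}, DiffT X (liftMap f u) →
      DiffT Y (liftMap f u) →
      Φ'.gSigmaL _ (mlieBracket (model E') X Y (liftMap f u)) (W (liftMap f u)) =
        Φ.gSigmaL u (mlieBracket (model E) (pullT f X) (pullT f Y) u) (pullT f W u) := by
    intro X Y W hX hY
    rw [← dLift_mlieBracket hf hΦ hX hY, ← dLift_pullT hf hΦ W u, gSigmaL_dLift hf hΦ]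
  rw [koszul, koszul, hd hY hW, hd hX hW, hd hX hY, hb hX hY, hb hX hW, hb hY hW]

end Lift
end BigTangent

/-! ### Naturality of the successive connections -/

namespace BigTangent
open BundleAux VectorField

section Naturality

variable {E : Type*} [NormedAddCommGroup E] [NormedSpace ℝ E] [FiniteDimensional ℝ E]
  {M : Type*} [TopologicalSpace M] [ChartedSpace E M] [IsManifold 𝓘(ℝ, E) ∞ M]
  {E' : Type*} [NormedAddCommGroup E'] [NormedSpace ℝ E'] [FiniteDimensional ℝ E']
  {N : Type*} [TopologicalSpace N] [ChartedSpace E' N] [IsManifold 𝓘(ℝ, E') ∞ N]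

/-- The lift of `f` carries the connection `D` on `V₁` to `D'`. -/
def Carries1 (f : M → N) (D : Conn1 E M) (D' : Conn1 E' N) : Prop :=
  ∀ (u : Total E M) (Y : Π u, V1 E' N u), Diff1 Y (liftMap f u) →
    ∀ Z : TangentSpace (model E) u,
      D' Y (liftMap f u) (dLift f u Z) = lift1 f u (D (pull1 f Y) u Z)

/-- The lift of `f` carries the connection `D` on `V` to `D'`. -/
def CarriesV (f : M → N) (D : ConnV E M) (D' : ConnV E' N) : Prop :=
  ∀ (u : Total E M) (s : Π u, V E' N u), DiffV s (liftMap f u) →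
    ∀ Z : TangentSpace (model E) u,
      D' s (liftMap f u) (dLift f u Z) = liftV f u (D (pullV f s) u Z)

variable {f : M → N} (hf : IsLocalDiffeomorph 𝓘(ℝ, E) 𝓘(ℝ, E') ∞ f)
  {Φ : DoubleField E M} {Φ' : DoubleField E' N} (hΦ : IsPullback f Φ Φ')

include hf hΦ

open DoubleField

/-- Both sides have the same pairing with every vector field: the Koszul expression is natural,
since derivatives, brackets and g_σ are. -/
theorem leviCivita_dLift (C : Φ.FieldAdapted) (C' : Φ'.FieldAdapted)
    {X Y : Π u : Total E' N, TangentSpace (model E') u} {u : Total E M}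
    (hX : DiffT X (liftMap f u)) (hY : DiffT Y (liftMap f u)) :
    C'.Dσ Y (liftMap f u) (X (liftMap f u)) =
      dLift f u (C.Dσ (pullT f Y) u (pullT f X u)) := by
  have hinj : Function.Injective (Φ'.gSigmaL (liftMap f u)) := by
    obtain ⟨d, hd⟩ := Φ'.gSigmaL_isInvertible (liftMap f u)
    rw [← hd]
    exact d.injective
  refine hinj (ContinuousLinearMap.ext fun Z => ?_)
  obtain ⟨W, hW, rfl⟩ := exists_diffT (liftMap f u) Z
  rw [C'.koszul_formula hX hY hW.diffT, koszul_pullT hf hΦ hX hY hW.diffT,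
    ← C.koszul_formula (diffT_pullT hf hΦ hX) (diffT_pullT hf hΦ hY) (diffT_pullT hf hΦ hW.diffT),
    ← dLift_pullT hf hΦ W u, gSigmaL_dLift hf hΦ]

theorem carries_Dprime0 (C : Φ.FieldAdapted) (C' : Φ'.FieldAdapted) :
    Carries1 f C.Dprime0 C'.Dprime0 := by
  intro u Y hY Z
  -- Z is extended by first extending its image on the target and then pulling back, so that the
  -- fields on both sides are related by the lift.
  obtain ⟨X, hX, hXZ⟩ := exists_diffT (liftMap f u) (dLift (E' := E') f u Z)
  have hZ : pullT f X u = Z := (pullT_eq_iff hf hΦ).2 hXZ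
  have hL := (Φ'.diff1_prLeaf hX.diffT).diffT_field1
  have hT := Φ'.diffT_prTransverse hX.diffT
  rw [← hXZ, Φ'.prime_formula C' hX.diffT hY, ← hZ,
    Φ.prime_formula C (diffT_pullT hf hΦ hX.diffT) (diff1_pull1 hf hΦ hY), primeExpr, primeExpr,
    leviCivita_dLift hf hΦ C C' hL hY.diffT_field1, ← dLift_mlieBracket hf hΦ hT hY.diffT_field1,
    ← ContinuousLinearMap.map_add, prLeaf_dLift hf hΦ, ← field1_pull1 hf hΦ, ← field1_pull1 hf hΦ,
    pull1_prLeaf hf hΦ, pullT_prTransverse hf hΦ]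

theorem carries_of_isMetrization {D₁ D : Conn1 E M} {D₁' D' : Conn1 E' N}
    (h : Φ.IsMetrization D₁ D) (h' : Φ'.IsMetrization D₁' D') (hc : Carries1 f D₁ D₁') :
    Carries1 f D D' := by
  intro u Y hY Z
  refine Φ'.sigma_ext fun W hW => ?_
  rw [h'.formula hY hW, dirDeriv_dLift hf (Φ'.mdifferentiableAt_sigma hY hW), hc u Y hY, hc u W hW,
    ← lift1_pull1 hf W, ← lift1_pull1 hf Y, hΦ.σ, hΦ.σ, hΦ.σ,
    h.formula (diff1_pull1 hf hΦ hY) (diff1_pull1 hf hΦ hW)]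
  simp only [sigma_pull1 hf hΦ]

theorem carries_of_isPsiDeformation {ε : ℝ} {D0 D : Conn1 E M} {D0' D' : Conn1 E' N}
    (h : Φ.IsPsiDeformation ε D0 D) (h' : Φ'.IsPsiDeformation ε D0' D')
    (hc : Carries1 f D0 D0') : Carries1 f D D' := by
  intro u Y hY Z
  obtain ⟨X, hX, hXZ⟩ := exists_diffT (liftMap f u) (dLift (E' := E') f u Z)
  have hZ : pullT f X u = Z := (pullT_eq_iff hf hΦ).2 hXZ
  refine Φ'.sigma_ext fun W hW => ?_
  rw [← hXZ, h'.formula hX.diffT hY hW, leafDPsi_pull1 hf hΦ (Φ'.diff1_prLeaf hX.diffT) hY hW,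
    hXZ, hc u Y hY, ← lift1_pull1 hf W, hΦ.σ, hΦ.σ, pull1_prLeaf hf hΦ, ← hZ,
    h.formula (diffT_pullT hf hΦ hX.diffT) (diff1_pull1 hf hΦ hY) (diff1_pull1 hf hΦ hW)]

theorem carries_of_isPair {Dp Dm : Conn1 E M} {D : ConnV E M} {Dp' Dm' : Conn1 E' N}
    {D' : ConnV E' N} (h : Φ.IsPair Dp Dm D) (h' : Φ'.IsPair Dp' Dm' D')
    (hp : Carries1 f Dp Dp') (hm : Carries1 f Dm Dm') : CarriesV f D D' := by
  intro u s hs Z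
  rw [h'.formula hs, h.formula (diffV_pullV hf hΦ hs), hp u _ (Φ'.diff1_coordU 1 hs),
    hm u _ (Φ'.diff1_coordU (-1) hs), iota_lift1 hf hΦ, iota_lift1 hf hΦ, pull1_coordU hf hΦ,
    pull1_coordU hf hΦ, ← liftVL_apply, ← liftVL_apply, ← liftVL_apply, map_add]

theorem carries_of_isBracketModification {D0 D₁ D : Conn1 E M} {DD0 : ConnV E M}
    {D0' D₁' D' : Conn1 E' N} {DD0' : ConnV E' N} (h0 : Φ.IsPair D0 D0 DD0)
    (h0' : Φ'.IsPair D0' D0' DD0') {ε : ℝ} (hε : ε = 1 ∨ ε = -1)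
    (h : Φ.IsBracketModification ε DD0 D₁ D) (h' : Φ'.IsBracketModification ε DD0' D₁' D')
    (hc0 : Carries1 f D0 D0') (hc : Carries1 f D₁ D₁') : Carries1 f D D' := by
  intro u Y hY Z
  have hε' : -ε = 1 ∨ -ε = -1 := by rcases hε with rfl | rfl <;> simp
  rw [h'.formula h0' hε hY, h.formula h0 hε (diff1_pull1 hf hΦ hY), vert_dLift hf hΦ,
    prU_liftV hf hΦ hε', ← dLift_vlift hf, hc u Y hY, hc u Y hY, hc0 u Y hY, ← lift1L_apply,
    ← lift1L_apply, ← lift1L_apply, ← lift1L_apply, map_add, map_sub]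

theorem contorsion_pullV {D D0 : ConnV E M} {D' D0' : ConnV E' N} (h : CarriesV f D D')
    (h0 : CarriesV f D0 D0') {s s' : Π u, V E' N u} (s'' : Π u, V E' N u) {u : Total E M}
    (hs' : DiffV s' (liftMap f u)) :
    Φ'.contorsion D' D0' s s' s'' (liftMap f u) =
      Φ.contorsion D D0 (pullV f s) (pullV f s') (pullV f s'') u := by
  rw [contorsion, contorsion, ← liftV_pullV hf s, ← liftV_pullV hf s'', ← dLift_vlift hf,
    h u s' hs', h0 u s' hs', ← liftVL_apply, ← liftVL_apply, ← map_sub, liftVL_apply,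
    gV_liftV hf hΦ]

theorem gualtieriTorsion_pullV {D D0 : ConnV E M} {D' D0' : ConnV E' N} (h : CarriesV f D D')
    (h0 : CarriesV f D0 D0') {s s' s'' : Π u, V E' N u} {u : Total E M}
    (hs : DiffV s (liftMap f u)) (hs' : DiffV s' (liftMap f u)) :
    Φ'.gualtieriTorsion D0' D' s s' s'' (liftMap f u) =
      Φ.gualtieriTorsion D0 D (pullV f s) (pullV f s') (pullV f s'') u := by
  rw [gualtieriTorsion_eq, gualtieriTorsion_eq, contorsion_pullV hf hΦ h h0 s'' hs',
    contorsion_pullV hf hΦ h h0 s'' hs, contorsion_pullV hf hΦ h h0 s hs',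
    contorsion_pullV hf hΦ h h0 s' hs]

theorem carries_Dbar (C : Φ.FieldAdapted) (C' : Φ'.FieldAdapted) :
    CarriesV f C.Dbar C'.Dbar := by
  have c0 : Carries1 f C.D0 C'.D0 := carries_of_isMetrization hf hΦ C.D0_metrization
    C'.D0_metrization (carries_Dprime0 hf hΦ C C')
  have cc0 : CarriesV f C.DD0 C'.DD0 := carries_of_isPair hf hΦ C.DD0_pair C'.DD0_pair c0 c0
  have cp : Carries1 f C.DPlus C'.DPlus :=
    carries_of_isMetrization hf hΦ C.DPlus_metrization C'.DPlus_metrization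
      (carries_of_isPsiDeformation hf hΦ C.DprimePlus_psi C'.DprimePlus_psi c0)
  have cm : Carries1 f C.DMinus C'.DMinus :=
    carries_of_isMetrization hf hΦ C.DMinus_metrization C'.DMinus_metrization
      (carries_of_isPsiDeformation hf hΦ C.DprimeMinus_psi C'.DprimeMinus_psi c0)
  have ct : CarriesV f C.Dtilde C'.Dtilde :=
    carries_of_isPair hf hΦ C.Dtilde_pair C'.Dtilde_pair
      (carries_of_isBracketModification hf hΦ C.DD0_pair C'.DD0_pair (Or.inl rfl)
        C.DtildePlus_modification C'.DtildePlus_modification c0 cp)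
      (carries_of_isBracketModification hf hΦ C.DD0_pair C'.DD0_pair (Or.inr rfl)
        C.DtildeMinus_modification C'.DtildeMinus_modification c0 cm)
  intro u s hs Z
  refine Φ'.gV_ext fun w => ?_
  -- The section t extends the vertical part of the image vector; its pull-back extends the vertical
  -- part of Z, as `Dbar_formula` requires on both sides.
  obtain ⟨t, ht, htw⟩ := exists_diffV (liftMap f u) (Φ'.H.vert (liftMap f u) (dLift f u Z))
  obtain ⟨s'', hs'', rfl⟩ := exists_diffV (liftMap f u) w
  have hv : Φ.H.vert u Z = pullV f t u := by
    refine liftV_injective hf u ?_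
    rw [liftV_pullV hf, htw, vert_dLift hf hΦ]
  rw [C'.Dbar_formula ht.diffV hs hs''.diffV htw.symm,
    gualtieriTorsion_pullV hf hΦ ct cc0 ht.diffV hs, ct u s hs, ← liftV_pullV hf s'',
    gV_liftV hf hΦ, gV_liftV hf hΦ, C.Dbar_formula (diffV_pullV hf hΦ ht.diffV)
      (diffV_pullV hf hΦ hs) (diffV_pullV hf hΦ hs''.diffV) hv]

end Naturality

end BigTangent

/-! ### Uniqueness, as naturality under the identity -/

namespace BigTangent
open BundleAux VectorField

section Uniqueness

variable {E : Type*} [NormedAddCommGroup E] [NormedSpace ℝ E] [FiniteDimensional ℝ E]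
  {M : Type*} [TopologicalSpace M] [ChartedSpace E M] [IsManifold 𝓘(ℝ, E) ∞ M]

theorem dBase_id (u : Total E M) :
    dBase (E' := E) (id : M → M) u = ContinuousLinearMap.id ℝ (TangentSpace 𝓘(ℝ, E) u.proj) :=
  mfderiv_id

theorem dBase_id_inverse (u : Total E M) :
    (dBase (E' := E) (id : M → M) u).inverse =
      ContinuousLinearMap.id ℝ (TangentSpace 𝓘(ℝ, E) u.proj) := by
  rw [dBase_id]
  exact ContinuousLinearMap.inverse_id

/-- The equality is not definitional, since the lift involves the differential of the identity and
its inverse. The fibres over different points are nevertheless the same model space, in which the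
following identities are transported. -/
theorem liftMap_id : liftMap (E := E) (E' := E) (id : M → M) = id := by
  funext u
  have h1 : (dBase (E' := E) (id : M → M) u u.2.1 : E) = u.2.1 := by
    rw [dBase_id]
    rfl
  have h2 : (u.2.2 ∘L (dBase (E' := E) (id : M → M) u).inverse : E →L[ℝ] ℝ) = u.2.2 := by
    rw [dBase_id_inverse]
    rfl
  exact congrArg (fun w : E × (E →L[ℝ] ℝ) => (⟨u.proj, w⟩ : Total E M)) (Prod.ext h1 h2)

theorem lift1_id (u : Total E M) (Y : V1 E M u) : (lift1 (E' := E) (id : M → M) u Y : E) = Y := by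
  have h : (dBase (E' := E) (id : M → M) u : E →L[ℝ] E) = ContinuousLinearMap.id ℝ E := dBase_id u
  exact congrArg (fun L : E →L[ℝ] E => L Y) h

theorem liftV_id (u : Total E M) (w : V E M u) :
    (liftV (E' := E) (id : M → M) u w : E × (E →L[ℝ] ℝ)) = w := by
  have h2 : (prV2 u w ∘L (dBase (E' := E) (id : M → M) u).inverse : E →L[ℝ] ℝ) = prV2 u w := by
    rw [dBase_id_inverse]
    rfl
  exact Prod.ext ((prV1_liftV u w).trans (lift1_id u _))
    ((ContinuousLinearMap.ext fun Y => prV2_liftV u w Y).trans h2)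

theorem isLocalDiffeomorph_id : IsLocalDiffeomorph 𝓘(ℝ, E) 𝓘(ℝ, E) ∞ (id : M → M) :=
  (Diffeomorph.refl 𝓘(ℝ, E) M ∞).isLocalDiffeomorph

theorem pullV_id (s : Π u, V E M u) : pullV (E' := E) (id : M → M) s = s := by
  funext u
  have h1 : (liftV (E' := E) (id : M → M) u (pullV id s u) : E × (E →L[ℝ] ℝ)) =
      s (liftMap id u) := liftV_pullV isLocalDiffeomorph_id s u
  have h2 := congrArg (β := E × (E →L[ℝ] ℝ)) (fun F : Total E M → Total E M => (s (F u) : E × (E →L[ℝ] ℝ)))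
    (liftMap_id (E := E) (M := M))
  exact ((liftV_id u _).symm.trans h1).trans h2

theorem dLift_id (u : Total E M) (Z : TangentSpace (model E) u) :
    (dLift (E' := E) (id : M → M) u Z : E × (E × (E →L[ℝ] ℝ))) = Z := by
  have h1 : (dLift (E' := E) (id : M → M) u Z : E × (E × (E →L[ℝ] ℝ))) =
      mfderiv (model E) (model E) (id : Total E M → Total E M) u Z :=
    congrArg (fun F : Total E M → Total E M =>
      (mfderiv (model E) (model E) F u Z : E × (E × (E →L[ℝ] ℝ)))) liftMap_id
  rw [mfderiv_id] at h1
  exact h1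

theorem isPullback_id (Φ : DoubleField E M) : IsPullback (id : M → M) Φ Φ where
  H u Z := by
    have h1 := congrArg₂ (γ := E × (E →L[ℝ] ℝ)) (fun (F : Total E M → Total E M) (W : E × (E × (E →L[ℝ] ℝ))) =>
      (Φ.H.vert (F u) : E × (E × (E →L[ℝ] ℝ)) →L[ℝ] E × (E →L[ℝ] ℝ)) W)
        (liftMap_id (E := E) (M := M)) (dLift_id u Z)
    exact h1.trans (liftV_id u _).symm
  σ u Y Y' := by
    have h1 := congrArg (fun F : Total E M → Total E M =>
      (Φ.σ (F u) : E →L[ℝ] E →L[ℝ] ℝ) (lift1 (E' := E) (id : M → M) u Y) (lift1 id u Y'))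
        (liftMap_id (E := E) (M := M))
    exact h1.trans (congrArg₂ (fun y y' : E => (Φ.σ u : E →L[ℝ] E →L[ℝ] ℝ) y y')
      (lift1_id u Y) (lift1_id u Y'))
  ψ u Y Y' := by
    have h1 := congrArg (fun F : Total E M → Total E M =>
      (Φ.ψ (F u) : E →L[ℝ] E →L[ℝ] ℝ) (lift1 (E' := E) (id : M → M) u Y) (lift1 id u Y'))
        (liftMap_id (E := E) (M := M))
    exact h1.trans (congrArg₂ (fun y y' : E => (Φ.ψ u : E →L[ℝ] E →L[ℝ] ℝ) y y')
      (lift1_id u Y) (lift1_id u Y'))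

/-- The identity is a local diffeomorphism for which Φ is its own pull-back, so naturality between
two runs of the construction for Φ identifies their results. -/
theorem DoubleField.FieldAdapted.Dbar_unique {Φ : DoubleField E M} (C C' : Φ.FieldAdapted) {u : Total E M}
    {s : Π u, V E M u} (hs : DiffV s u) : C.Dbar s u = C'.Dbar s u := by
  have hs' : DiffV s (liftMap (E' := E) (id : M → M) u) := by
    rw [liftMap_id]
    exact hs
  have key : ∀ Z : TangentSpace (model E) u,
      (C.Dbar s u Z : E × (E →L[ℝ] ℝ)) = C'.Dbar s u Z := by
    intro Z
    have h := carries_Dbar isLocalDiffeomorph_id (isPullback_id Φ) C' C u s hs' Z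
    have h1 := congrArg₂ (γ := E × (E →L[ℝ] ℝ)) (fun (F : Total E M → Total E M) (W : E × (E × (E →L[ℝ] ℝ))) =>
      (C.Dbar s (F u) : E × (E × (E →L[ℝ] ℝ)) →L[ℝ] E × (E →L[ℝ] ℝ)) W)
        (liftMap_id (E := E) (M := M)) (dLift_id u Z)
    rw [pullV_id] at h
    exact h1.symm.trans (h.trans (liftV_id u _))
  exact ContinuousLinearMap.ext key

end Uniqueness

end BigTangent

end

theorem proposition5p7
    {E : Type*} [NormedAddCommGroup E] [NormedSpace ℝ E] [FiniteDimensional ℝ E]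
    {M : Type*} [TopologicalSpace M] [ChartedSpace E M] [IsManifold 𝓘(ℝ, E) ∞ M]
    {E' : Type*} [NormedAddCommGroup E'] [NormedSpace ℝ E'] [FiniteDimensional ℝ E']
    {N : Type*} [TopologicalSpace N] [ChartedSpace E' N] [IsManifold 𝓘(ℝ, E') ∞ N]
    (Φ : BigTangent.DoubleField E M) :
    -- the construction can be carried out
    Nonempty Φ.FieldAdapted ∧
    (∀ C : Φ.FieldAdapted,
      -- the modified connection is smooth and double metric, its Gualtieri torsion is a totally
      -- skew symmetric vertical tensor
      (BigTangent.IsSmooth C.Dtilde ∧ Φ.IsDoubleMetric C.Dtilde ∧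
        ∀ u : BigTangent.Total E M, ∃ T : BigTangent.V E M u [⋀^Fin 3]→ₗ[ℝ] ℝ,
          ∀ s s' s'' : Π v, BigTangent.V E M v,
            BigTangent.DiffV s u → BigTangent.DiffV s' u → BigTangent.DiffV s'' u →
              Φ.gualtieriTorsion C.DD0 C.Dtilde s s' s'' u = T ![s u, s' u, s'' u]) ∧
      -- the field-adapted connection is smooth, double metric, with vanishing Gualtieri torsion
      (BigTangent.IsSmooth C.Dbar ∧ Φ.IsDoubleMetric C.Dbar ∧
        ∀ (u : BigTangent.Total E M) (s s' s'' : Π v, BigTangent.V E M v),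
          BigTangent.DiffV s u → BigTangent.DiffV s' u → BigTangent.DiffV s'' u →
            Φ.gualtieriTorsion C.DD0 C.Dbar s s' s'' u = 0)) ∧
    -- the field-adapted connection depends only on the double field
    (∀ (C C' : Φ.FieldAdapted) (u : BigTangent.Total E M) (s : Π v, BigTangent.V E M v),
      BigTangent.DiffV s u → C.Dbar s u = C'.Dbar s u) ∧
    -- the construction is invariant under local diffeomorphisms
    (∀ (Φ' : BigTangent.DoubleField E' N) (f : M → N),
      IsLocalDiffeomorph 𝓘(ℝ, E) 𝓘(ℝ, E') ∞ f → BigTangent.IsPullback f Φ Φ' →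
      ∀ (C : Φ.FieldAdapted) (C' : Φ'.FieldAdapted) (u : BigTangent.Total E M)
        (s : Π v, BigTangent.V E' N v), BigTangent.DiffV s (BigTangent.liftMap f u) →
        ∀ Z : TangentSpace (BigTangent.model E) u,
          C'.Dbar s (BigTangent.liftMap f u)
              (mfderiv (BigTangent.model E) (BigTangent.model E') (BigTangent.liftMap f) u Z) =
            BigTangent.liftV f u (C.Dbar (BigTangent.pullV f s) u Z)) := by
  refine ⟨Φ.nonempty_fieldAdapted, fun C => ⟨⟨?_, C.isDoubleMetric_Dtilde, fun u => ?_⟩,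
    ?_, C.isDoubleMetric_Dbar, fun u s s' s'' hs hs' hs'' => C.gualtieriTorsion_Dbar hs hs' hs''⟩,
    fun C C' u s hs => C.Dbar_unique C' hs, fun Φ' f hf hΦ C C' u s hs Z => ?_⟩
  · exact BigTangent.DoubleField.isSmooth_of_smoothConnection C.smoothConnection_Dtilde
  · exact Φ.exists_torsion_alternatingMap C.isDoubleMetric_Dtilde.2 C.isDoubleMetric_DD0.2 u
  · exact BigTangent.DoubleField.isSmooth_of_smoothConnection C.smoothConnection_Dbar
  · exact BigTangent.carries_Dbar hf hΦ C C' u s hs Z
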